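/- Let $g\ge 1$ and $n\ge 0$ be integers. Let $\Sigma_g$ be a compact connected oriented topological surface of genus $g$ (without boundary), let $Y^n\subset\Sigma_g$ be a set of $n$ distinct points, and let $y_0\in\Sigma_g\setminus Y^n$. Put $\Lambda_{g,n}:=\pi_1(\Sigma_g\setminus Y^n,y_0)$. Let $\hat\Gamma_{g,n}$ be the full mapping class group, i.e. the group of orientation-preserving homeomorphisms $h$ of $\Sigma_g$ with $h(Y^n)=Y^n$, modulo isotopies relative to $Y^n$. For a group $G$, the group $\hat\Gamma_{g,n}$ acts on the set $\mathrm{Hom}(\Lambda_{g,n},G)/G$ of representations modulo conjugation as follows: for a homeomorphism $h$ as above and $\rho\in\mathrm{Hom}(\Lambda_{g,n},G)$, the class $[h]\cdot[\rho]$ is the class of the representation $\alpha\mapsto\rho(\gamma\,.\,(h^{-1}\circ\alpha)\,.\,\gamma^{-1})$, where $\gamma$ is any path in $\Sigma_g\setminus Y^n$ from $y_0$ to $h^{-1}(y_0)$. In particular, if $h(y_0)=y_0$, then $[h]\cdot[\rho]=[\rho\circ (h^{-1})_*]$. Let $\mathrm{Aff}(\mathbb C)=\{(a_{ij})\in\mathrm{GL}_2(\mathbb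 C) : a_{21}=0,\ a_{22}=1\}$ be the group of affine transformations $z\mapsto az+b$ of $\mathbb C$ ($a\in\mathbb C^*$, $b\in\mathbb C$), and let $\rho:\Lambda_{g,n}\to\mathrm{Aff}(\mathbb C)$ be a representation whose image $\mathrm{Im}(\rho)$ is abelian. Then the orbit of the conjugacy class $[\rho]\in\mathrm{Hom}(\Lambda_{g,n},\mathrm{Aff}(\mathbb C))/\mathrm{Aff}(\mathbb C)$ under the action of $\hat\Gamma_{g,n}$ is finite if and only if $\mathrm{Im}(\rho)$ is finite. -/

import Mathlib

open CategoryTheory Topology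

namespace SurfaceMCG

noncomputable section

/-! ### Oriented topological surfaces -/

/-- A map `f : ℂ → ℂ` preserves the orientation at `p` if, on small circles around `p`, the
difference `f (p + z) - f p` winds exactly once, positively, around the origin; in other words if
`(f (p + z) - f p) / z` is nowhere zero and has a continuous logarithm on a punctured disc. -/
def OrientationPreservingAt (f : ℂ → ℂ) (p : ℂ) : Prop :=
  ∃ r : ℝ, 0 < r ∧ ∃ l : ℂ → ℂ, ContinuousOn l (Metric.ball 0 r \ {0}) ∧
    ∀ z ∈ Metric.ball (0 : ℂ) r \ {0}, f (p + z) - f p = z * Complex.exp (l z)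

theorem OrientationPreservingAt.congr {f g : ℂ → ℂ} {p : ℂ} (hf : OrientationPreservingAt f p)
    (h : g =ᶠ[𝓝 p] f) : OrientationPreservingAt g p := by
  obtain ⟨r, hr, l, hl, hfl⟩ := hf
  obtain ⟨e, he, hge⟩ := Metric.eventually_nhds_iff_ball.1 h
  refine ⟨min r e, lt_min hr he, l, hl.mono ?_, fun z hz => ?_⟩
  · exact Set.sdiff_subset_sdiff_left (Metric.ball_subset_ball (min_le_left _ _))
  · have hz1 : z ∈ Metric.ball (0 : ℂ) r \ {0} :=
      ⟨Metric.ball_subset_ball (min_le_left _ _) hz.1, hz.2⟩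
    have hz2 : p + z ∈ Metric.ball p e := by
      have := Metric.ball_subset_ball (min_le_right r e) hz.1
      simpa [Metric.mem_ball, dist_eq_norm] using this
    rw [hge _ hz2, hge p (Metric.mem_ball_self he), hfl z hz1]

theorem OrientationPreservingAt.comp {f g : ℂ → ℂ} {p : ℂ} {s : Set ℂ} (hs : s ∈ 𝓝 p)
    (hfc : ContinuousOn f s) (hf : OrientationPreservingAt f p)
    (hg : OrientationPreservingAt g (f p)) : OrientationPreservingAt (g ∘ f) p := by
  obtain ⟨r, hr, l, hl, hfl⟩ := hf
  obtain ⟨r', hr', l', hl', hgl⟩ := hg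
  have h1 : ∀ᶠ q in 𝓝 p, q ∈ s ∧ f q ∈ Metric.ball (f p) r' :=
    Filter.Eventually.and hs
      ((hfc.continuousAt hs).eventually (Metric.ball_mem_nhds (f p) hr'))
  obtain ⟨e, he, hse⟩ := Metric.eventually_nhds_iff_ball.1 h1
  have hm : ∀ z ∈ Metric.ball (0 : ℂ) (min r e), p + z ∈ Metric.ball p e := fun z hz => by
    have := Metric.ball_subset_ball (min_le_right r e) hz
    simpa [Metric.mem_ball, dist_eq_norm] using this
  have hsub : Metric.ball (0 : ℂ) (min r e) \ {0} ⊆ Metric.ball 0 r \ {0} :=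
    Set.sdiff_subset_sdiff_left (Metric.ball_subset_ball (min_le_left _ _))
  have hw : ∀ z ∈ Metric.ball (0 : ℂ) (min r e) \ {0},
      f (p + z) - f p ∈ Metric.ball (0 : ℂ) r' \ {0} := fun z hz => by
    refine ⟨?_, ?_⟩
    · have := (hse _ (hm z hz.1)).2
      simpa [Metric.mem_ball, dist_eq_norm] using this
    · rw [hfl z (hsub hz)]
      exact mul_ne_zero hz.2 (Complex.exp_ne_zero _)
  refine ⟨min r e, lt_min hr he, fun z => l z + l' (f (p + z) - f p), ?_, fun z hz => ?_⟩
  · refine (hl.mono hsub).add (hl'.comp ?_ hw)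
    refine ContinuousOn.sub (hfc.comp (by fun_prop) fun z hz => (hse _ (hm z hz.1)).1)
      continuousOn_const
  · have h2 := hgl _ (hw z hz)
    rw [add_sub_cancel] at h2
    rw [Function.comp, Function.comp, h2, Complex.exp_add, ← mul_assoc, ← hfl z (hsub hz)]

/-- The pregroupoid of continuous orientation-preserving maps between open subsets of `ℂ`. -/
def orientationPregroupoid : Pregroupoid ℂ where
  property f s := ContinuousOn f s ∧ ∀ p ∈ s, OrientationPreservingAt f p
  comp {f g u v} hf hg hu hv huv := by
    refine ⟨hg.1.comp (hf.1.mono Set.inter_subset_left) fun x hx => hx.2, fun p hp => ?_⟩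
    exact OrientationPreservingAt.comp (hu.mem_nhds hp.1) hf.1 (hf.2 p hp.1) (hg.2 _ hp.2)
  id_mem := ⟨continuousOn_id, fun p _ => ⟨1, one_pos, fun _ => 0, continuousOn_const,
    fun z _ => by simp⟩⟩
  locality {f u} hu h := by
    refine ⟨fun x hx => ?_, fun p hp => ?_⟩
    · obtain ⟨v, hv, hxv, h⟩ := h x hx
      exact ((h.1.continuousAt ((hu.inter hv).mem_nhds ⟨hx, hxv⟩))).continuousWithinAt
    · obtain ⟨v, _, hpv, h⟩ := h p hp
      exact h.2 p ⟨hp, hpv⟩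
  congr {f g u} hu hfg hf :=
    ⟨hf.1.congr hfg, fun p hp => (hf.2 p hp).congr (Filter.eventually_of_mem (hu.mem_nhds hp) hfg)⟩

/-- The structure groupoid of orientation-preserving homeomorphisms between open subsets of the
plane. An oriented topological surface is a space `S` with `[ChartedSpace ℂ S]` and
`[HasGroupoid S orientationGroupoid]`. -/
def orientationGroupoid : StructureGroupoid ℂ := orientationPregroupoid.groupoid

/-- The `4g`-gon is the closed unit disc; its boundary is divided into `4g` sides, and
`boundaryPoint g s` is the point `exp (2πi s / (4g))`, so that side `j` (`0 ≤ j < 4g`) is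
`{boundaryPoint g (j + t) | t ∈ [0,1]}`. -/
def boundaryPoint (g : ℕ) (s : ℝ) : Metric.closedBall (0 : ℂ) 1 :=
  ⟨Complex.exp ((2 * Real.pi * s / (4 * g) : ℝ) * Complex.I), by
    rw [mem_closedBall_zero_iff, Complex.norm_exp_ofReal_mul_I]⟩

/-- The side identifications of the boundary word
`a₁ b₁ a₁⁻¹ b₁⁻¹ ⋯ a_g b_g a_g⁻¹ b_g⁻¹`: the sides `4k` and `4k+2` (for `i = 0`), respectively
`4k+1` and `4k+3` (for `i = 1`), are glued with reversed direction. -/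
def sideGluing (g : ℕ) (z w : Metric.closedBall (0 : ℂ) 1) : Prop :=
  ∃ k < g, ∃ i < 2, ∃ t ∈ Set.Icc (0 : ℝ) 1,
    z = boundaryPoint g (4 * (k : ℕ) + (i : ℕ) + t) ∧
    w = boundaryPoint g (4 * (k : ℕ) + (i : ℕ) + 3 - t)

/-- The standard closed surface of genus `g ≥ 1`: the quotient of a `4g`-gon by the (equivalence
relation generated by the) side identifications `∏ aₖ bₖ aₖ⁻¹ bₖ⁻¹`. -/
def GenusSurface (g : ℕ) : Type := Quot (sideGluing g)

instance (g : ℕ) : TopologicalSpace (GenusSurface g) :=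
  inferInstanceAs (TopologicalSpace (Quot (sideGluing g)))

/-! ### The mapping class group -/

section MappingClassGroup

variable {S : Type*} [TopologicalSpace S]

/-- A self-homeomorphism of an oriented surface preserves the orientation if it does so in all
charts of the oriented atlas. -/
def IsOrientationPreserving [ChartedSpace ℂ S] (h : S ≃ₜ S) : Prop :=
  ∀ c ∈ atlas ℂ S, ∀ c' ∈ atlas ℂ S,
    c.symm.trans (h.toOpenPartialHomeomorph.trans c') ∈ orientationGroupoid

variable [ChartedSpace ℂ S] [HasGroupoid S orientationGroupoid]

/-- `Homeo₊(S, Y)`: orientation-preserving self-homeomorphisms of `S` that preserve the set `Y`. -/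
def HomeoPlus (Y : Finset S) : Subgroup (S ≃ₜ S) where
  carrier := {h | IsOrientationPreserving h ∧ ∀ x, h x ∈ Y ↔ x ∈ Y}
  one_mem' := ⟨fun c hc c' hc' =>
    (Structomorph.refl (G := orientationGroupoid) S).mem_groupoid c c' hc hc', fun _ => Iff.rfl⟩
  mul_mem' {a b} ha hb := by
    refine ⟨fun c hc c' hc' => ?_, fun x => (ha.2 (b x)).trans (hb.2 x)⟩
    exact (Structomorph.trans (G := orientationGroupoid)
      ⟨b, fun c c' hc hc' => hb.1 c hc c' hc'⟩
      ⟨a, fun c c' hc hc' => ha.1 c hc c' hc'⟩).mem_groupoid c c' hc hc'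
  inv_mem' {a} ha := by
    refine ⟨fun c hc c' hc' => ?_, fun x => ?_⟩
    · exact (Structomorph.symm (G := orientationGroupoid)
        ⟨a, fun c c' hc hc' => ha.1 c hc c' hc'⟩).mem_groupoid c c' hc hc'
    · have := ha.2 (a⁻¹ x)
      rw [show a (a⁻¹ x) = x from a.apply_symm_apply x] at this
      exact this.symm

/-- `h` is isotopic to the identity relative to `Y`: there is a continuous family of homeomorphisms
of `S`, all fixing `Y` pointwise, from the identity to `h`. -/
def IsotopicToId (Y : Finset S) (h : S ≃ₜ S) : Prop :=
  ∃ H : unitInterval → (S ≃ₜ S), Continuous (fun p : unitInterval × S => H p.1 p.2) ∧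
    (∀ t, ∀ y ∈ Y, H t y = y) ∧ H 0 = 1 ∧ H 1 = h

/-- The normal subgroup of `Homeo₊(S, Y)` of the elements that are isotopic to the identity
relative to `Y`. -/
def isotopySubgroup (Y : Finset S) : Subgroup (HomeoPlus Y) where
  carrier := {h | IsotopicToId Y (h : S ≃ₜ S)}
  one_mem' := ⟨fun _ => 1, continuous_snd, fun _ _ _ => rfl, rfl, rfl⟩
  mul_mem' {a b} := by
    rintro ⟨H, hc, hY, h0, h1⟩ ⟨K, kc, kY, k0, k1⟩
    refine ⟨fun t => H t * K t, ?_, fun t y hy => ?_, by simp [h0, k0], by simp [h1, k1]⟩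
    · exact hc.comp (continuous_fst.prodMk kc)
    · change H t (K t y) = y
      rw [kY t y hy, hY t y hy]
  inv_mem' {a} := by
    rintro ⟨H, hc, hY, h0, h1⟩
    refine ⟨fun t => H (unitInterval.symm t) * (a : S ≃ₜ S)⁻¹, ?_, fun t y hy => ?_, ?_, ?_⟩
    · exact hc.comp ((unitInterval.continuous_symm.comp continuous_fst).prodMk
        ((a : S ≃ₜ S)⁻¹.continuous.comp continuous_snd))
    · have ha : (a : S ≃ₜ S)⁻¹ y = y := by
        rw [← h1]
        exact (Equiv.symm_apply_eq (H 1).toEquiv).2 (hY 1 y hy).symm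
      change H (unitInterval.symm t) ((a : S ≃ₜ S)⁻¹ y) = y
      rw [ha, hY _ y hy]
    · simp [h1]
    · simp [h0]

instance (Y : Finset S) : (isotopySubgroup Y).Normal where
  conj_mem a := by
    rintro ⟨H, hc, hY, h0, h1⟩ b
    refine ⟨fun t => (b : S ≃ₜ S) * H t * (b : S ≃ₜ S)⁻¹, ?_, fun t y hy => ?_, ?_, ?_⟩
    · exact (b : S ≃ₜ S).continuous.comp (hc.comp (continuous_fst.prodMk
        ((b : S ≃ₜ S)⁻¹.continuous.comp continuous_snd)))
    · have hb : (b : S ≃ₜ S)⁻¹ y ∈ Y := (((HomeoPlus Y).inv_mem b.2).2 y).2 hy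
      change (b : S ≃ₜ S) (H t ((b : S ≃ₜ S)⁻¹ y)) = y
      rw [hY t _ hb]
      exact (b : S ≃ₜ S).apply_symm_apply y
    · simp [h0]
    · simp [h1]

/-- The full mapping class group of `(S, Y)`. -/
abbrev MappingClassGroup (Y : Finset S) : Type _ := HomeoPlus Y ⧸ isotopySubgroup Y

end MappingClassGroup

/-! ### Fundamental group and representations modulo conjugation -/

section Representations

/-- The fundamental group, with concatenation "first `α`, then `α'`" as its product `α * α'`
(the product of `FundamentalGroup` is composition in the opposite order). -/
abbrev PiOne (X : Type*) [TopologicalSpace X] (x : X) : Type _ := (FundamentalGroup X x)ᵐᵒᵖ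

/-- Representations are equivalent if they are conjugate by an element of the target group. -/
def conjSetoid (L G : Type*) [Group L] [Group G] : Setoid (L →* G) where
  r ρ ρ' := ∃ c : G, ∀ a, ρ' a = c * ρ a * c⁻¹
  iseqv := by
    refine ⟨fun ρ => ⟨1, by simp⟩, ?_, ?_⟩
    · rintro ρ ρ' ⟨c, hc⟩
      exact ⟨c⁻¹, fun a => by rw [hc]; group⟩
    · rintro ρ ρ' ρ'' ⟨c, hc⟩ ⟨d, hd⟩
      exact ⟨d * c, fun a => by rw [hd, hc]; group⟩

/-- `Hom(L, G) / G`, the representations of `L` in `G` modulo conjugation. -/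
def RepClass (L G : Type*) [Group L] [Group G] : Type _ := Quotient (conjSetoid L G)

/-- The conjugacy class `[ρ]` of a representation. -/
def repClass {L G : Type*} [Group L] [Group G] (ρ : L →* G) : RepClass L G :=
  Quotient.mk (conjSetoid L G) ρ

theorem repClass_eq {L G : Type*} [Group L] [Group G] {ρ ρ' : L →* G} (c : G)
    (h : ∀ a, ρ' a = c * ρ a * c⁻¹) : repClass ρ = repClass ρ' :=
  Quotient.sound (s := conjSetoid L G) ⟨c, h⟩

/-- In a groupoid, for a functor `F` and a morphism `γ : x ⟶ F x`, the endomorphism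
`a ↦ γ ≫ F a ≫ γ⁻¹` of the vertex group at `x` (whose product is `≫`). -/
def conjEnd {C : Type*} [Groupoid C] (F : C ⥤ C) {x : C} (γ : x ⟶ F.obj x) :
    (End x)ᵐᵒᵖ →* (End x)ᵐᵒᵖ where
  toFun a := MulOpposite.op (End.of (γ ≫ F.map a.unop.asHom ≫ Groupoid.inv γ))
  map_one' := by
    apply MulOpposite.unop_injective
    change γ ≫ F.map (𝟙 x) ≫ Groupoid.inv γ = 𝟙 x
    simp
  map_mul' a b := by
    apply MulOpposite.unop_injective
    change γ ≫ F.map (a.unop.asHom ≫ b.unop.asHom) ≫ Groupoid.inv γ =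
      (γ ≫ F.map a.unop.asHom ≫ Groupoid.inv γ) ≫ (γ ≫ F.map b.unop.asHom ≫ Groupoid.inv γ)
    simp

/-- Changing the connecting morphism changes `conjEnd` by an inner automorphism. -/
theorem conjEnd_change {C : Type*} [Groupoid C] (F : C ⥤ C) {x : C} (γ γ' : x ⟶ F.obj x)
    (a : (End x)ᵐᵒᵖ) :
    conjEnd F γ' a = MulOpposite.op (End.of (γ' ≫ Groupoid.inv γ)) * conjEnd F γ a *
      (MulOpposite.op (End.of (γ' ≫ Groupoid.inv γ)))⁻¹ := by
  rw [eq_mul_inv_iff_mul_eq]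
  apply MulOpposite.unop_injective
  change (γ' ≫ F.map a.unop.asHom ≫ Groupoid.inv γ') ≫ (γ' ≫ Groupoid.inv γ) =
    (γ' ≫ Groupoid.inv γ) ≫ (γ ≫ F.map a.unop.asHom ≫ Groupoid.inv γ)
  simp

theorem conj_one_aux {C : Type*} [Groupoid C] {x : C} (a : x ⟶ x) :
    𝟙 x ≫ a ≫ Groupoid.inv (𝟙 x) = a := by
  simp

theorem conj_comp_aux {C : Type*} [Groupoid C] (F : C ⥤ C) {x y : C} (γ : x ⟶ F.obj x)
    (γ' : x ⟶ y) (b : y ⟶ y) :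
    γ ≫ F.map (γ' ≫ b ≫ Groupoid.inv γ') ≫ Groupoid.inv γ =
      (γ ≫ F.map γ') ≫ F.map b ≫ Groupoid.inv (γ ≫ F.map γ') := by
  simp

theorem conj_nat_aux {C : Type*} [Groupoid C] {F F' : C ⥤ C} (η : F ⟶ F') {x : C}
    (γ : x ⟶ F.obj x) (a : x ⟶ x) :
    γ ≫ F.map a ≫ Groupoid.inv γ =
      (γ ≫ η.app x) ≫ F'.map a ≫ Groupoid.inv (γ ≫ η.app x) := by
  simp

variable {X : Type*} [TopologicalSpace X] {x : X}

/-- Homotopy classes of paths from `x` to `y`. -/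
abbrev PathClass (x y : X) : Type _ := FundamentalGroupoid.mk x ⟶ FundamentalGroupoid.mk y

/-- For a continuous `f : X → X` and a homotopy class `γ` of paths from `x` to `f x`, the
endomorphism `α ↦ γ . (f ∘ α) . γ⁻¹` of `π₁(X, x)`. -/
def inducedHom (f : C(X, X)) (γ : PathClass x (f x)) : PiOne X x →* PiOne X x :=
  conjEnd (FundamentalGroupoid.map f) γ

theorem repClass_inducedHom (f : C(X, X)) (γ γ' : PathClass x (f x)) {G : Type*} [Group G]
    (ρ : PiOne X x →* G) :
    repClass (ρ.comp (inducedHom f γ)) = repClass (ρ.comp (inducedHom f γ')) := by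
  refine repClass_eq (ρ (MulOpposite.op (End.of (γ' ≫ Groupoid.inv γ)))) fun a => ?_
  have h := conjEnd_change (FundamentalGroupoid.map f) γ γ' a
  exact (congrArg ρ h).trans (by rw [map_mul, map_mul, map_inv]; rfl)

theorem inducedHom_id : inducedHom (ContinuousMap.id X) (𝟙 (FundamentalGroupoid.mk x)) =
    MonoidHom.id (PiOne X x) := by
  ext a
  apply MulOpposite.unop_injective
  obtain ⟨p, hp⟩ := Path.Homotopic.Quotient.mk_surjective a.unop
  change 𝟙 (FundamentalGroupoid.mk x) ≫
    (FundamentalGroupoid.map (ContinuousMap.id X)).map a.unop.asHom ≫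
      Groupoid.inv (𝟙 (FundamentalGroupoid.mk x)) = a.unop.asHom
  have h : (FundamentalGroupoid.map (ContinuousMap.id X)).map a.unop.asHom = a.unop.asHom := by
    rw [← hp]; rfl
  rw [h]
  exact conj_one_aux _

theorem inducedHom_comp (f g : C(X, X)) (γ : PathClass x (f x)) (γ' : PathClass x (g x)) :
    (inducedHom f γ).comp (inducedHom g γ') =
      inducedHom (f.comp g) (γ ≫ (FundamentalGroupoid.map f).map γ' : PathClass x (f (g x))) := by
  ext a
  apply MulOpposite.unop_injective
  obtain ⟨p, hp⟩ := Path.Homotopic.Quotient.mk_surjective a.unop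
  have h : (FundamentalGroupoid.map (f.comp g)).map a.unop.asHom =
      (FundamentalGroupoid.map f).map ((FundamentalGroupoid.map g).map a.unop.asHom) := by
    rw [← hp]; rfl
  change γ ≫ (FundamentalGroupoid.map f).map (γ' ≫ (FundamentalGroupoid.map g).map a.unop.asHom ≫
      Groupoid.inv γ') ≫ Groupoid.inv γ =
    (γ ≫ (FundamentalGroupoid.map f).map γ') ≫
      (FundamentalGroupoid.map (f.comp g)).map a.unop.asHom ≫
      Groupoid.inv (γ ≫ (FundamentalGroupoid.map f).map γ')
  rw [h]
  exact conj_comp_aux (FundamentalGroupoid.map f) γ γ' _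

theorem inducedHom_homotopy {f g : C(X, X)} (H : f.Homotopy g) (γ : PathClass x (f x)) :
    inducedHom f γ =
      inducedHom g (γ ≫ (FundamentalGroupoidFunctor.homotopicMapsNatIso H).app _) := by
  ext a
  apply MulOpposite.unop_injective
  exact conj_nat_aux (FundamentalGroupoidFunctor.homotopicMapsNatIso H) γ a.unop.asHom

/-- Self-homeomorphisms of a path connected space `X` act on representations of `π₁(X, x)` modulo
conjugation: `k • [ρ]` is the class of `α ↦ ρ (γ . (k⁻¹ ∘ α) . γ⁻¹)`, for any path `γ` from `x` to
`k⁻¹ x`. If `k x = x`, one may take for `γ` the constant path, and `k • [ρ] = [ρ ∘ (k⁻¹)_*]`. -/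
def homeoAct [PathConnectedSpace X] {G : Type*} [Group G] (k : X ≃ₜ X) :
    RepClass (PiOne X x) G → RepClass (PiOne X x) G :=
  Quotient.map' (fun ρ => ρ.comp (inducedHom (k⁻¹ : X ≃ₜ X)
    (Path.Homotopic.Quotient.mk (PathConnectedSpace.somePath x ((k⁻¹ : X ≃ₜ X) x)))))
    (by rintro ρ ρ' ⟨c, hc⟩; exact ⟨c, fun a => hc _⟩)

theorem homeoAct_repClass [PathConnectedSpace X] {G : Type*} [Group G] (k : X ≃ₜ X)
    (γ : PathClass x ((k⁻¹ : X ≃ₜ X) x)) (ρ : PiOne X x →* G) :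
    homeoAct k (repClass ρ) = repClass (ρ.comp (inducedHom (k⁻¹ : X ≃ₜ X) γ)) :=
  repClass_inducedHom ((k⁻¹ : X ≃ₜ X) : C(X, X)) _ γ ρ

/-- The action of `X ≃ₜ X` on `Hom(π₁(X, x), G) / G`. -/
instance homeoMulAction [PathConnectedSpace X] {G : Type*} [Group G] :
    MulAction (X ≃ₜ X) (RepClass (PiOne X x) G) where
  smul := homeoAct
  one_smul c := by
    obtain ⟨ρ, rfl⟩ := Quotient.exists_rep c
    refine (homeoAct_repClass 1 (𝟙 (FundamentalGroupoid.mk x)) ρ).trans ?_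
    refine (congrArg (fun φ => repClass (ρ.comp φ)) inducedHom_id).trans ?_
    rfl
  mul_smul k l c := by
    obtain ⟨ρ, rfl⟩ := Quotient.exists_rep c
    let γ : PathClass x ((k⁻¹ : X ≃ₜ X) x) :=
      Path.Homotopic.Quotient.mk (PathConnectedSpace.somePath x _)
    let δ : PathClass x ((l⁻¹ : X ≃ₜ X) x) :=
      Path.Homotopic.Quotient.mk (PathConnectedSpace.somePath x _)
    refine (homeoAct_repClass (k * l)
      (δ ≫ (FundamentalGroupoid.map ((l⁻¹ : X ≃ₜ X) : C(X, X))).map γ) ρ).trans ?_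
    exact congrArg (fun φ => repClass (ρ.comp φ))
      (inducedHom_comp ((l⁻¹ : X ≃ₜ X) : C(X, X)) ((k⁻¹ : X ≃ₜ X) : C(X, X)) δ γ).symm

theorem homeo_smul_repClass [PathConnectedSpace X] {G : Type*} [Group G] (k : X ≃ₜ X)
    (γ : PathClass x ((k⁻¹ : X ≃ₜ X) x)) (ρ : PiOne X x →* G) :
    k • repClass ρ = repClass (ρ.comp (inducedHom (k⁻¹ : X ≃ₜ X) γ)) :=
  homeoAct_repClass k γ ρ

/-- Homeomorphisms whose inverse is homotopic to the identity act trivially. -/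
theorem homeo_smul_eq_of_homotopic [PathConnectedSpace X] {G : Type*} [Group G] (k : X ≃ₜ X)
    (H : (ContinuousMap.id X).Homotopy ((k⁻¹ : X ≃ₜ X) : C(X, X)))
    (c : RepClass (PiOne X x) G) : k • c = c := by
  obtain ⟨ρ, rfl⟩ := Quotient.exists_rep c
  refine (homeo_smul_repClass k ((𝟙 (FundamentalGroupoid.mk x)) ≫
    (FundamentalGroupoidFunctor.homotopicMapsNatIso H).app (FundamentalGroupoid.mk x)) ρ).trans ?_
  refine (congrArg (fun φ => repClass (ρ.comp φ))
    ((inducedHom_homotopy H (𝟙 (FundamentalGroupoid.mk x))).symm.trans inducedHom_id)).trans ?_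
  rfl

end Representations

/-! ### Connectedness of punctured surfaces -/

section Connectedness

variable {S : Type*} [TopologicalSpace S] [T1Space S] [ChartedSpace ℂ S]

theorem isPreconnected_ball_diff (p : ℂ) (r : ℝ) : IsPreconnected (Metric.ball p r \ {p}) := by
  have h : Metric.ball p r \ {p} =
      (fun q : ℝ × ℝ => p + q.1 * Complex.exp (q.2 * Complex.I)) ''
        (Set.Ioo 0 r ×ˢ Set.univ) := by
    ext z
    constructor
    · rintro ⟨hz, hzp⟩
      refine ⟨(‖z - p‖, Complex.arg (z - p)), ⟨⟨?_, ?_⟩, trivial⟩, ?_⟩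
      · exact norm_pos_iff.2 (sub_ne_zero.2 hzp)
      · rwa [← dist_eq_norm]
      · simp [Complex.norm_mul_exp_arg_mul_I]
    · rintro ⟨⟨s, t⟩, ⟨⟨h0, h1⟩, -⟩, rfl⟩
      refine ⟨?_, ?_⟩
      · simpa [Metric.mem_ball, dist_eq_norm, Complex.norm_exp_ofReal_mul_I, abs_of_pos h0] using h1
      · simp [Complex.exp_ne_zero, h0.ne']
  rw [h]
  exact (isPreconnected_Ioo.prod isPreconnected_univ).image _ (by fun_prop)

/-- Removing a point from a preconnected open subset of a surface leaves it preconnected. -/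
theorem isPreconnected_diff_singleton {U : Set S} (hU : IsOpen U) (hc : IsPreconnected U) (a : S) :
    IsPreconnected (U \ {a}) := by
  by_cases ha : a ∈ U
  swap
  · rwa [Set.sdiff_singleton_eq_self ha]
  obtain ⟨B, hBo, haB, hBU, hBc⟩ : ∃ B : Set S, IsOpen B ∧ a ∈ B ∧ B ⊆ U ∧
      IsPreconnected (B \ {a}) ∧ (B \ {a}).Nonempty := by
    let c := chartAt ℂ a
    have hac : a ∈ c.source := mem_chart_source ℂ a
    have hV : IsOpen (c.target ∩ c.symm ⁻¹' U) := c.isOpen_inter_preimage_symm hU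
    obtain ⟨r, hr, hb⟩ := Metric.isOpen_iff.1 hV (c a)
      ⟨c.map_source hac, by simpa [c.left_inv hac] using ha⟩
    have hbt : Metric.ball (c a) r ⊆ c.target := fun z hz => (hb hz).1
    have himg : c.symm '' Metric.ball (c a) r \ {a} =
        c.symm '' (Metric.ball (c a) r \ {c a}) := by
      ext z
      constructor
      · rintro ⟨⟨w, hw, rfl⟩, hz⟩
        exact ⟨w, ⟨hw, fun h => hz (by rw [Set.mem_singleton_iff.1 h, c.left_inv hac]; rfl)⟩, rfl⟩
      · rintro ⟨w, ⟨hw, hwa⟩, rfl⟩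
        exact ⟨⟨w, hw, rfl⟩, fun h => hwa (by
          rw [← Set.mem_singleton_iff.1 h, c.right_inv (hbt hw)]; rfl)⟩
    refine ⟨c.symm '' Metric.ball (c a) r, ?_, ?_, ?_, ?_, ?_⟩
    · exact c.symm.isOpen_image_of_subset_source Metric.isOpen_ball hbt
    · exact ⟨c a, Metric.mem_ball_self hr, c.left_inv hac⟩
    · rintro _ ⟨w, hw, rfl⟩
      exact (hb hw).2
    · rw [himg]
      exact (isPreconnected_ball_diff _ _).image _
        (c.continuousOn_symm.mono fun z hz => hbt hz.1)
    · rw [himg]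
      refine Set.Nonempty.image _ ⟨c a + (r / 2 : ℝ), ?_, ?_⟩
      · rw [Metric.mem_ball, dist_eq_norm, add_sub_cancel_left, Complex.norm_real, Real.norm_eq_abs,
          abs_of_pos (half_pos hr)]
        exact half_lt_self hr
      · simp [hr.ne']
  intro u v hu hv huv ⟨x, hxU, hxu⟩ ⟨y, hyU, hyv⟩
  have key : ∀ u v : Set S, IsOpen u → IsOpen v → U \ {a} ⊆ u ∪ v → ((U \ {a}) ∩ u).Nonempty →
      ((U \ {a}) ∩ v).Nonempty → ((B \ {a}) ∩ u).Nonempty → ((U \ {a}) ∩ (u ∩ v)).Nonempty := by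
    intro u v hu hv huv ⟨x, hxU, hxu⟩ ⟨y, hyU, hyv⟩ hBu
    by_contra hne
    have hBsub : B \ {a} ⊆ u := by
      intro z hz
      by_contra hzu
      have hzv : z ∈ v := (huv ⟨hBU hz.1, hz.2⟩).resolve_left hzu
      obtain ⟨w, hw, hw'⟩ := hBc.1 u v hu hv (fun w hw => huv ⟨hBU hw.1, hw.2⟩) hBu ⟨z, hz, hzv⟩
      exact hne ⟨w, ⟨hBU hw.1, hw.2⟩, hw'⟩
    obtain ⟨w, hw, hw1, hw2⟩ := hc (u ∪ B) (v \ {a}) (hu.union hBo)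
      (hv.sdiff isClosed_singleton) (fun w hw => by
        by_cases hwa : w = a
        · exact Or.inl (Or.inr (hwa ▸ haB))
        · rcases huv ⟨hw, hwa⟩ with h | h
          · exact Or.inl (Or.inl h)
          · exact Or.inr ⟨h, hwa⟩)
      ⟨x, hxU.1, Or.inl hxu⟩ ⟨y, hyU.1, hyv, hyU.2⟩
    refine hne ⟨w, ⟨hw, hw2.2⟩, ?_, hw2.1⟩
    rcases hw1 with h | h
    · exact h
    · exact hBsub ⟨h, hw2.2⟩
  obtain ⟨z, hz⟩ := hBc.2
  rcases huv ⟨hBU hz.1, hz.2⟩ with h | h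
  · exact key u v hu hv huv ⟨x, hxU, hxu⟩ ⟨y, hyU, hyv⟩ ⟨z, hz, h⟩
  · rw [Set.inter_comm u v]
    exact key v u hv hu (by rwa [Set.union_comm]) ⟨y, hyU, hyv⟩ ⟨x, hxU, hxu⟩ ⟨z, hz, h⟩

theorem isPreconnected_compl_finset [ConnectedSpace S] (Y : Finset S) :
    IsPreconnected ((Y : Set S)ᶜ) := by
  classical
  induction Y using Finset.induction_on with
  | empty => simpa using isPreconnected_univ
  | insert a Y _ ih =>
    have := isPreconnected_diff_singleton Y.finite_toSet.isClosed.isOpen_compl ih a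
    rwa [show ((insert a Y : Finset S) : Set S)ᶜ = (Y : Set S)ᶜ \ {a} by
      ext; simp [and_comm]]

/-- The punctured surface `S \ Y`. -/
abbrev Punctured {S : Type*} (Y : Finset S) : Type _ := ((Y : Set S)ᶜ : Set S)

theorem pathConnectedSpace_punctured [ConnectedSpace S] (Y : Finset S) (y₀ : Punctured Y) :
    PathConnectedSpace (Punctured Y) := by
  have : LocallyPathConnectedSpace S := ChartedSpace.locallyPathConnectedSpace ℂ S
  have : LocallyPathConnectedSpace (Punctured Y) :=
    (Y.finite_toSet.isClosed.isOpen_compl : IsOpen ((Y : Set S)ᶜ)).locallyPathConnectedSpace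
  have : PreconnectedSpace (Punctured Y) :=
    Subtype.preconnectedSpace (isPreconnected_compl_finset Y)
  have : ConnectedSpace (Punctured Y) := { toNonempty := ⟨y₀⟩ }
  exact PathConnectedSpace.of_locallyPathConnectedSpace

end Connectedness

/-! ### The action of the mapping class group -/

section Action

variable {S : Type*} [TopologicalSpace S] [ChartedSpace ℂ S] [HasGroupoid S orientationGroupoid]

/-- The restriction of an element of `Homeo₊(S, Y)` to `S \ Y`. -/
def restrictPunctured (Y : Finset S) : HomeoPlus Y →* (Punctured Y ≃ₜ Punctured Y) where
  toFun h := (h : S ≃ₜ S).subtype fun x => not_congr (h.2.2 x).symm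
  map_one' := rfl
  map_mul' _ _ := rfl

/-- An isotopy relative to `Y` restricts to a homotopy on `S \ Y`. -/
theorem homotopy_of_isotopicToId {Y : Finset S} (h : HomeoPlus Y)
    (hh : IsotopicToId Y (h : S ≃ₜ S)) :
    Nonempty ((ContinuousMap.id (Punctured Y)).Homotopy
      (restrictPunctured Y h : C(Punctured Y, Punctured Y))) := by
  obtain ⟨H, hc, hY, h0, h1⟩ := hh
  have hm : ∀ t, ∀ x : Punctured Y, H t x ∈ ((Y : Set S)ᶜ : Set S) := fun t x hx =>
    x.2 (by
      have := (H t).injective (hY t _ hx)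
      rwa [this] at hx)
  exact ⟨{
    toFun := fun p => ⟨H p.1 p.2, hm p.1 p.2⟩
    continuous_toFun := Continuous.subtype_mk
      (hc.comp (continuous_fst.prodMk (continuous_subtype_val.comp continuous_snd))) _
    map_zero_left := fun x => by
      apply Subtype.ext
      change H 0 x = x
      rw [h0]; rfl
    map_one_left := fun x => by
      apply Subtype.ext
      change H 1 x = (h : S ≃ₜ S) x
      rw [h1] }⟩

variable [T1Space S] [ConnectedSpace S]

/-- The permutation representation of the mapping class group of `(S, Y)` on
`Hom(π₁(S \ Y, y₀), G) / G`, induced on isotopy classes by the action of homeomorphisms. -/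
def mappingClassPerm (Y : Finset S) (y₀ : Punctured Y) (G : Type*) [Group G] :
    MappingClassGroup Y →* Equiv.Perm (RepClass (PiOne (Punctured Y) y₀) G) :=
  haveI := pathConnectedSpace_punctured Y y₀
  QuotientGroup.lift (isotopySubgroup Y)
    ((MulAction.toPermHom (Punctured Y ≃ₜ Punctured Y)
      (RepClass (PiOne (Punctured Y) y₀) G)).comp (restrictPunctured Y))
    (fun h hh => by
      obtain ⟨H⟩ := homotopy_of_isotopicToId h⁻¹ ((isotopySubgroup Y).inv_mem hh)
      ext c
      exact homeo_smul_eq_of_homotopic (restrictPunctured Y h) H c)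

/-- The action of the mapping class group of `(S, Y)` on `Hom(π₁(S \ Y, y₀), G) / G`. -/
instance mappingClassAction (Y : Finset S) (y₀ : Punctured Y) (G : Type*) [Group G] :
    MulAction (MappingClassGroup Y) (RepClass (PiOne (Punctured Y) y₀) G) :=
  MulAction.compHom _ (mappingClassPerm Y y₀ G)

/-- The action in terms of a homeomorphism `h` and any path `γ` from `y₀` to `h⁻¹ y₀`. -/
theorem mappingClass_smul (Y : Finset S) (y₀ : Punctured Y) {G : Type*} [Group G]
    (h : HomeoPlus Y) (γ : PathClass y₀ ((restrictPunctured Y h)⁻¹ y₀))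
    (ρ : PiOne (Punctured Y) y₀ →* G) :
    (QuotientGroup.mk h : MappingClassGroup Y) • repClass ρ =
      repClass (ρ.comp (inducedHom
        (((restrictPunctured Y h)⁻¹ : Punctured Y ≃ₜ Punctured Y) :
          C(Punctured Y, Punctured Y)) γ)) :=
  haveI := pathConnectedSpace_punctured Y y₀
  homeo_smul_repClass (restrictPunctured Y h) γ ρ

end Action

/-- `Aff(ℂ)`: the invertible complex `2 × 2` matrices with second row `(0, 1)`. -/
def Aff : Subgroup (GL (Fin 2) ℂ) where
  carrier := {A | A.1 1 0 = 0 ∧ A.1 1 1 = 1}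
  one_mem' := by simp
  mul_mem' {A B} hA hB := by
    simp only [Set.mem_ofPred_eq, Units.val_mul, Matrix.mul_apply, Fin.sum_univ_two] at *
    simp [hA.1, hA.2, hB.1, hB.2]
  inv_mem' {A} hA := by
    have h : A.1 * (A⁻¹).1 = 1 := by rw [← Units.val_mul, mul_inv_cancel, Units.val_one]
    have h0 := congrFun (congrFun h 1) 0
    have h1 := congrFun (congrFun h 1) 1
    simp only [Matrix.mul_apply, Fin.sum_univ_two, hA.1, hA.2] at h0 h1
    exact ⟨by simpa using h0, by simpa using h1⟩

end

end SurfaceMCG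

namespace SurfaceMCG

noncomputable section

/-! ### Multiplicative cocycles on paths -/

/-! For a representation with commutative image, conjugating a loop changes nothing: ρ is a
character of H₁(Σ∖Y) with values in A = Im ρ, and a mapping class acts by evaluating this character
on transformed loops. Characters are handled as a `PathCocycle`, and finite generation of H₁ as
`FinTriv`: there are finitely many loops such that every cocycle vanishing on them has a primitive.

If A is finite, every point of the orbit is the class of a homomorphism into A. Such a homomorphism
is determined by its values on the finitely many loops, so the orbit is finite.

Conversely, each of these loops α comes with a crossing loop β and Dehn twists that fix the class of
α and send β to β + kα (`HasTransvections`). If the orbit is finite, two different powers of the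
twist give conjugate representations. So, with a = ρ(α) and b = ρ(β), some c commutes with a and
conjugates b aᵏ to b aᵏ', where k ≠ k'. If a ≠ 1, its centralizer in Aff(ℂ) is commutative, hence c
commutes with b too and aᵏ = aᵏ'. Thus a has finite order (`Aff.isOfFinOrder_of_conj`), and a
commutative group generated by finitely many torsion elements is finite
(`finite_orbit_iff_of_finTriv`).

What remains is topology: `FinTriv Y Set.univ`. In the 4g-gon, the chords joining side s to its
partner s + 2 close up to circles and fill an annulus. It does not separate the surface, because
another pair of glued sides connects the two caps left in the disc. Hence the core of any
puncture-free subannulus has transvections. The polygon is reparametrized so that the interior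
punctures lie near one point of side 0, on distinct levels of a single annulus
(`exists_goodPosition`). Cutting an annulus at its puncture levels leaves puncture-free annuli; a
thin neighbourhood of such a level, slit at the puncture, is simply connected and glues the
neighbouring annuli. The open disc and the 2g annuli cover everything but the vertices, which are
filled in by small discs. All gluing is done by matching primitives over connected intersections
(`PathCocycle.TrivialOn.union`), in place of van Kampen's theorem. -/

/-- A homotopy invariant assignment of elements of a commutative group to paths that is
multiplicative under concatenation. -/
structure PathCocycle (X : Type*) [TopologicalSpace X] (A : Type*) [CommGroup A] where
  /-- The value on a path. -/
  val : ∀ {x y : X}, Path x y → A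
  map_trans : ∀ {x y z : X} (p : Path x y) (q : Path y z), val (p.trans q) = val p * val q
  map_homotopic : ∀ {x y : X} {p q : Path x y}, p.Homotopic q → val p = val q

namespace PathCocycle

variable {X C A : Type*} [TopologicalSpace X] [TopologicalSpace C] [CommGroup A]
  (l : PathCocycle X A)

/-- Lifts and images of paths have end points that are only propositionally equal; this compares
them without casts. -/
theorem val_congr {x y x' y' : X} (p : Path x y) (q : Path x' y') (h : ∀ t, p t = q t) :
    l.val p = l.val q := by
  obtain rfl : x = x' := by simpa using h 0
  obtain rfl : y = y' := by simpa using h 1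
  congr 1
  ext t
  exact h t

theorem val_refl (x : X) : l.val (Path.refl x) = 1 := by
  have h := l.map_trans (Path.refl x) (Path.refl x)
  rw [Path.refl_trans_refl] at h
  exact left_eq_mul.1 h

theorem val_symm {x y : X} (p : Path x y) : l.val p.symm = (l.val p)⁻¹ := by
  rw [eq_inv_iff_mul_eq_one, ← l.map_trans, l.map_homotopic (Path.Homotopic.symm_trans p),
    val_refl]

/-- The pullback of a cocycle along a continuous map. -/
def comap (i : C(C, X)) : PathCocycle C A where
  val p := l.val (p.map i.continuous)
  map_trans p q := by rw [Path.map_trans, l.map_trans]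
  map_homotopic h := l.map_homotopic (h.map i)

/-- `f` is a primitive of the cocycle along all paths in `U`. -/
def IsPrimitiveOn (f : X → A) (U : Set X) : Prop :=
  ∀ ⦃x y : X⦄ (p : Path x y), (∀ t, p t ∈ U) → l.val p = (f x)⁻¹ * f y

/-- The cocycle has a primitive on `U`. -/
def TrivialOn (U : Set X) : Prop := ∃ f, l.IsPrimitiveOn f U

variable {l}

theorem IsPrimitiveOn.mono {f : X → A} {U V : Set X} (h : l.IsPrimitiveOn f V) (hUV : U ⊆ V) :
    l.IsPrimitiveOn f U :=
  fun _ _ p hp => h p fun t => hUV (hp t)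

theorem TrivialOn.mono {U V : Set X} (h : l.TrivialOn V) (hUV : U ⊆ V) : l.TrivialOn U :=
  h.imp fun _ hf => hf.mono hUV

/-- A path is subdivided so that each piece lies in one of the sets `W`. Since `f` is the same
function on all of them, the product over the pieces telescopes. -/
theorem IsPrimitiveOn.of_local {f : X → A} {U : Set X}
    (h : ∀ x ∈ U, ∃ W ∈ 𝓝 x, l.IsPrimitiveOn f W) : l.IsPrimitiveOn f U := by
  intro x y p hp
  have h' : ∀ t, ∃ W ∈ 𝓝 (p t), l.IsPrimitiveOn f W := fun t => h _ (hp t)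
  choose W hW hfW using h'
  obtain ⟨t, ht0, htm, ⟨n, hn⟩, ht⟩ := exists_monotone_Icc_subset_open_cover_unitInterval
    (c := fun s => p ⁻¹' interior (W s)) (fun s => isOpen_interior.preimage p.continuous)
    (fun s _ => Set.mem_iUnion.2 ⟨s, mem_interior_iff_mem_nhds.2 (hW s)⟩)
  have key : ∀ k, l.val (p.subpath 0 (t k)) = (f (p 0))⁻¹ * f (p (t k)) := by
    intro k
    induction k with
    | zero =>
      rw [ht0, Path.subpath_self, val_refl]
      simp
    | succ k ih =>
      rw [← l.map_homotopic ⟨Path.Homotopy.subpathTransSubpath p 0 (t k) (t (k + 1))⟩,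
        l.map_trans, ih]
      obtain ⟨s, hs⟩ := ht k
      rw [hfW s (p.subpath (t k) (t (k + 1))) fun r => ?_]
      · group
      · have hr : p.subpath (t k) (t (k + 1)) r ∈ Set.range (p.subpath (t k) (t (k + 1))) :=
          ⟨r, rfl⟩
        rw [Path.range_subpath_of_le _ _ _ (htm k.le_succ)] at hr
        obtain ⟨q, hq, hqr⟩ := hr
        rw [← hqr]
        exact interior_subset (hs hq)
  have h1 := key n
  rw [hn n le_rfl, Path.subpath_zero_one] at h1
  rw [← l.val_congr (p.cast p.source p.target) p fun t => rfl, h1, p.source, p.target]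

/-- Two primitives on `W` differ by a constant if `W` is open and preconnected. -/
theorem IsPrimitiveOn.div_eq [LocallyPathConnectedSpace X] {f g : X → A} {W : Set X} (hW : IsOpen W)
    (hc : IsPreconnected W) (hf : l.IsPrimitiveOn f W) (hg : l.IsPrimitiveOn g W) {x y : X}
    (hx : x ∈ W) (hy : y ∈ W) : f x / g x = f y / g y := by
  have hp : IsPathConnected W := hW.isConnected_iff_isPathConnected.1 ⟨⟨x, hx⟩, hc⟩
  obtain ⟨p, hp⟩ := hp.joinedIn x hx y hy
  have h := (hf p hp).symm.trans (hg p hp)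
  rw [div_eq_div_iff_mul_eq_mul]
  rw [inv_mul_eq_iff_eq_mul, mul_comm (g x)⁻¹, ← mul_assoc, eq_mul_inv_iff_mul_eq] at h
  rw [← h, mul_comm]

/-- On the connected intersection the two primitives differ by a constant `c`; rescaling one by `c`
makes them agree. If the intersection is empty, any constant will do. -/
theorem TrivialOn.union [LocallyPathConnectedSpace X] {U V : Set X} (hU : IsOpen U) (hV : IsOpen V)
    (hUV : IsPreconnected (U ∩ V)) (h1 : l.TrivialOn U) (h2 : l.TrivialOn V) :
    l.TrivialOn (U ∪ V) := by
  classical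
  obtain ⟨f, hf⟩ := h1
  obtain ⟨g, hg⟩ := h2
  obtain ⟨c, hc⟩ : ∃ c : A, ∀ x ∈ U ∩ V, f x = c * g x := by
    rcases (U ∩ V).eq_empty_or_nonempty with h | ⟨x, hx⟩
    · exact ⟨1, by simp [h]⟩
    · refine ⟨f x / g x, fun y hy => ?_⟩
      rw [(hf.mono Set.inter_subset_left).div_eq (hU.inter hV) hUV
        (hg.mono Set.inter_subset_right) hx hy, div_mul_cancel]
  have hg' : l.IsPrimitiveOn (fun x => c * g x) V := fun x y p hp => by
    rw [hg p hp]; group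
  let F : X → A := fun x => if x ∈ U then f x else c * g x
  have hFU : ∀ x ∈ U, F x = f x := fun x hx => if_pos hx
  have hFV : ∀ x ∈ V, F x = c * g x := fun x hx => by
    by_cases h : x ∈ U
    · rw [hFU x h, hc x ⟨h, hx⟩]
    · exact if_neg h
  refine ⟨F, IsPrimitiveOn.of_local ?_⟩
  rintro x (hx | hx)
  · refine ⟨U, hU.mem_nhds hx, fun a b p hp => ?_⟩
    rw [hf p hp, hFU a (by simpa using hp 0), hFU b (by simpa using hp 1)]
  · refine ⟨V, hV.mem_nhds hx, fun a b p hp => ?_⟩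
    rw [hg' p hp, hFV a (by simpa using hp 0), hFV b (by simpa using hp 1)]

variable (l)

/-- On a simply connected space a cocycle has a global primitive. -/
theorem exists_primitive [SimplyConnectedSpace C] (m : PathCocycle C A) :
    ∃ f : C → A, ∀ ⦃a b : C⦄ (p : Path a b), m.val p = (f a)⁻¹ * f b := by
  obtain ⟨c⟩ : Nonempty C := inferInstance
  refine ⟨fun a => m.val (PathConnectedSpace.somePath c a), fun a b p => ?_⟩
  rw [eq_inv_mul_iff_mul_eq, ← m.map_trans]
  exact m.map_homotopic (SimplyConnectedSpace.paths_homotopic _ _)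

/-- A cocycle has a primitive on the image of a simply connected space under a local homeomorphism
if it has a primitive upstairs that is constant on the fibres. -/
theorem trivialOn_range {s : C → X} (hs : IsLocalHomeomorph s) {f : C → A}
    (hf : ∀ ⦃a b : C⦄ (p : Path a b), l.val (p.map hs.continuous) = (f a)⁻¹ * f b)
    (h : ∀ a b, s a = s b → f a = f b) : l.TrivialOn (Set.range s) := by
  classical
  -- The value 1 off the range is never used: only paths inside the range are tested.
  let F : X → A := fun x => if hx : ∃ c, s c = x then f hx.choose else 1
  have hF : ∀ c, F (s c) = f c := fun c => by
    have hx : ∃ c', s c' = s c := ⟨c, rfl⟩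
    have : F (s c) = f hx.choose := dif_pos hx
    rw [this]
    exact h _ _ hx.choose_spec
  refine ⟨F, IsPrimitiveOn.of_local ?_⟩
  rintro _ ⟨c, rfl⟩
  obtain ⟨e, hce, he⟩ := hs c
  refine ⟨e.target, e.open_target.mem_nhds (by rw [he]; exact e.map_source hce), ?_⟩
  intro x y p hp
  have hcont : Continuous fun t => e.symm (p t) :=
    e.continuousOn_symm.comp_continuous p.continuous hp
  let q : Path (e.symm (p 0)) (e.symm (p 1)) := ⟨⟨fun t => e.symm (p t), hcont⟩, rfl, rfl⟩
  have hq : ∀ t, s (q t) = p t := fun t => by rw [he]; exact e.right_inv (hp t)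
  rw [l.val_congr p (q.map hs.continuous) fun t => (hq t).symm, hf]
  have h0 : s (e.symm (p 0)) = x := (hq 0).trans p.source
  have h1 : s (e.symm (p 1)) = y := (hq 1).trans p.target
  rw [← hF, ← hF, h0, h1]

theorem trivialOn_range_of_isOpenEmbedding [SimplyConnectedSpace C] {s : C → X}
    (hs : IsOpenEmbedding s) : l.TrivialOn (Set.range s) := by
  obtain ⟨f, hf⟩ := exists_primitive (l.comap ⟨s, hs.continuous⟩)
  exact l.trivialOn_range hs.isLocalHomeomorph hf fun a b h => by rw [hs.injective h]

/-- A deck transformation changes a primitive by a constant. -/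
theorem primitive_deck [PathConnectedSpace C] {s : C → X} (hs : Continuous s) {f : C → A}
    (hf : ∀ ⦃a b : C⦄ (p : Path a b), l.val (p.map hs) = (f a)⁻¹ * f b) {d : C → C}
    (hd : Continuous d) (hsd : ∀ c, s (d c) = s c) (a b : C) : f (d a) / f a = f (d b) / f b := by
  obtain ⟨p⟩ := PathConnectedSpace.joined a b
  -- A path and its translate by `d` have the same image in `X`.
  have h : l.val ((p.map hd).map hs) = l.val (p.map hs) :=
    l.val_congr _ _ fun t => hsd (p t)
  rw [hf, hf, inv_mul_eq_iff_eq_mul] at h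
  rw [h, mul_div_assoc, mul_div_cancel_right, div_eq_mul_inv]

end PathCocycle

/-! ### Cocycles of representations with abelian image -/

section HomCocycle

variable {X : Type*} [TopologicalSpace X] {x₀ : X} {A : Type*} [CommGroup A]

/-- The element of the fundamental group represented by a loop. -/
def piMk (p : Path x₀ x₀) : PiOne X x₀ :=
  MulOpposite.op (End.of (Path.Homotopic.Quotient.mk p :
    FundamentalGroupoid.mk x₀ ⟶ FundamentalGroupoid.mk x₀))

theorem piMk_surjective (a : PiOne X x₀) : ∃ p, piMk p = a := by
  obtain ⟨p, hp⟩ := Path.Homotopic.Quotient.mk_surjective a.unop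
  exact ⟨p, MulOpposite.unop_injective hp⟩

theorem piMk_trans (p q : Path x₀ x₀) : piMk (p.trans q) = piMk p * piMk q := rfl

theorem piMk_eq {p q : Path x₀ x₀} (h : p.Homotopic q) : piMk p = piMk q := by
  have h' : Path.Homotopic.Quotient.mk p = Path.Homotopic.Quotient.mk q :=
    Path.Homotopic.Quotient.eq.2 h
  unfold piMk
  rw [h']

theorem inducedHom_piMk (f : C(X, X)) (γ : Path x₀ (f x₀)) (p : Path x₀ x₀) :
    inducedHom f (Path.Homotopic.Quotient.mk γ) (piMk p) =
      piMk (γ.trans ((p.map f.continuous).trans γ.symm)) := rfl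

/-- Commutativity of `A` is what makes base points and connecting paths irrelevant from here on. -/
theorem PathCocycle.val_conj (l : PathCocycle X A) {x y : X} (γ : Path x y) (p : Path y y) :
    l.val (γ.trans (p.trans γ.symm)) = l.val p := by
  rw [l.map_trans, l.map_trans, l.val_symm, mul_comm (l.val p), mul_inv_cancel_left]

variable [PathConnectedSpace X]

/-- The loop obtained from a path by connecting its end points to the base point. -/
def basedLoop (x₀ : X) {x y : X} (p : Path x y) : Path x₀ x₀ :=
  (PathConnectedSpace.somePath x₀ x).trans (p.trans (PathConnectedSpace.somePath x₀ y).symm)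

/-- The cocycle defined by a homomorphism of the fundamental group to a commutative group. -/
def homCocycle (φ : PiOne X x₀ →* A) : PathCocycle X A where
  val p := φ (piMk (basedLoop x₀ p))
  map_trans {x y z} p q := by
    rw [← map_mul, ← piMk_trans]
    congr 1
    apply piMk_eq
    rw [← Path.Homotopic.Quotient.eq]
    simp only [basedLoop, Path.Homotopic.Quotient.mk_trans, Path.Homotopic.Quotient.mk_symm,
      Path.Homotopic.Quotient.trans_assoc]
    rw [← Path.Homotopic.Quotient.trans_assoc (Path.Homotopic.Quotient.symm _),
      Path.Homotopic.Quotient.symm_trans, Path.Homotopic.Quotient.refl_trans]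
  map_homotopic h := by
    congr 1
    exact piMk_eq ((Path.Homotopic.refl _).hcomp (h.hcomp (Path.Homotopic.refl _)))

theorem PathCocycle.val_basedLoop (l : PathCocycle X A) {x : X} (p : Path x x) :
    l.val (basedLoop x₀ p) = l.val p :=
  l.val_conj _ p

/-- The chosen path from `x₀` to itself need not be constant, but it enters together with its
inverse and cancels in `A`. -/
theorem homCocycle_val_loop (φ : PiOne X x₀ →* A) (p : Path x₀ x₀) :
    (homCocycle φ).val p = φ (piMk p) := by
  let γ := PathConnectedSpace.somePath x₀ x₀
  have h1 : piMk γ * piMk γ.symm = 1 := by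
    rw [← piMk_trans, piMk_eq (Path.Homotopic.trans_symm γ)]
    rfl
  have h2 := congrArg φ h1
  rw [map_mul, map_one] at h2
  change φ (piMk γ * (piMk p * piMk γ.symm)) = _
  rw [map_mul, map_mul, mul_left_comm, h2, mul_one]

/-- The connecting path `γ` drops out, so the action on commutative characters is evaluation of the
cocycle on the image loop. -/
theorem apply_inducedHom (φ : PiOne X x₀ →* A) (f : C(X, X)) (γ : Path x₀ (f x₀))
    (p : Path x₀ x₀) :
    φ (inducedHom f (Path.Homotopic.Quotient.mk γ) (piMk p)) =
      (homCocycle φ).val (p.map f.continuous) := by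
  rw [inducedHom_piMk, ← homCocycle_val_loop, PathCocycle.val_conj]

end HomCocycle

/-! ### Affine transformations -/

/-- The linear parts commute anyway, so only the translation parts of the two products are compared.
The condition says that the vectors (linear part − 1, translation part) are proportional. -/
theorem Aff.mul_comm_iff (a b : Aff) : a * b = b * a ↔
    (a.1.1 0 0 - 1) * b.1.1 0 1 = (b.1.1 0 0 - 1) * a.1.1 0 1 := by
  have ha := a.2
  have hb := b.2
  obtain ⟨ha0, ha1⟩ := ha
  obtain ⟨hb0, hb1⟩ := hb
  rw [Subtype.ext_iff, Units.ext_iff, ← Matrix.ext_iff]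
  simp only [Fin.forall_fin_two, Subgroup.coe_mul, Units.val_mul, Matrix.mul_apply,
    Fin.sum_univ_two, ha0, ha1, hb0, hb1]
  constructor
  · rintro ⟨⟨-, h⟩, -⟩
    linear_combination h
  · intro h
    refine ⟨⟨by ring, by linear_combination h⟩, by ring, by ring⟩

theorem Aff.eq_one_of (a : Aff) (h0 : a.1.1 0 0 = 1) (h1 : a.1.1 0 1 = 0) : a = 1 := by
  obtain ⟨ha0, ha1⟩ := a.2
  rw [Subtype.ext_iff, Units.ext_iff, ← Matrix.ext_iff]
  simp [Fin.forall_fin_two, ha0, ha1, h0, h1]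

/-- Centralizers of nontrivial affine transformations are commutative. -/
theorem Aff.mul_comm_of_commute {a b c : Aff} (ha : a ≠ 1) (hab : a * b = b * a)
    (hac : a * c = c * a) : b * c = c * b := by
  rw [Aff.mul_comm_iff] at *
  by_cases h : a.1.1 0 0 = 1
  -- A nontrivial translation commutes only with translations; in the other case everything
  -- commuting with `a` shares its fixed point.
  · have h1 : a.1.1 0 1 ≠ 0 := fun h1 => ha (Aff.eq_one_of a h h1)
    rw [h, sub_self, zero_mul, eq_comm, mul_eq_zero, or_iff_left h1] at hab hac
    rw [hab, hac, zero_mul, zero_mul]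
  · apply mul_left_cancel₀ (sub_ne_zero.2 h)
    linear_combination (b.1.1 0 0 - 1) * hac - (c.1.1 0 0 - 1) * hab

/-- Unless `a = 1`, both `b` and `c` lie in the commutative centralizer of `a`. So conjugation by
`c` does nothing to `b * a ^ k`, and two distinct powers of `a` coincide. -/
theorem Aff.isOfFinOrder_of_conj {a b c : Aff} {k k' : ℤ} (hk : k ≠ k') (hab : a * b = b * a)
    (hc : a = c * a * c⁻¹) (h : b * a ^ k' = c * (b * a ^ k) * c⁻¹) : IsOfFinOrder a := by
  by_cases ha : a = 1
  · rw [ha]; exact IsOfFinOrder.one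
  rw [eq_mul_inv_iff_mul_eq] at hc h
  have hbc : b * c = c * b := Aff.mul_comm_of_commute ha hab hc
  have hac : a ^ k' * c = c * a ^ k' := (show Commute a c from hc).zpow_left k'
  rw [mul_assoc, hac, ← mul_assoc, hbc, mul_assoc, mul_left_cancel_iff, mul_left_cancel_iff] at h
  by_contra hinf
  exact hk (injective_zpow_iff_not_isOfFinOrder.2 hinf h.symm)

/-! ### Loops with transvections -/

section Transvection

variable {S : Type*} [TopologicalSpace S] [ChartedSpace ℂ S] [HasGroupoid S orientationGroupoid]

/-- There is a loop `β` such that, for all `k`, some mapping class fixes the homology class of `α`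
and adds `k` times this class to the homology class of `β`. -/
def HasTransvections (Y : Finset S) {x : Punctured Y} (α : Path x x) : Prop :=
  ∃ (z : Punctured Y) (β : Path z z), ∀ k : ℤ, ∃ h : HomeoPlus Y,
    ∀ (A : Type) [CommGroup A] (l : PathCocycle (Punctured Y) A),
      l.val (α.map (restrictPunctured Y h).continuous) = l.val α ∧
      l.val (β.map (restrictPunctured Y h).continuous) = l.val β * l.val α ^ k

/-- There are finitely many loops with transvections such that every cocycle on `S \ Y` that
vanishes on them is trivial on `U \ Y`. -/
def FinTriv (Y : Finset S) (U : Set S) : Prop :=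
  ∃ F : Set (Σ x : Punctured Y, Path x x), F.Finite ∧ (∀ α ∈ F, HasTransvections Y α.2) ∧
    ∀ (A : Type) [CommGroup A] (l : PathCocycle (Punctured Y) A),
      (∀ α ∈ F, l.val α.2 = 1) → l.TrivialOn (Subtype.val ⁻¹' U)

variable [T1Space S] [ConnectedSpace S]

/-- The action is defined through h⁻¹, so the class of `h⁻¹` pulls `ρ` back along `h` itself. The
auxiliary `k` is needed because the type of `γ` depends on the homeomorphism, which equals
`restrictPunctured Y h` only propositionally. -/
theorem inv_smul_repClass (Y : Finset S) (y₀ : Punctured Y) {G : Type*} [Group G] (h : HomeoPlus Y)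
    (ρ : PiOne (Punctured Y) y₀ →* G) :
    ∃ γ : Path y₀ (restrictPunctured Y h y₀),
      (QuotientGroup.mk h⁻¹ : MappingClassGroup Y) • repClass ρ =
        repClass (ρ.comp (inducedHom (restrictPunctured Y h : C(Punctured Y, Punctured Y))
          (Path.Homotopic.Quotient.mk γ))) := by
  have key : ∀ k : Punctured Y ≃ₜ Punctured Y, (restrictPunctured Y h⁻¹)⁻¹ = k →
      ∃ γ : Path y₀ (k y₀), (QuotientGroup.mk h⁻¹ : MappingClassGroup Y) • repClass ρ =
        repClass (ρ.comp (inducedHom (k : C(Punctured Y, Punctured Y))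
          (Path.Homotopic.Quotient.mk γ))) := by
    rintro _ rfl
    have := pathConnectedSpace_punctured Y y₀
    exact ⟨PathConnectedSpace.somePath _ _, mappingClass_smul Y y₀ h⁻¹ _ ρ⟩
  exact key _ (by rw [map_inv, inv_inv])

theorem smul_repClass_exists (Y : Finset S) (y₀ : Punctured Y) {G : Type*} [Group G]
    (m : MappingClassGroup Y) (ρ : PiOne (Punctured Y) y₀ →* G) :
    ∃ φ : PiOne (Punctured Y) y₀ →* PiOne (Punctured Y) y₀,
      m • repClass ρ = repClass (ρ.comp φ) := by
  obtain ⟨h, rfl⟩ := QuotientGroup.mk_surjective m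
  obtain ⟨γ, hγ⟩ := inv_smul_repClass Y y₀ h⁻¹ ρ
  rw [inv_inv] at hγ
  exact ⟨_, hγ⟩

/-- The commutative group structure on an abelian image. -/
abbrev rangeCommGroup {L G : Type*} [Group L] [Group G] (ρ : L →* G)
    (hρ : ∀ a ∈ ρ.range, ∀ b ∈ ρ.range, a * b = b * a) : CommGroup ρ.range :=
  { (inferInstance : Group ρ.range) with
    mul_comm := fun a b => Subtype.ext (hρ a a.2 b b.2) }

/-- A representation with abelian image and finite orbit has finite order on loops with
transvections. -/
theorem HasTransvections.isOfFinOrder {Y : Finset S} {y₀ : Punctured Y}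
    (ρ : PiOne (Punctured Y) y₀ →* Aff)
    (hρ : ∀ a ∈ ρ.range, ∀ b ∈ ρ.range, a * b = b * a)
    (hfin : (MulAction.orbit (MappingClassGroup Y) (repClass ρ)).Finite)
    {x : Punctured Y} {α : Path x x} (hα : HasTransvections Y α) :
    letI := rangeCommGroup ρ hρ
    haveI := pathConnectedSpace_punctured Y y₀
    IsOfFinOrder ((homCocycle ρ.rangeRestrict).val α) := by
  let _ := rangeCommGroup ρ hρ
  have := pathConnectedSpace_punctured Y y₀
  change IsOfFinOrder ((homCocycle ρ.rangeRestrict).val α)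
  set l := homCocycle ρ.rangeRestrict with hl
  obtain ⟨z, β, hβ⟩ := hα
  choose h hh using hβ
  have hγ := fun k => inv_smul_repClass Y y₀ (h k) ρ
  choose γ hγ using hγ
  -- The pulled back representation is evaluated on free loops: moving `p` to the base point does
  -- not change the value of `l`.
  have hval : ∀ (k : ℤ) {w : Punctured Y} (p : Path w w),
      ρ (inducedHom (restrictPunctured Y (h k) : C(Punctured Y, Punctured Y))
          (Path.Homotopic.Quotient.mk (γ k)) (piMk (basedLoop y₀ p))) =
        (l.val (p.map (restrictPunctured Y (h k)).continuous) : Aff) := by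
    intro k w p
    have h1 := apply_inducedHom ρ.rangeRestrict
      (restrictPunctured Y (h k) : C(Punctured Y, Punctured Y)) (γ k) (basedLoop y₀ p)
    have h2 : (l.comap (restrictPunctured Y (h k) : C(Punctured Y, Punctured Y))).val
        (basedLoop y₀ p) = (l.comap _).val p := PathCocycle.val_basedLoop _ p
    exact congrArg Subtype.val (h1.trans h2)
  -- Pigeonhole: infinitely many twists, finitely many classes in the orbit.
  obtain ⟨k, -, k', -, hkk, he⟩ := Set.infinite_univ.exists_ne_map_eq_of_mapsTo
    (f := fun k : ℤ => (QuotientGroup.mk (h k)⁻¹ : MappingClassGroup Y) • repClass ρ)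
    (fun k _ => MulAction.mem_orbit _ _) hfin
  simp only [hγ] at he
  obtain ⟨c, hc⟩ := Quotient.exact (s := conjSetoid _ _) he
  have hcl : ∀ {w : Punctured Y} (p : Path w w),
      (l.val (p.map (restrictPunctured Y (h k')).continuous) : Aff) =
        c * l.val (p.map (restrictPunctured Y (h k)).continuous) * c⁻¹ := by
    intro w p
    rw [← hval, ← hval]
    exact hc _
  have h1 := hcl α
  have h2 := hcl β
  rw [(hh k' _ l).1, (hh k _ l).1] at h1
  rw [(hh k' _ l).2, (hh k _ l).2] at h2
  have h3 : IsOfFinOrder ((l.val α : ρ.range) : Aff) :=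
    Aff.isOfFinOrder_of_conj hkk (hρ _ (l.val α).2 _ (l.val β).2) h1 h2
  exact Submonoid.isOfFinOrder_coe.1 h3

/-- A commutative group generated by finitely many elements of finite order is finite. -/
theorem finite_of_closure_eq_top {A : Type*} [CommGroup A] {s : Set A} (hs : s.Finite)
    (hfin : ∀ a ∈ s, IsOfFinOrder a) (htop : Subgroup.closure s = ⊤) : Finite A := by
  have : Group.FG A := ⟨⟨hs.toFinset, by simpa using htop⟩⟩
  apply CommGroup.finite_of_fg_isMulTorsion
  have h : Subgroup.closure s ≤ CommGroup.torsion A := (Subgroup.closure_le _).2 hfin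
  rw [htop] at h
  exact fun a => h (Subgroup.mem_top a)

/-- The loops in `F` detect characters. Hence their values generate the commutative image, and a
homomorphism to a finite commutative group is determined by finitely many values; each fact gives
one implication. -/
theorem finite_orbit_iff_of_finTriv {Y : Finset S} (hY : FinTriv Y Set.univ) {y₀ : Punctured Y}
    (ρ : PiOne (Punctured Y) y₀ →* Aff)
    (hρ : ∀ a ∈ ρ.range, ∀ b ∈ ρ.range, a * b = b * a) :
    (MulAction.orbit (MappingClassGroup Y) (repClass ρ)).Finite ↔ (ρ.range : Set Aff).Finite := by
  let _ := rangeCommGroup ρ hρ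
  have := pathConnectedSpace_punctured Y y₀
  obtain ⟨F, hF, hFt, hFA⟩ := hY
  have triv : ∀ (A : Type) [CommGroup A] (φ : PiOne (Punctured Y) y₀ →* A),
      (∀ α ∈ F, (homCocycle φ).val α.2 = 1) → φ = 1 := by
    intro A _ φ h
    obtain ⟨f, hf⟩ := hFA A (homCocycle φ) h
    ext a
    obtain ⟨p, rfl⟩ := piMk_surjective a
    rw [← homCocycle_val_loop, hf p fun _ => trivial]
    simp
  constructor
  · intro hfin
    let l := homCocycle ρ.rangeRestrict
    let s : Set ρ.range := (fun α : (Σ x : Punctured Y, Path x x) => l.val α.2) '' F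
    have hs : ∀ a ∈ s, IsOfFinOrder a := by
      rintro _ ⟨α, hα, rfl⟩
      exact (hFt α hα).isOfFinOrder ρ hρ hfin
    -- Modulo the subgroup generated by the values on `F`, the representation becomes a character
    -- vanishing on `F`, hence trivial.
    have htop : Subgroup.closure s = ⊤ := by
      let π := QuotientGroup.mk' (Subgroup.closure s)
      have h1 := triv _ (π.comp ρ.rangeRestrict) fun α hα =>
        (QuotientGroup.eq_one_iff _).2 (Subgroup.subset_closure ⟨α, hα, rfl⟩)
      rw [eq_top_iff]
      rintro a -
      obtain ⟨b, rfl⟩ := ρ.rangeRestrict_surjective a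
      exact (QuotientGroup.eq_one_iff _).1 (DFunLike.congr_fun h1 b)
    have := finite_of_closure_eq_top (hF.image _) hs htop
    exact Set.toFinite _
  · intro hfin
    have : Finite ρ.range := hfin
    have : Finite F := hF
    -- Two homomorphisms agreeing on `F` have a quotient that vanishes on `F`.
    have hinj : Function.Injective fun (φ : PiOne (Punctured Y) y₀ →* ρ.range) (α : F) =>
        (homCocycle φ).val α.1.2 := by
      intro φ ψ h
      have h1 : φ / ψ = 1 := triv _ _ fun α hα => by
        have h2 : (homCocycle φ).val α.2 = (homCocycle ψ).val α.2 := congrFun h ⟨α, hα⟩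
        change φ _ / ψ _ = 1
        rw [div_eq_one]
        exact h2
      exact div_eq_one.1 h1
    have : Finite (PiOne (Punctured Y) y₀ →* ρ.range) := Finite.of_injective _ hinj
    refine (Set.finite_range fun φ : PiOne (Punctured Y) y₀ →* ρ.range =>
      repClass (ρ.range.subtype.comp φ)).subset ?_
    rintro _ ⟨m, rfl⟩
    obtain ⟨φ, hφ⟩ := smul_repClass_exists Y y₀ m ρ
    exact ⟨ρ.rangeRestrict.comp φ, hφ.symm⟩

end Transvection

/-! ### Isotopies and orientation -/

/-- A homotopy of functions without zeros on a set lifts to logarithms. -/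
theorem exists_continuousOn_log {s : Set ℂ} (g : unitInterval × s → ℂ) (hg : Continuous g)
    (hne : ∀ q, g q ≠ 0) (h0 : ∀ z, g (0, z) = 1) :
    ∃ l : ℂ → ℂ, ContinuousOn l s ∧ ∀ z : s, g (1, z) = Complex.exp (l z) := by
  classical
  let G : C(unitInterval × s, {z : ℂ // z ≠ 0}) := ⟨fun q => ⟨g q, hne q⟩, hg.subtype_mk _⟩
  let f : C(s, ℂ) := ⟨fun _ => 0, continuous_const⟩
  have hG : ∀ a, G (0, a) = (⟨_, (f a).exp_ne_zero⟩ : {z : ℂ // z ≠ 0}) := fun a => by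
    apply Subtype.ext
    change g (0, a) = Complex.exp 0
    rw [h0, Complex.exp_zero]
  let L := Complex.isCoveringMap_exp.liftHomotopy G f hG
  have hL := Complex.isCoveringMap_exp.liftHomotopy_lifts G f hG
  refine ⟨fun z => if hz : z ∈ s then L (1, ⟨z, hz⟩) else 0, ?_, fun z => ?_⟩
  · rw [continuousOn_iff_continuous_domRestrict]
    have h1 : Continuous fun z : s => L (1, z) := by fun_prop
    convert h1 using 2 with z
    simp
  · have h1 := congrArg Subtype.val (congrFun hL (1, z))
    simp only [Subtype.coe_eta, Subtype.coe_prop, dite_true]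
    exact h1.symm

/-- Injectivity keeps the differences `F t (p + z) - F t p` away from 0. Dividing by the difference
at time 0 gives a homotopy of nonvanishing functions starting at 1; it has a logarithm, which is
added to the one for `F 0`. -/
theorem OrientationPreservingAt.of_homotopy {F : unitInterval → ℂ → ℂ} {p : ℂ} {W : Set ℂ}
    (hW : W ∈ 𝓝 p) (hF : ContinuousOn (fun q : unitInterval × ℂ => F q.1 q.2) (Set.univ ×ˢ W))
    (hinj : ∀ t, Set.InjOn (F t) W) (h0 : OrientationPreservingAt (F 0) p) :
    OrientationPreservingAt (F 1) p := by
  obtain ⟨r, hr, l, hl, hfl⟩ := h0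
  obtain ⟨e, he, heW⟩ := Metric.mem_nhds_iff.1 hW
  set s : Set ℂ := Metric.ball 0 (min r e) \ {0} with hs
  have hpW : p ∈ W := mem_of_mem_nhds hW
  have hsW : ∀ z ∈ s, p + z ∈ W := fun z hz => heW (by
    have := Metric.ball_subset_ball (min_le_right r e) hz.1
    simpa [Metric.mem_ball, dist_eq_norm] using this)
  have hsr : s ⊆ Metric.ball 0 r \ {0} :=
    Set.sdiff_subset_sdiff_left (Metric.ball_subset_ball (min_le_left _ _))
  have hne : ∀ t, ∀ z ∈ s, F t (p + z) - F t p ≠ 0 := fun t z hz h => by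
    have := hinj t (hsW z hz) hpW (sub_eq_zero.1 h)
    exact hz.2 (by simpa using this)
  let g : unitInterval × s → ℂ := fun q =>
    (F q.1 (p + q.2) - F q.1 p) / (F 0 (p + q.2) - F 0 p)
  have hc1 : Continuous fun q : unitInterval × s => F q.1 (p + q.2) :=
    hF.comp_continuous (f := fun q : unitInterval × s => (q.1, p + (q.2 : ℂ))) (by fun_prop)
      fun q => ⟨trivial, hsW _ q.2.2⟩
  have hc2 : Continuous fun q : unitInterval × s => F q.1 p :=
    hF.comp_continuous (f := fun q : unitInterval × s => (q.1, p)) (by fun_prop)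
      fun q => ⟨trivial, hpW⟩
  have hc3 : Continuous fun q : unitInterval × s => F 0 (p + q.2) :=
    hF.comp_continuous (f := fun q : unitInterval × s => (0, p + (q.2 : ℂ))) (by fun_prop)
      fun q => ⟨trivial, hsW _ q.2.2⟩
  obtain ⟨m, hm, hgm⟩ := exists_continuousOn_log g
    ((hc1.sub hc2).div (hc3.sub continuous_const) fun q => hne 0 _ q.2.2)
    (fun q => div_ne_zero (hne _ _ q.2.2) (hne _ _ q.2.2))
    (fun z => div_self (hne 0 _ z.2))
  refine ⟨min r e, lt_min hr he, fun z => l z + m z, (hl.mono hsr).add hm, fun z hz => ?_⟩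
  have h1 := hgm ⟨z, hz⟩
  rw [div_eq_iff (hne 0 z hz)] at h1
  rw [h1, hfl z (hsr hz), Complex.exp_add]
  ring

section Isotopy

variable {S : Type*} [TopologicalSpace S]

/-- Near `x`, the map `h` is isotopic to the inclusion. -/
def LocallyIsotopic (h : S → S) (x : S) : Prop :=
  ∃ U ∈ 𝓝 x, ∃ H : unitInterval → S → S,
    ContinuousOn (fun q : unitInterval × S => H q.1 q.2) (Set.univ ×ˢ U) ∧
    (∀ t, Set.InjOn (H t) U) ∧ (∀ y ∈ U, H 0 y = y) ∧ ∀ y ∈ U, H 1 y = h y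

variable [ChartedSpace ℂ S] [HasGroupoid S orientationGroupoid]

theorem orientationPreservingAt_coord_change {c c' : OpenPartialHomeomorph S ℂ} (hc : c ∈ atlas ℂ S)
    (hc' : c' ∈ atlas ℂ S) {x : S} (hx : x ∈ c.source) (hx' : x ∈ c'.source) :
    OrientationPreservingAt (c' ∘ c.symm) (c x) := by
  have h := HasGroupoid.compatible (G := orientationGroupoid) hc hc'
  refine ((mem_groupoid_of_pregroupoid.1 h).1).2 (c x) ?_
  simp [hx, hx']

/-- Orientation preservation can be tested in any target chart. -/
theorem orientationPreservingAt_chart_change {c c₁ c₂ : OpenPartialHomeomorph S ℂ}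
    (hc₁ : c₁ ∈ atlas ℂ S) (hc₂ : c₂ ∈ atlas ℂ S) {x : S} (hx : x ∈ c.source) {U : Set S}
    (hU : U ∈ 𝓝 x) {f : S → S} (hf : ContinuousOn f U) (h1 : f x ∈ c₁.source)
    (h2 : f x ∈ c₂.source) (h : OrientationPreservingAt (c₁ ∘ f ∘ c.symm) (c x)) :
    OrientationPreservingAt (c₂ ∘ f ∘ c.symm) (c x) := by
  have hsymm : Filter.Tendsto c.symm (𝓝 (c x)) (𝓝 x) := by
    have := c.continuousAt_symm (c.map_source hx)
    rwa [ContinuousAt, c.left_inv hx] at this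
  have hfx : ContinuousAt f x := hf.continuousAt hU
  let V : Set ℂ := c.target ∩ c.symm ⁻¹' {y | y ∈ interior U ∧ f y ∈ c₁.source}
  have hVn : V ∈ 𝓝 (c x) := Filter.inter_mem (c.open_target.mem_nhds (c.map_source hx))
    (hsymm (Filter.inter_mem (interior_mem_nhds.2 hU) (hfx (c₁.open_source.mem_nhds h1))))
  have hcV : ContinuousOn (c₁ ∘ f ∘ c.symm) V := by
    refine c₁.continuousOn.comp (hf.comp (c.continuousOn_symm.mono fun y hy => hy.1) ?_) ?_
    · exact fun y hy => interior_subset hy.2.1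
    · exact fun y hy => hy.2.2
  have h3 := orientationPreservingAt_coord_change hc₁ hc₂ h1 h2
  have hval : (c₁ ∘ f ∘ c.symm) (c x) = c₁ (f x) := by simp [hx]
  refine (h.comp hVn hcV (by rw [hval]; exact h3)).congr ?_
  filter_upwards [hVn] with y hy
  simp only [Function.comp]
  rw [c₁.left_inv hy.2.2]

/-- The track `H t x` may leave any given chart, so time is treated locally: while the track stays
in one chart, the homotopy argument applies along paths of times. Hence preservation of orientation
in all charts is a locally constant property of `t`, and it holds at `t = 0`. -/
theorem LocallyIsotopic.orientationPreservingAt {h : S → S} {x : S} (hx : LocallyIsotopic h x)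
    {c c' : OpenPartialHomeomorph S ℂ} (hc : c ∈ atlas ℂ S) (hc' : c' ∈ atlas ℂ S)
    (hxc : x ∈ c.source) (hxc' : h x ∈ c'.source) :
    OrientationPreservingAt (c' ∘ h ∘ c.symm) (c x) := by
  obtain ⟨U₀, hU₀, H, hH, hinj, hH0, hH1⟩ := hx
  wlog hUo : IsOpen U₀ generalizing U₀
  · obtain ⟨U, hUU, hU, hxU⟩ := mem_nhds_iff.1 hU₀
    exact this U (hU.mem_nhds hxU) (hH.mono (Set.prod_mono le_rfl hUU))
      (fun t => (hinj t).mono hUU) (fun y hy => hH0 y (hUU hy)) (fun y hy => hH1 y (hUU hy)) hU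
  have hxU : x ∈ U₀ := mem_of_mem_nhds hU₀
  have hHt : ∀ t, ContinuousOn (H t) U₀ := fun t =>
    hH.comp (f := fun y => (t, y)) (by fun_prop) fun y hy => ⟨trivial, hy⟩
  have hsymm : Filter.Tendsto c.symm (𝓝 (c x)) (𝓝 x) := by
    have := c.continuousAt_symm (c.map_source hxc)
    rwa [ContinuousAt, c.left_inv hxc] at this
  let P : unitInterval → Prop := fun t =>
    ∀ c' ∈ atlas ℂ S, H t x ∈ c'.source → OrientationPreservingAt (c' ∘ H t ∘ c.symm) (c x)
  have hP : IsLocallyConstant P := by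
    rw [IsLocallyConstant.iff_eventually_eq]
    intro t₀
    set d := chartAt ℂ (H t₀ x) with hd
    have hda : d ∈ atlas ℂ S := chart_mem_atlas ℂ _
    have hopen : IsOpen (Set.univ ×ˢ U₀ ∩ (fun q : unitInterval × S => H q.1 q.2) ⁻¹' d.source) :=
      hH.isOpen_inter_preimage (isOpen_univ.prod hUo) d.open_source
    have hmem : (t₀, x) ∈ Set.univ ×ˢ U₀ ∩
        (fun q : unitInterval × S => H q.1 q.2) ⁻¹' d.source :=
      ⟨⟨trivial, hxU⟩, mem_chart_source ℂ _⟩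
    obtain ⟨N, hN, V, hV, hNV⟩ := mem_nhds_prod_iff.1 (hopen.mem_nhds hmem)
    have : LocallyPathConnectedSpace unitInterval :=
      (convex_Icc (0 : ℝ) 1).locallyPathConnectedSpace
    obtain ⟨N', ⟨hN', hN'c⟩, hN'N⟩ := (path_connected_basis t₀).mem_iff.1 hN
    have hxV : x ∈ V := mem_of_mem_nhds hV
    have hds : ∀ t ∈ N', ∀ y ∈ V, H t y ∈ d.source := fun t ht y hy =>
      (hNV (Set.mk_mem_prod (hN'N ht) hy)).2
    have hVU : V ⊆ U₀ := fun y hy => (hNV (Set.mk_mem_prod (mem_of_mem_nhds hN) hy)).1.2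
    have transfer : ∀ t ∈ N', ∀ t' ∈ N', P t → P t' := by
      intro t ht t' ht' hPt e he hxe
      obtain ⟨γ, hγ⟩ := hN'c.joinedIn t ht t' ht'
      refine orientationPreservingAt_chart_change hda he hxc hU₀ (hHt t') (hds t' ht' x hxV) hxe ?_
      let W : Set ℂ := c.target ∩ c.symm ⁻¹' V
      have hW : W ∈ 𝓝 (c x) :=
        Filter.inter_mem (c.open_target.mem_nhds (c.map_source hxc)) (hsymm hV)
      have key := OrientationPreservingAt.of_homotopy (F := fun s => d ∘ H (γ s) ∘ c.symm)
        (p := c x) hW ?_ ?_ ?_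
      · simpa using key
      · refine d.continuousOn.comp (hH.comp
          (f := fun q : unitInterval × ℂ => (γ q.1, c.symm q.2)) ?_ ?_) ?_
        · exact (γ.continuous.comp continuous_fst).continuousOn.prodMk
            (c.continuousOn_symm.comp continuousOn_snd fun q hq => hq.2.1)
        · exact fun q hq => ⟨trivial, hVU hq.2.2⟩
        · exact fun q hq => hds _ (hγ _) _ hq.2.2
      · intro s y hy y' hy' hyy
        have h1 := d.injOn (hds _ (hγ s) _ hy.2) (hds _ (hγ s) _ hy'.2) hyy
        exact c.symm.injOn hy.1 hy'.1 (hinj _ (hVU hy.2) (hVU hy'.2) h1)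
      · simpa using hPt d hda (hds t ht x hxV)
    filter_upwards [hN'] with t ht
    exact propext ⟨transfer t ht t₀ (mem_of_mem_nhds hN'), transfer t₀ (mem_of_mem_nhds hN') t ht⟩
  have hP0 : P 0 := by
    intro e he hxe
    rw [hH0 x hxU] at hxe
    refine (orientationPreservingAt_coord_change hc he hxc hxe).congr ?_
    filter_upwards [hsymm hU₀] with y hy
    simp only [Function.comp]
    rw [hH0 _ hy]
  have hP1 : P 1 := by rwa [hP.apply_eq_of_preconnectedSpace 1 0]
  refine (hP1 c' hc' (by rwa [hH1 x hxU])).congr ?_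
  filter_upwards [hsymm hU₀] with y hy
  simp only [Function.comp]
  rw [hH1 _ hy]

/-- A Dehn twist need not be isotopic to the identity, but near each point it is isotopic to the
inclusion, and orientation is a local matter. Membership in the groupoid also needs the inverse. -/
theorem isOrientationPreserving_of_locallyIsotopic (h : S ≃ₜ S)
    (h1 : ∀ x, LocallyIsotopic h x) (h2 : ∀ x, LocallyIsotopic h.symm x) :
    IsOrientationPreserving h := by
  have key : ∀ k : S ≃ₜ S, (∀ x, LocallyIsotopic k x) → ∀ c ∈ atlas ℂ S, ∀ c' ∈ atlas ℂ S,
      orientationPregroupoid.property (c.symm.trans (k.toOpenPartialHomeomorph.trans c'))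
        (c.symm.trans (k.toOpenPartialHomeomorph.trans c')).source := by
    intro k hk c hc c' hc'
    refine ⟨OpenPartialHomeomorph.continuousOn _, fun p hp => ?_⟩
    simp only [OpenPartialHomeomorph.trans_source, OpenPartialHomeomorph.symm_source,
      Homeomorph.toOpenPartialHomeomorph_source, Set.univ_inter, Set.mem_inter_iff,
      Set.mem_preimage] at hp
    have := (hk (c.symm p)).orientationPreservingAt hc hc' (c.map_target hp.1) hp.2
    rwa [c.right_inv hp.1] at this
  intro c hc c' hc'
  refine mem_groupoid_of_pregroupoid.2 ⟨key h h1 c hc c' hc', ?_⟩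
  have h3 := key h.symm h2 c' hc' c hc
  have h4 : (c.symm.trans (h.toOpenPartialHomeomorph.trans c')).symm =
      c'.symm.trans (h.symm.toOpenPartialHomeomorph.trans c) := by
    rw [OpenPartialHomeomorph.trans_symm_eq_symm_trans_symm,
      OpenPartialHomeomorph.trans_symm_eq_symm_trans_symm, OpenPartialHomeomorph.trans_assoc,
      OpenPartialHomeomorph.symm_symm, Homeomorph.symm_toOpenPartialHomeomorph]
  rw [← OpenPartialHomeomorph.symm_source, h4]
  exact h3

end Isotopy

/-! ### Annuli and twists -/

theorem isPreconnected_diff_finset {S : Type*} [TopologicalSpace S] [T1Space S] [ChartedSpace ℂ S]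
    {U : Set S} (hU : IsOpen U) (hc : IsPreconnected U) (Y : Finset S) :
    IsPreconnected (U \ Y) := by
  classical
  induction Y using Finset.induction_on with
  | empty => simpa using hc
  | insert a Y _ ih =>
    have h := isPreconnected_diff_singleton (hU.sdiff Y.finite_toSet.isClosed) ih a
    rwa [Set.sdiff_sdiff, Set.union_comm, Set.singleton_union, ← Finset.coe_insert] at h

/-- An open annulus in `S`, parametrized by `ℝ/ℤ × (lo, hi)`. -/
structure Annulus (S : Type*) [TopologicalSpace S] where
  /-- The parametrization. -/
  chart : OpenPartialHomeomorph (AddCircle (1 : ℝ) × ℝ) S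
  /-- The lower end. -/
  lo : ℝ
  /-- The upper end. -/
  hi : ℝ
  source_eq : chart.source = Set.univ ×ˢ Set.Ioo lo hi

/-- A ramp function, with value `0` on the left of `[a, b]` and `1` on the right. -/
def ramp (a b r : ℝ) : ℝ := max 0 (min 1 ((r - a) / (b - a)))

theorem continuous_ramp (a b : ℝ) : Continuous (ramp a b) := by
  unfold ramp; fun_prop

theorem ramp_of_le {a b r : ℝ} (h : a < b) (hr : r ≤ a) : ramp a b r = 0 := by
  have h1 : (r - a) / (b - a) ≤ 0 := div_nonpos_of_nonpos_of_nonneg (by linarith) (by linarith)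
  exact max_eq_left ((min_le_right _ _).trans h1)

theorem ramp_of_ge {a b r : ℝ} (h : a < b) (hr : b ≤ r) : ramp a b r = 1 := by
  have h1 : 1 ≤ (r - a) / (b - a) := by rw [le_div_iff₀ (by linarith)]; linarith
  rw [ramp, min_eq_left h1, max_eq_right zero_le_one]

/-- Off `[a, b]` the ramp is 0 or 1, so an integer multiple vanishes in ℝ/ℤ. This lets an integral
twist extend by the identity. -/
theorem intCast_mul_ramp {a b r : ℝ} (h : a < b) (hr : r ∉ Set.Icc a b) (k : ℤ) :
    (((k : ℝ) * ramp a b r : ℝ) : AddCircle (1 : ℝ)) = 0 := by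
  by_cases h1 : r ≤ a
  · rw [ramp_of_le h h1, mul_zero]; rfl
  · have h2 : b ≤ r := by
      by_contra h2
      exact hr ⟨(not_le.1 h1).le, (not_le.1 h2).le⟩
    rw [ramp_of_ge h h2, mul_one]
    rw [AddCircle.coe_eq_zero_iff]
    exact ⟨k, by simp⟩

namespace Annulus

variable {S : Type*} [TopologicalSpace S] (E : Annulus S)

/-- The part of the annulus over an interval. -/
def band (a b : ℝ) : Set S := E.chart '' (Set.univ ×ˢ Set.Ioo a b)

/-- The parametrization of the universal covering of the annulus. -/
def cov (q : ℝ × ℝ) : S := E.chart ((q.1 : AddCircle (1 : ℝ)), q.2)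

theorem mem_source {θ : AddCircle (1 : ℝ)} {r : ℝ} (hr : r ∈ Set.Ioo E.lo E.hi) :
    (θ, r) ∈ E.chart.source := by
  rw [E.source_eq]; exact ⟨trivial, hr⟩

theorem isLocalHomeomorphOn_cov : IsLocalHomeomorphOn E.cov (Set.univ ×ˢ Set.Ioo E.lo E.hi) := by
  have h1 : IsLocalHomeomorph fun q : ℝ × ℝ => ((q.1 : AddCircle (1 : ℝ)), q.2) := by
    refine IsLocalHomeomorph.mk _ fun q => ?_
    obtain ⟨e, hqe, he⟩ := AddCircle.isLocalHomeomorph_coe (1 : ℝ) q.1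
    refine ⟨e.prod (OpenPartialHomeomorph.refl ℝ), ⟨hqe, trivial⟩, fun p _ => ?_⟩
    change ((p.1 : AddCircle (1 : ℝ)), p.2) = (e p.1, p.2)
    rw [← he]
  have h2 : IsLocalHomeomorphOn E.chart E.chart.source :=
    IsLocalHomeomorphOn.mk _ _ fun x hx => ⟨E.chart, hx, fun _ _ => rfl⟩
  refine h2.comp (h1.isLocalHomeomorphOn.mono (Set.subset_univ _)) ?_
  rintro q ⟨-, hq⟩
  exact E.mem_source hq

theorem isLocalHomeomorph_cov_subtype {K : Set (ℝ × ℝ)} (hK : IsOpen K)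
    (hKE : K ⊆ Set.univ ×ˢ Set.Ioo E.lo E.hi) :
    IsLocalHomeomorph fun c : K => E.cov c := by
  rw [isLocalHomeomorph_iff_isLocalHomeomorphOn_univ]
  exact (E.isLocalHomeomorphOn_cov.mono hKE).comp
    (hK.isOpenEmbedding_subtypeVal.isLocalHomeomorph.isLocalHomeomorphOn.mono (Set.subset_univ _))
    fun c _ => c.2

theorem cov_add_int (u r : ℝ) (n : ℤ) : E.cov (u + n, r) = E.cov (u, r) := by
  have : ((u + n : ℝ) : AddCircle (1 : ℝ)) = u := by
    rw [AddCircle.coe_add, add_eq_left, AddCircle.coe_eq_zero_iff]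
    exact ⟨n, by simp⟩
  simp [cov, this]

theorem cov_mem_band {a b u r : ℝ} (hr : r ∈ Set.Ioo a b) : E.cov (u, r) ∈ E.band a b :=
  ⟨_, ⟨trivial, hr⟩, rfl⟩

theorem exists_cov_eq {a b : ℝ} {x : S} (hx : x ∈ E.band a b) :
    ∃ u : ℝ, ∃ r ∈ Set.Ioo a b, E.cov (u, r) = x := by
  obtain ⟨⟨θ, r⟩, ⟨-, hr⟩, rfl⟩ := hx
  obtain ⟨u, rfl⟩ := QuotientAddGroup.mk_surjective θ
  exact ⟨u, r, hr, rfl⟩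

theorem cov_eq_iff {u u' r r' : ℝ} (hr : r ∈ Set.Ioo E.lo E.hi) (hr' : r' ∈ Set.Ioo E.lo E.hi) :
    E.cov (u, r) = E.cov (u', r') ↔ (∃ n : ℤ, u' = u + n) ∧ r = r' := by
  constructor
  · intro h
    have h1 := E.chart.injOn (E.mem_source hr) (E.mem_source hr') h
    rw [Prod.mk.injEq] at h1
    refine ⟨?_, h1.2⟩
    have h2 : ((u' - u : ℝ) : AddCircle (1 : ℝ)) = 0 := by
      rw [AddCircle.coe_sub, ← h1.1, sub_self]
    obtain ⟨n, hn⟩ := AddCircle.coe_eq_zero_iff _ |>.1 h2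
    exact ⟨n, by simp at hn; linarith⟩
  · rintro ⟨⟨n, rfl⟩, rfl⟩
    exact (E.cov_add_int u r n).symm

theorem isOpen_band {a b : ℝ} (ha : E.lo ≤ a) (hb : b ≤ E.hi) : IsOpen (E.band a b) := by
  refine E.chart.isOpen_image_of_subset_source (isOpen_univ.prod isOpen_Ioo) ?_
  rw [E.source_eq]
  exact Set.prod_mono le_rfl (Set.Ioo_subset_Ioo ha hb)

/-! #### The twist -/

/-- The rotation of the levels of the annulus by `s` times a ramp function on `[a, b]`. -/
def twistFun (a b s : ℝ) (x : S) : S :=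
  open Classical in
  if x ∈ E.chart.target then
    E.chart ((E.chart.symm x).1 + ((s * ramp a b (E.chart.symm x).2 : ℝ) : AddCircle (1 : ℝ)),
      (E.chart.symm x).2)
  else x

theorem mem_source_of_mem_target {x : S} (hx : x ∈ E.chart.target) (θ : AddCircle (1 : ℝ)) :
    (θ, (E.chart.symm x).2) ∈ E.chart.source := by
  have h := E.chart.map_target hx
  rw [E.source_eq] at h ⊢
  exact ⟨trivial, h.2⟩

theorem twistFun_mem_target {a b s : ℝ} {x : S} (hx : x ∈ E.chart.target) :
    E.twistFun a b s x ∈ E.chart.target := by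
  rw [twistFun, if_pos hx]
  exact E.chart.map_source (E.mem_source_of_mem_target hx _)

/-- Rotations preserve levels, so the ramp has the same value at both stages and the parameters add.
-/
theorem twistFun_twistFun (a b s t : ℝ) (x : S) :
    E.twistFun a b s (E.twistFun a b t x) = E.twistFun a b (s + t) x := by
  by_cases hx : x ∈ E.chart.target
  · rw [twistFun, if_pos (E.twistFun_mem_target hx)]
    have h1 := E.chart.left_inv (E.mem_source_of_mem_target hx
      ((E.chart.symm x).1 + ((t * ramp a b (E.chart.symm x).2 : ℝ) : AddCircle (1 : ℝ))))
    have h2 : E.chart.symm (E.twistFun a b t x) = ((E.chart.symm x).1 +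
        ((t * ramp a b (E.chart.symm x).2 : ℝ) : AddCircle (1 : ℝ)), (E.chart.symm x).2) := by
      rw [twistFun, if_pos hx]; exact h1
    rw [h2, twistFun, if_pos hx, add_assoc, ← AddCircle.coe_add, add_comm s t, add_mul]
  · have h : ∀ s, E.twistFun a b s x = x := fun s => if_neg hx
    rw [h, h, h]

theorem twistFun_zero (a b : ℝ) (x : S) : E.twistFun a b 0 x = x := by
  by_cases hx : x ∈ E.chart.target
  · rw [twistFun, if_pos hx, zero_mul, AddCircle.coe_zero, add_zero]
    exact E.chart.right_inv hx
  · rw [twistFun, if_neg hx]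

theorem continuousOn_twistFun (a b : ℝ) :
    ContinuousOn (fun q : ℝ × S => E.twistFun a b q.1 q.2) (Set.univ ×ˢ E.chart.target) := by
  have h1 : ContinuousOn (fun q : ℝ × S => E.chart.symm q.2) (Set.univ ×ˢ E.chart.target) :=
    E.chart.continuousOn_symm.comp continuousOn_snd fun q hq => hq.2
  have h2 : ContinuousOn (fun q : ℝ × S => E.chart ((E.chart.symm q.2).1 +
      ((q.1 * ramp a b (E.chart.symm q.2).2 : ℝ) : AddCircle (1 : ℝ)), (E.chart.symm q.2).2))
      (Set.univ ×ˢ E.chart.target) := by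
    refine E.chart.continuousOn.comp ?_ fun q hq => E.mem_source_of_mem_target hq.2 _
    refine ContinuousOn.prodMk (h1.fst.add ?_) h1.snd
    exact (AddCircle.continuous_mk' (1 : ℝ)).comp_continuousOn
      (continuousOn_fst.mul ((continuous_ramp a b).comp_continuousOn h1.snd))
  exact h2.congr fun q hq => if_pos hq.2

theorem twistFun_eq_self {a b : ℝ} (hab : a < b) (k : ℤ) {x : S}
    (hx : x ∉ E.chart '' (Set.univ ×ˢ Set.Icc a b)) : E.twistFun a b k x = x := by
  by_cases ht : x ∈ E.chart.target
  · have h1 : (E.chart.symm x).2 ∉ Set.Icc a b := fun h =>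
      hx ⟨E.chart.symm x, ⟨trivial, h⟩, E.chart.right_inv ht⟩
    rw [twistFun, if_pos ht, intCast_mul_ramp hab h1, add_zero]
    exact E.chart.right_inv ht
  · rw [twistFun, if_neg ht]

theorem twistFun_cov (a b s : ℝ) {u r : ℝ} (hr : r ∈ Set.Ioo E.lo E.hi) :
    E.twistFun a b s (E.cov (u, r)) = E.cov (u + s * ramp a b r, r) := by
  have h := E.mem_source (θ := u) hr
  rw [cov, twistFun, if_pos (E.chart.map_source h), E.chart.left_inv h, cov, AddCircle.coe_add]

theorem isClosed_image [T2Space S] {a b : ℝ} (ha : E.lo < a) (hb : b < E.hi) :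
    IsClosed (E.chart '' (Set.univ ×ˢ Set.Icc a b)) := by
  refine ((isCompact_univ.prod isCompact_Icc).image_of_continuousOn
    (E.chart.continuousOn.mono ?_)).isClosed
  rw [E.source_eq]
  exact Set.prod_mono le_rfl fun r hr => ⟨ha.trans_le hr.1, hr.2.trans_lt hb⟩

theorem continuous_twistFun [T2Space S] {a b : ℝ} (ha : E.lo < a) (hab : a < b) (hb : b < E.hi)
    (k : ℤ) : Continuous (E.twistFun a b k) := by
  rw [continuous_iff_continuousAt]
  intro x
  by_cases hx : x ∈ E.chart '' (Set.univ ×ˢ Set.Icc a b)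
  · have ht : x ∈ E.chart.target := by
      obtain ⟨⟨θ, r⟩, ⟨-, hr⟩, rfl⟩ := hx
      exact E.chart.map_source (E.mem_source ⟨ha.trans_le hr.1, hr.2.trans_lt hb⟩)
    have h1 : ContinuousOn (E.twistFun a b k) E.chart.target :=
      (E.continuousOn_twistFun a b).comp (f := fun y => ((k : ℝ), y)) (by fun_prop)
        fun y hy => ⟨trivial, hy⟩
    exact h1.continuousAt (E.chart.open_target.mem_nhds ht)
  · refine continuousAt_id.congr ?_
    filter_upwards [(E.isClosed_image ha hb).isOpen_compl.mem_nhds hx] with y hy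
    exact (E.twistFun_eq_self hab k hy).symm

/-- The `k`-fold twist, supported over `[a, b]`. -/
def twist [T2Space S] {a b : ℝ} (ha : E.lo < a) (hab : a < b) (hb : b < E.hi) (k : ℤ) : S ≃ₜ S where
  toFun := E.twistFun a b k
  invFun := E.twistFun a b (-k : ℤ)
  left_inv x := by rw [twistFun_twistFun]; simp [twistFun_zero]
  right_inv x := by rw [twistFun_twistFun]; simp [twistFun_zero]
  continuous_toFun := E.continuous_twistFun ha hab hb k
  continuous_invFun := E.continuous_twistFun ha hab hb (-k)

theorem locallyIsotopic_twistFun [T2Space S] {a b : ℝ} (ha : E.lo < a) (hab : a < b) (hb : b < E.hi)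
    (k : ℤ) (x : S) : LocallyIsotopic (E.twistFun a b k) x := by
  by_cases hx : x ∈ E.chart '' (Set.univ ×ˢ Set.Icc a b)
  · have ht : x ∈ E.chart.target := by
      obtain ⟨⟨θ, r⟩, ⟨-, hr⟩, rfl⟩ := hx
      exact E.chart.map_source (E.mem_source ⟨ha.trans_le hr.1, hr.2.trans_lt hb⟩)
    -- The twist by the real amount `t * k` need not be continuous on `S`, but on the annulus it is,
    -- and that is all a local isotopy requires.
    refine ⟨E.chart.target, E.chart.open_target.mem_nhds ht,
      fun t => E.twistFun a b (t * k), ?_, fun t y _ z _ h => ?_, fun y _ => ?_, fun y _ => ?_⟩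
    · exact (E.continuousOn_twistFun a b).comp
        (f := fun q : unitInterval × S => ((q.1 : ℝ) * k, q.2)) (by fun_prop)
        fun q hq => ⟨trivial, hq.2⟩
    · have h1 := congrArg (E.twistFun a b (-(t * k))) h
      simpa [twistFun_twistFun, twistFun_zero] using h1
    · simp [twistFun_zero]
    · simp
  · refine ⟨_, (E.isClosed_image ha hb).isOpen_compl.mem_nhds hx, fun _ y => y, ?_, ?_, ?_, ?_⟩
    · exact continuousOn_snd
    · exact fun t y _ z _ h => h
    · exact fun _ _ => rfl
    · exact fun y hy => (E.twistFun_eq_self hab k hy).symm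

variable [ChartedSpace ℂ S] [HasGroupoid S orientationGroupoid]

/-- The `k`-fold twist as an orientation preserving homeomorphism fixing `Y`. -/
def twistPlus [T2Space S] {a b : ℝ} (ha : E.lo < a) (hab : a < b) (hb : b < E.hi) (Y : Finset S)
    (hY : ∀ y ∈ Y, y ∉ E.chart '' (Set.univ ×ˢ Set.Icc a b)) (k : ℤ) : HomeoPlus Y :=
  ⟨E.twist ha hab hb k, isOrientationPreserving_of_locallyIsotopic _
      (E.locallyIsotopic_twistFun ha hab hb k) (E.locallyIsotopic_twistFun ha hab hb (-k)),
    fun x => by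
      constructor
      · intro hx
        have h1 : E.twist ha hab hb k x = x := (E.twist ha hab hb k).injective
          (E.twistFun_eq_self hab k (hY _ hx))
        rwa [h1] at hx
      · intro hx
        have h1 : E.twist ha hab hb k x = x := E.twistFun_eq_self hab k (hY _ hx)
        rwa [h1]⟩

end Annulus

/-! ### Transvections in annuli, and gluing of trivial pieces -/

section Pieces

variable {S : Type*} [TopologicalSpace S] {Y : Finset S}

theorem isLocalHomeomorph_punctured [T1Space S] {C : Type*} [TopologicalSpace C] {s : C → S}
    (hs : IsLocalHomeomorph s) (hY : ∀ c, s c ∉ Y) :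
    IsLocalHomeomorph fun c => (⟨s c, hY c⟩ : Punctured Y) :=
  IsLocalHomeomorph.of_comp (g := Subtype.val) (f := fun c => (⟨s c, hY c⟩ : Punctured Y))
    hs Y.finite_toSet.isClosed.isOpen_compl.isOpenEmbedding_subtypeVal.isLocalHomeomorph
    (hs.continuous.subtype_mk _)

namespace Annulus

variable (E : Annulus S)

/-- The loop running once around the annulus at the level `c`. -/
def core {c : ℝ} (hc : c ∈ Set.Ioo E.lo E.hi) (hY : ∀ u, E.cov (u, c) ∉ Y) :
    Path (⟨E.cov (0, c), hY 0⟩ : Punctured Y) ⟨E.cov (0, c), hY 0⟩ where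
  toFun t := ⟨E.cov (t, c), hY t⟩
  continuous_toFun := Continuous.subtype_mk (E.isLocalHomeomorphOn_cov.continuousOn.comp_continuous
    (f := fun t : unitInterval => ((t : ℝ), c)) (by fun_prop) fun _ => ⟨trivial, hc⟩) _
  source' := by simp
  target' := by
    have h := E.cov_add_int 0 c 1
    apply Subtype.ext
    simpa using h

/-- A primitive of a cocycle on the universal covering of an annulus in `S \ Y`. -/
theorem exists_strip_primitive [T1Space S] {α β c : ℝ} (hα : E.lo ≤ α) (hβ : β ≤ E.hi)
    (hc : c ∈ Set.Ioo α β) (hcE : c ∈ Set.Ioo E.lo E.hi)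
    (hY : ∀ u, ∀ r ∈ Set.Ioo α β, E.cov (u, r) ∉ Y)
    {A : Type*} [CommGroup A] (l : PathCocycle (Punctured Y) A) :
    ∃ f : ℝ × ℝ → A,
      (∀ ⦃x y : Punctured Y⦄ (p : Path x y) (q : unitInterval → ℝ × ℝ), Continuous q →
        (∀ t, (q t).2 ∈ Set.Ioo α β) → (∀ t, E.cov (q t) = p t) →
        l.val p = (f (q 0))⁻¹ * f (q 1)) ∧
      (∀ u, ∀ r ∈ Set.Ioo α β, ∀ n : ℤ,
        f (u + n, r) = f (u, r) * l.val (E.core hcE fun u => hY u c hc) ^ n) ∧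
      (l.val (E.core hcE fun u => hY u c hc) = 1 →
        l.TrivialOn (Subtype.val ⁻¹' E.band α β)) := by
  classical
  set ℓ := l.val (E.core hcE fun u => hY u c hc) with hℓ
  let K : Set (ℝ × ℝ) := Set.univ ×ˢ Set.Ioo α β
  have hKo : IsOpen K := isOpen_univ.prod isOpen_Ioo
  have hKE : K ⊆ Set.univ ×ˢ Set.Ioo E.lo E.hi :=
    Set.prod_mono le_rfl (Set.Ioo_subset_Ioo hα hβ)
  have : ContractibleSpace K :=
    (convex_univ.prod (convex_Ioo α β)).contractibleSpace ⟨(0, c), trivial, hc⟩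
  let s : K → Punctured Y := fun q => ⟨E.cov q, hY _ _ q.2.2⟩
  have hs : IsLocalHomeomorph s :=
    isLocalHomeomorph_punctured (E.isLocalHomeomorph_cov_subtype hKo hKE) fun q => hY _ _ q.2.2
  obtain ⟨f, hf⟩ := PathCocycle.exists_primitive (l.comap ⟨s, hs.continuous⟩)
  let F : ℝ × ℝ → A := fun q => if hq : q ∈ K then f ⟨q, hq⟩ else 1
  have hFf : ∀ q (hq : q ∈ K), F q = f ⟨q, hq⟩ := fun q hq => dif_pos hq
  have h1 : ∀ ⦃x y : Punctured Y⦄ (p : Path x y) (q : unitInterval → ℝ × ℝ), Continuous q →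
        (∀ t, (q t).2 ∈ Set.Ioo α β) → (∀ t, E.cov (q t) = p t) →
        l.val p = (F (q 0))⁻¹ * F (q 1) := by
    intro x y p q hq hqK hqp
    let q' : Path (⟨q 0, trivial, hqK 0⟩ : K) ⟨q 1, trivial, hqK 1⟩ :=
      ⟨⟨fun t => ⟨q t, trivial, hqK t⟩, hq.subtype_mk _⟩, rfl, rfl⟩
    rw [l.val_congr p (q'.map hs.continuous) fun t => Subtype.ext (hqp t).symm]
    rw [hFf _ ⟨trivial, hqK 0⟩, hFf _ ⟨trivial, hqK 1⟩]
    exact hf q'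
  -- Translation by `n` is a deck transformation of the strip, so it multiplies the primitive by a
  -- constant.
  have hdeck : ∀ (n : ℤ) (a b : K), F (a.1.1 + n, a.1.2) / F a = F (b.1.1 + n, b.1.2) / F b := by
    intro n a b
    let d : K → K := fun q => ⟨(q.1.1 + n, q.1.2), trivial, q.2.2⟩
    have h2 := l.primitive_deck hs.continuous hf (d := d)
      (Continuous.subtype_mk (by fun_prop) _)
      (fun q => Subtype.ext (E.cov_add_int q.1.1 q.1.2 n)) a b
    rw [hFf a a.2, hFf b b.2, hFf _ (d a).2, hFf _ (d b).2]
    exact h2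
  -- The core lifts to the segment from (0, c) to (1, c), which identifies the constant for the unit
  -- translation.
  have hcore : ℓ = F (1, c) / F (0, c) := by
    rw [hℓ, h1 (E.core hcE fun u => hY u c hc) (fun t => ((t : ℝ), c)) (by fun_prop)
      (fun _ => hc) (fun t => rfl), div_eq_inv_mul]
    simp
  have hone : ∀ u, ∀ r ∈ Set.Ioo α β, F (u + 1, r) = F (u, r) * ℓ := by
    intro u r hr
    have h2 := hdeck 1 ⟨(u, r), trivial, hr⟩ ⟨(0, c), trivial, hc⟩
    simp only [Int.cast_one, zero_add] at h2
    rw [← hcore] at h2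
    rw [← h2, mul_div_cancel]
  have hint : ∀ u, ∀ r ∈ Set.Ioo α β, ∀ n : ℤ, F (u + n, r) = F (u, r) * ℓ ^ n := by
    intro u r hr n
    induction n with
    | zero => simp
    | succ i ih =>
      push_cast at ih ⊢
      rw [← add_assoc, hone _ _ hr, ih, zpow_add_one, mul_assoc]
    | pred i ih =>
      have h2 := hone (u + ((-i - 1 : ℤ) : ℝ)) r hr
      rw [show u + ((-i - 1 : ℤ) : ℝ) + 1 = u + ((-i : ℤ) : ℝ) by push_cast; ring, ih] at h2
      rw [zpow_sub_one, ← mul_assoc, h2, mul_inv_cancel_right]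
  refine ⟨F, h1, hint, fun hℓ1 => ?_⟩
  -- If the core has value 1, the primitive is periodic and descends to the annulus.
  have h2 := l.trivialOn_range hs hf fun a b hab => by
    have h3 := congrArg Subtype.val hab
    obtain ⟨⟨n, hn⟩, hr⟩ := (E.cov_eq_iff (hKE a.2).2 (hKE b.2).2).1 h3
    have h4 := hint a.1.1 a.1.2 a.2.2 n
    rw [hℓ1, one_zpow, mul_one, ← hn, hr] at h4
    rw [← hFf a a.2, ← hFf b b.2]
    exact (congrArg F (Prod.ext rfl hr : a.1 = (a.1.1, b.1.2))).trans h4.symm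
  refine h2.mono ?_
  rintro ⟨x, hx⟩ hxb
  obtain ⟨u, r, hr, hur⟩ := E.exists_cov_eq hxb
  exact ⟨⟨(u, r), trivial, hr⟩, Subtype.ext hur⟩

variable [ChartedSpace ℂ S] [HasGroupoid S orientationGroupoid]

/-- The dual loop crosses the twisting zone `[a, b]` once, from level `c` to `c'`, and returns
outside the zone, which is possible because the annulus does not separate. The twist fixes the core
and the return path; the crossing arc picks up `k` turns. -/
theorem hasTransvections_core [T2Space S] {α β c a b c' : ℝ} (hα : E.lo ≤ α) (hβ : β ≤ E.hi)
    (hαc : α < c) (hca : c < a) (hab : a < b) (hbc : b < c') (hcβ : c' < β)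
    (hcE : c ∈ Set.Ioo E.lo E.hi)
    (hY : ∀ u, ∀ r ∈ Set.Ioo α β, E.cov (u, r) ∉ Y)
    (hN : IsPreconnected (E.chart '' (Set.univ ×ˢ Set.Icc a b))ᶜ) :
    HasTransvections Y (E.core hcE fun u => hY u c ⟨hαc, by linarith⟩) := by
  have ha : E.lo < a := by linarith
  have hb : b < E.hi := by linarith
  have hcI : c ∈ Set.Ioo α β := ⟨hαc, by linarith⟩
  have hcI' : c' ∈ Set.Ioo α β := ⟨by linarith, hcβ⟩
  have hcE' : c' ∈ Set.Ioo E.lo E.hi := ⟨by linarith, by linarith⟩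
  set N := (E.chart '' (Set.univ ×ˢ Set.Icc a b))ᶜ with hNdef
  have hNo : IsOpen N := (E.isClosed_image ha hb).isOpen_compl
  have hcovN : ∀ u r, r ∈ Set.Ioo α β → r ∉ Set.Icc a b → E.cov (u, r) ∈ N := by
    rintro u r hr hrab ⟨⟨θ, r'⟩, ⟨-, hr'⟩, h⟩
    have h1 := E.chart.injOn (E.mem_source ⟨ha.trans_le hr'.1, hr'.2.trans_lt hb⟩)
      (E.mem_source ⟨hα.trans_lt hr.1, hr.2.trans_le hβ⟩) h
    exact hrab ((Prod.mk.inj h1).2 ▸ hr')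
  have hYN : ∀ y ∈ Y, y ∉ E.chart '' (Set.univ ×ˢ Set.Icc a b) := by
    rintro y hy ⟨⟨θ, r⟩, ⟨-, hr⟩, rfl⟩
    obtain ⟨u, rfl⟩ := QuotientAddGroup.mk_surjective θ
    exact hY u r ⟨by linarith [hr.1], by linarith [hr.2]⟩ hy
  have hx : E.cov (0, c) ∈ N \ Y := ⟨hcovN 0 c hcI fun h => by linarith [h.1], hY 0 c hcI⟩
  have hx' : E.cov (0, c') ∈ N \ Y := ⟨hcovN 0 c' hcI' fun h => by linarith [h.2], hY 0 c' hcI'⟩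
  have : LocallyPathConnectedSpace S := ChartedSpace.locallyPathConnectedSpace ℂ S
  have hNY : IsOpen (N \ Y) := hNo.sdiff Y.finite_toSet.isClosed
  have hpc : IsPathConnected (N \ Y) := hNY.isConnected_iff_isPathConnected.1
    ⟨⟨_, hx⟩, isPreconnected_diff_finset hNo hN Y⟩
  -- The return path, away from the twisting zone and from `Y`.
  obtain ⟨p, hp⟩ := hpc.joinedIn _ hx' _ hx
  let out : Path (⟨E.cov (0, c'), hx'.2⟩ : Punctured Y) ⟨E.cov (0, c), hx.2⟩ :=
    ⟨⟨fun t => ⟨p t, (hp t).2⟩, p.continuous.subtype_mk _⟩, Subtype.ext p.source,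
      Subtype.ext p.target⟩
  have hlev : ∀ t : unitInterval, c + t * (c' - c) ∈ Set.Ioo α β := fun t =>
    ⟨by nlinarith [t.2.1], by nlinarith [t.2.2]⟩
  let arc : Path (⟨E.cov (0, c), hx.2⟩ : Punctured Y) ⟨E.cov (0, c'), hx'.2⟩ :=
    ⟨⟨fun t => ⟨E.cov (0, c + t * (c' - c)), hY _ _ (hlev t)⟩, Continuous.subtype_mk
      (E.isLocalHomeomorphOn_cov.continuousOn.comp_continuous
        (f := fun t : unitInterval => ((0 : ℝ), c + t * (c' - c))) (by fun_prop)
        fun t => ⟨trivial, hα.trans_lt (hlev t).1, (hlev t).2.trans_le hβ⟩) _⟩, by simp, by simp⟩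
  refine ⟨_, arc.trans out, fun k => ⟨E.twistPlus ha hab hb Y hYN k, fun A _ l => ?_⟩⟩
  set h := restrictPunctured Y (E.twistPlus ha hab hb Y hYN k) with hh
  have hval : ∀ x : Punctured Y, (h x : S) = E.twistFun a b k x := fun x => rfl
  obtain ⟨f, hf1, hf2, -⟩ := E.exists_strip_primitive hα hβ hcI hcE hY l
  refine ⟨l.val_congr _ _ fun t => Subtype.ext ?_, ?_⟩
  · refine (E.twistFun_cov a b k (u := t) hcE).trans ?_
    rw [ramp_of_le hab hca.le, mul_zero, add_zero]
    rfl
  · rw [Path.map_trans, l.map_trans, l.map_trans]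
    have hout : l.val (out.map h.continuous) = l.val out :=
      l.val_congr _ _ fun t => Subtype.ext (E.twistFun_eq_self hab k (hp t).1)
    have h1 := hf1 arc (fun t => (0, c + t * (c' - c))) (by fun_prop) hlev fun t => rfl
    have hramp := continuous_ramp a b
    -- The twisted arc lifts to a path ending at (k, c') instead of (0, c').
    have h2 := hf1 (arc.map h.continuous)
      (fun t => (0 + k * ramp a b (c + t * (c' - c)), c + t * (c' - c)))
      (by fun_prop) hlev fun t => (E.twistFun_cov a b k
        ⟨hα.trans_lt (hlev t).1, (hlev t).2.trans_le hβ⟩).symm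
    have h3 := hf2 0 c' hcI' k
    simp only [Set.Icc.coe_zero, Set.Icc.coe_one, zero_mul, add_zero, one_mul,
      add_sub_cancel, ramp_of_le hab hca.le, ramp_of_ge hab hbc.le, mul_zero, mul_one] at h1 h2
    rw [hout, h2, h1, h3, mul_right_comm, mul_assoc, mul_assoc, mul_assoc]
    congr 1
    exact mul_left_comm _ _ _

/-- A nonseparating annulus without points of `Y`. -/
theorem finTriv_band [T2Space S] {α β : ℝ} (hα : E.lo ≤ α) (hαβ : α < β) (hβ : β ≤ E.hi)
    (hY : ∀ u, ∀ r ∈ Set.Ioo α β, E.cov (u, r) ∉ Y)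
    (hN : ∀ a b, E.lo < a → a < b → b < E.hi →
      IsPreconnected (E.chart '' (Set.univ ×ˢ Set.Icc a b))ᶜ) :
    FinTriv Y (E.band α β) := by
  -- Five equal layers leave room for the core at α + d, the twisting zone [α + 2d, α + 3d] and the
  -- upper end α + 4d of the crossing arc.
  set d := (β - α) / 5 with hd
  have hd0 : 0 < d := by rw [hd]; linarith
  have hβd : β = α + 5 * d := by rw [hd]; ring
  have hc : α + d ∈ Set.Ioo α β := ⟨by linarith, by linarith⟩
  have hcE : α + d ∈ Set.Ioo E.lo E.hi := ⟨by linarith, by linarith⟩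
  refine ⟨{⟨_, E.core hcE fun u => hY u _ hc⟩}, Set.finite_singleton _, ?_, ?_⟩
  · rintro _ rfl
    exact E.hasTransvections_core (a := α + 2 * d) (b := α + 3 * d) (c' := α + 4 * d) hα hβ
      (by linarith) (by linarith) (by linarith) (by linarith) (by linarith) hcE hY
      (hN _ _ (by linarith) (by linarith) (by linarith))
  · intro A _ l hl
    obtain ⟨f, -, -, hf⟩ := E.exists_strip_primitive hα hβ hc hcE hY l
    exact hf (hl _ rfl)

end Annulus

variable [ChartedSpace ℂ S] [HasGroupoid S orientationGroupoid]

theorem FinTriv.mono {U V : Set S} (h : FinTriv Y V) (hUV : U ⊆ V) : FinTriv Y U := by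
  obtain ⟨F, hF, h1, h2⟩ := h
  exact ⟨F, hF, h1, fun A _ l hl => (h2 A l hl).mono (Set.preimage_mono hUV)⟩

/-- Triviality only concerns paths in the punctured surface, so points of `Y` may be added freely.
-/
theorem FinTriv.of_diff {U : Set S} (h : FinTriv Y (U \ Y)) : FinTriv Y U := by
  obtain ⟨F, hF, h1, h2⟩ := h
  exact ⟨F, hF, h1, fun A _ l hl => (h2 A l hl).mono fun x hx => ⟨hx, x.2⟩⟩

/-- Removing finitely many points from a connected open subset of a surface keeps it connected, so
primitives can be matched on the punctured intersection. -/
theorem FinTriv.union [T1Space S] {U V : Set S} (hU : IsOpen U) (hV : IsOpen V)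
    (hUV : IsPreconnected (U ∩ V)) (h1 : FinTriv Y U) (h2 : FinTriv Y V) : FinTriv Y (U ∪ V) := by
  obtain ⟨F, hF, hFt, hFA⟩ := h1
  obtain ⟨G, hG, hGt, hGA⟩ := h2
  refine ⟨F ∪ G, hF.union hG, ?_, fun A _ l hl => ?_⟩
  · rintro α (hα | hα)
    · exact hFt α hα
    · exact hGt α hα
  have : LocallyPathConnectedSpace S := ChartedSpace.locallyPathConnectedSpace ℂ S
  have : LocallyPathConnectedSpace (Punctured Y) :=
    (Y.finite_toSet.isClosed.isOpen_compl : IsOpen ((Y : Set S)ᶜ)).locallyPathConnectedSpace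
  rw [Set.preimage_union]
  refine PathCocycle.TrivialOn.union (hU.preimage continuous_subtype_val)
    (hV.preimage continuous_subtype_val) ?_ (hFA A l fun α hα => hl α (Or.inl hα))
    (hGA A l fun α hα => hl α (Or.inr hα))
  rw [← Topology.IsInducing.subtypeVal.isPreconnected_image, ← Set.preimage_inter,
    Subtype.image_preimage_coe, Set.inter_comm]
  exact isPreconnected_diff_finset (hU.inter hV) hUV Y

/-- Simply connected pieces need no loops at all. -/
theorem finTriv_range [T1Space S] {C : Type*} [TopologicalSpace C] [SimplyConnectedSpace C]
    {s : C → S} (hs : IsOpenEmbedding s) (hY : ∀ c, s c ∉ Y) : FinTriv Y (Set.range s) := by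
  refine ⟨∅, Set.finite_empty, by simp, fun A _ l _ => ?_⟩
  have h1 := (isLocalHomeomorph_punctured hs.isLocalHomeomorph hY).isOpenEmbedding_of_injective
    fun a b hab => hs.injective (congrArg Subtype.val hab)
  refine (l.trivialOn_range_of_isOpenEmbedding h1).mono ?_
  rintro ⟨x, hx⟩ ⟨c, rfl⟩
  exact ⟨c, rfl⟩

end Pieces

namespace Annulus

variable {S : Type*} [TopologicalSpace S] {Y : Finset S} (E : Annulus S)

theorem image_cov_inter_band {a b α β u v : ℝ} (ha : E.lo ≤ a) (hb : b ≤ E.hi)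
    (hα : E.lo ≤ α) (hβ : β ≤ E.hi) :
    E.cov '' (Set.Ioo u v ×ˢ Set.Ioo a b) ∩ E.band α β =
      E.cov '' (Set.Ioo u v ×ˢ (Set.Ioo a b ∩ Set.Ioo α β)) := by
  ext x
  constructor
  · rintro ⟨⟨⟨w, r⟩, ⟨hw, hr⟩, rfl⟩, hx⟩
    obtain ⟨w', r', hr', h⟩ := E.exists_cov_eq hx
    obtain ⟨-, rfl⟩ := (E.cov_eq_iff ⟨hα.trans_lt hr'.1, hr'.2.trans_le hβ⟩
      ⟨ha.trans_lt hr.1, hr.2.trans_le hb⟩).1 h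
    exact ⟨_, ⟨hw, hr, hr'⟩, rfl⟩
  · rintro ⟨⟨w, r⟩, ⟨hw, hr, hr'⟩, rfl⟩
    exact ⟨⟨_, ⟨hw, hr⟩, rfl⟩, E.cov_mem_band hr'⟩

theorem isPreconnected_image_cov {a b α β u v : ℝ} (ha : E.lo ≤ a) (hb : b ≤ E.hi) :
    IsPreconnected (E.cov '' (Set.Ioo u v ×ˢ (Set.Ioo a b ∩ Set.Ioo α β))) := by
  refine ((convex_Ioo u v).prod ((convex_Ioo a b).inter (convex_Ioo α β))).isPreconnected.image _
    (E.isLocalHomeomorphOn_cov.continuousOn.mono ?_)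
  exact fun q hq => ⟨trivial, ha.trans_lt hq.2.1.1, hq.2.1.2.trans_le hb⟩

theorem isOpenEmbedding_cov {a b u : ℝ} (ha : E.lo ≤ a) (hb : b ≤ E.hi) :
    IsOpenEmbedding fun c : (Set.Ioo u (u + 1) ×ˢ Set.Ioo a b : Set (ℝ × ℝ)) => E.cov c := by
  have hsub : (Set.Ioo u (u + 1) ×ˢ Set.Ioo a b : Set (ℝ × ℝ)) ⊆
      Set.univ ×ˢ Set.Ioo E.lo E.hi :=
    Set.prod_mono (Set.subset_univ _) (Set.Ioo_subset_Ioo ha hb)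
  refine (E.isLocalHomeomorph_cov_subtype (isOpen_Ioo.prod isOpen_Ioo)
    hsub).isOpenEmbedding_of_injective ?_
  rintro ⟨⟨w, r⟩, hw, hr⟩ ⟨⟨w', r'⟩, hw', hr'⟩ h
  obtain ⟨⟨n, hn⟩, hrr⟩ := (E.cov_eq_iff (hsub ⟨hw, hr⟩).2 (hsub ⟨hw', hr'⟩).2).1 h
  simp only [Set.mem_Ioo] at hw hw'
  have h1 : (n : ℝ) < 1 := by linarith
  have h2 : (-1 : ℝ) < n := by linarith
  have h3 : n = 0 := by
    have h1' : n < 1 := by exact_mod_cast h1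
    have h2' : -1 < n := by exact_mod_cast h2
    omega
  rw [h3, Int.cast_zero, add_zero] at hn
  exact Subtype.ext (Prod.ext hn.symm hrr)

variable [ChartedSpace ℂ S] [HasGroupoid S orientationGroupoid] [T1Space S]

/-- Two adjacent bands can be merged if there is only one point of `Y` between them. -/
theorem finTriv_merge {α b β u : ℝ} (hα : E.lo ≤ α) (hαb : α < b) (hbβ : b < β) (hβ : β ≤ E.hi)
    (hu : E.cov (u, b) ∈ Y) (hY : ∀ v, E.cov (v, b) ∈ Y → E.cov (v, b) = E.cov (u, b))
    (h1 : FinTriv Y (E.band α b)) (h2 : FinTriv Y (E.band b β)) : FinTriv Y (E.band α β) := by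
  classical
  have hbE : b ∈ Set.Ioo E.lo E.hi := ⟨by linarith, by linarith⟩
  -- Finitely many puncture levels, so near `b` only the level `b` itself carries punctures.
  obtain ⟨ε, hε, hεα, hεβ, hεY⟩ : ∃ ε > 0, α ≤ b - ε ∧ b + ε ≤ β ∧
      ∀ v, ∀ r ∈ Set.Ioo (b - ε) (b + ε), E.cov (v, r) ∈ Y → r = b := by
    let L : Set ℝ := (fun y => (E.chart.symm y).2) '' Y \ {b}
    have hL : IsClosed L := ((Y.finite_toSet.image _).subset Set.sdiff_subset).isClosed
    have hbL : b ∈ Lᶜ := fun h => h.2 rfl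
    obtain ⟨e, he, heL⟩ := Metric.isOpen_iff.1 hL.isOpen_compl b hbL
    refine ⟨min e (min (b - α) (β - b)), by
      rw [gt_iff_lt, lt_min_iff, lt_min_iff]; exact ⟨he, by linarith, by linarith⟩, ?_, ?_, ?_⟩
    · linarith [(min_le_right e _).trans (min_le_left (b - α) (β - b))]
    · linarith [(min_le_right e _).trans (min_le_right (b - α) (β - b))]
    · intro v r hr hv
      by_contra hrb
      have hm1 := min_le_left e (min (b - α) (β - b))
      have hm2 := (min_le_right e _).trans (min_le_left (b - α) (β - b))
      have hm3 := (min_le_right e _).trans (min_le_right (b - α) (β - b))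
      have hrE : r ∈ Set.Ioo E.lo E.hi := ⟨by linarith [hr.1], by linarith [hr.2]⟩
      have hball : r ∈ Metric.ball b e := by
        rw [Metric.mem_ball, Real.dist_eq, abs_lt]
        exact ⟨by linarith [hr.1], by linarith [hr.2]⟩
      refine heL hball ⟨⟨_, hv, ?_⟩, hrb⟩
      · change (E.chart.symm (E.chart _)).2 = r
        rw [E.chart.left_inv (E.mem_source hrE)]
  have ha' : E.lo ≤ b - ε := hα.trans hεα
  have hb' : b + ε ≤ E.hi := hεβ.trans hβ
  -- The rectangle of width 1 starting at `u` is the neighbourhood of level `b` slit at the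
  -- puncture: it is puncture-free, simply connected and meets both bands.
  have hemb := E.isOpenEmbedding_cov (u := u) ha' hb'
  have : ContractibleSpace (Set.Ioo u (u + 1) ×ˢ Set.Ioo (b - ε) (b + ε) : Set (ℝ × ℝ)) :=
    ((convex_Ioo _ _).prod (convex_Ioo _ _)).contractibleSpace
      ⟨(u + 1 / 2, b), ⟨by norm_num, by norm_num⟩, by linarith, by linarith⟩
  have hK := finTriv_range (Y := Y) hemb (by
    rintro ⟨⟨v, r⟩, hv, hr⟩ hvY
    obtain rfl := hεY v r hr hvY
    obtain ⟨⟨n, hn⟩, -⟩ := (E.cov_eq_iff hbE hbE).1 (hY v hvY)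
    simp only [Set.mem_Ioo] at hv
    have h1' : (-1 : ℝ) < n := by linarith
    have h2' : (n : ℝ) < 0 := by linarith
    have h1'' : -1 < n := by exact_mod_cast h1'
    have h2'' : n < 0 := by exact_mod_cast h2'
    omega)
  have hrange : Set.range (fun c : (Set.Ioo u (u + 1) ×ˢ Set.Ioo (b - ε) (b + ε) : Set (ℝ × ℝ)) =>
      E.cov c) = E.cov '' (Set.Ioo u (u + 1) ×ˢ Set.Ioo (b - ε) (b + ε)) := by
    rw [Set.image_eq_range]
  rw [hrange] at hK
  have hKo := hemb.isOpen_range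
  rw [hrange] at hKo
  have hbαo := E.isOpen_band hα hbE.2.le
  have hbβo := E.isOpen_band hbE.1.le hβ
  have h3 := hK.union hKo hbαo (by
    rw [E.image_cov_inter_band ha' hb' hα hbE.2.le]
    exact E.isPreconnected_image_cov ha' hb') h1
  -- The two bands are disjoint, so the upper one meets the union only in the rectangle.
  have h4 := h3.union (hKo.union hbαo) hbβo (by
    have hdisj : E.band α b ∩ E.band b β = ∅ := by
      ext x
      refine iff_of_false ?_ (Set.notMem_empty x)
      rintro ⟨hx1, hx2⟩
      obtain ⟨w, r, hr, rfl⟩ := E.exists_cov_eq hx1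
      obtain ⟨w', r', hr', h⟩ := E.exists_cov_eq hx2
      obtain ⟨-, rfl⟩ := (E.cov_eq_iff ⟨hbE.1.trans hr'.1, hr'.2.trans_le hβ⟩
        ⟨hα.trans_lt hr.1, hr.2.trans hbE.2⟩).1 h
      exact lt_asymm hr.2 hr'.1
    rw [Set.union_inter_distrib_right, hdisj, Set.union_empty,
      E.image_cov_inter_band ha' hb' hbE.1.le hβ]
    exact E.isPreconnected_image_cov ha' hb') h2
  refine FinTriv.of_diff (h4.mono ?_)
  rintro x ⟨hx, hxY⟩
  obtain ⟨v, r, hr, rfl⟩ := E.exists_cov_eq hx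
  rcases lt_trichotomy r b with hrb | rfl | hrb
  · exact Or.inl (Or.inr (E.cov_mem_band ⟨hr.1, hrb⟩))
  · refine Or.inl (Or.inl ?_)
    have hv : (v + (-⌊v - u⌋ : ℤ) : ℝ) = u + Int.fract (v - u) := by
      push_cast
      linarith [Int.floor_add_fract (v - u)]
    rw [← E.cov_add_int v r (-⌊v - u⌋), hv] at hxY ⊢
    refine ⟨_, ⟨⟨?_, ?_⟩, by simp [hε], by simp [hε]⟩, rfl⟩
    · have h0 : Int.fract (v - u) ≠ 0 := fun h0 => hxY (by rw [h0, add_zero]; exact hu)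
      linarith [lt_of_le_of_ne (Int.fract_nonneg (v - u)) h0.symm]
    · linarith [Int.fract_lt_one (v - u)]
  · exact Or.inr (E.cov_mem_band ⟨hrb, hr.2⟩)

/-- A nonseparating annulus in which the points of `Y` lie on distinct levels. -/
theorem finTriv_of_distinct_levels [T2Space S]
    (hN : ∀ a b, E.lo < a → a < b → b < E.hi →
      IsPreconnected (E.chart '' (Set.univ ×ˢ Set.Icc a b))ᶜ)
    (hY : ∀ r ∈ Set.Ioo E.lo E.hi, ∀ u v, E.cov (u, r) ∈ Y → E.cov (v, r) ∈ Y →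
      E.cov (u, r) = E.cov (v, r)) : FinTriv Y (E.band E.lo E.hi) := by
  classical
  let L : Finset ℝ := Y.image fun y => (E.chart.symm y).2
  have hL : ∀ u, ∀ r ∈ Set.Ioo E.lo E.hi, E.cov (u, r) ∈ Y → r ∈ L := fun u r hr hu =>
    Finset.mem_image.2 ⟨_, hu, by
      change (E.chart.symm (E.chart _)).2 = r
      rw [E.chart.left_inv (E.mem_source hr)]⟩
  -- Induction on the number of puncture levels in the interval, which is split at one of them.
  have key : ∀ (n : ℕ) (α β : ℝ), E.lo ≤ α → α < β → β ≤ E.hi →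
      (L.filter fun r => r ∈ Set.Ioo α β).card ≤ n → FinTriv Y (E.band α β) := by
    intro n
    induction n with
    | zero =>
      intro α β hα hαβ hβ hn
      refine E.finTriv_band hα hαβ hβ (fun u r hr hu => ?_) hN
      have h1 := hL u r ⟨hα.trans_lt hr.1, hr.2.trans_le hβ⟩ hu
      rw [Nat.le_zero, Finset.card_eq_zero] at hn
      have h2 : r ∈ L.filter fun r => r ∈ Set.Ioo α β := Finset.mem_filter.2 ⟨h1, hr⟩
      rw [hn] at h2
      exact Finset.notMem_empty r h2
    | succ n ih =>
      intro α β hα hαβ hβ hn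
      by_cases h : ∃ u, ∃ r ∈ Set.Ioo α β, E.cov (u, r) ∈ Y
      · obtain ⟨u, b, hb, hu⟩ := h
        have hbE : b ∈ Set.Ioo E.lo E.hi := ⟨hα.trans_lt hb.1, hb.2.trans_le hβ⟩
        have hbL : b ∈ L.filter fun r => r ∈ Set.Ioo α β := Finset.mem_filter.2 ⟨hL u b hbE hu, hb⟩
        have hcard : ∀ a c, Set.Ioo a c ⊆ Set.Ioo α β → b ∉ Set.Ioo a c →
            (L.filter fun r => r ∈ Set.Ioo a c).card ≤ n := by
          intro a c hac hbac
          refine Nat.lt_succ_iff.1 (lt_of_lt_of_le (Finset.card_lt_card ?_) hn)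
          refine (Finset.ssubset_iff_of_subset fun r hr => ?_).2 ⟨b, hbL, fun h => ?_⟩
          · rw [Finset.mem_filter] at hr ⊢
            exact ⟨hr.1, hac hr.2⟩
          · exact hbac (Finset.mem_filter.1 h).2
        exact E.finTriv_merge hα hb.1 hb.2 hβ hu (fun v hv => hY b hbE v u hv hu)
          (ih α b hα hb.1 hbE.2.le (hcard _ _ (Set.Ioo_subset_Ioo le_rfl hb.2.le) (by simp)))
          (ih b β hbE.1.le hb.2 hβ (hcard _ _ (Set.Ioo_subset_Ioo hb.1.le le_rfl) (by simp)))
      · push Not at h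
        exact E.finTriv_band hα hαβ hβ h hN
  rcases lt_or_ge E.lo E.hi with h | h
  · exact key _ _ _ le_rfl h le_rfl le_rfl
  · refine ⟨∅, Set.finite_empty, by simp, fun A _ l _ => ⟨1, fun x y p hp => ?_⟩⟩
    obtain ⟨u, r, hr, -⟩ := E.exists_cov_eq (hp 0)
    exact absurd (hr.1.trans hr.2) (not_lt.2 h)

end Annulus

/-! ### The polygon -/

/-- The point `exp (2πi x / (4g))` of the unit circle. -/
def circlePoint (g : ℕ) (x : ℝ) : ℂ := Complex.exp ((2 * Real.pi * x / (4 * g) : ℝ) * Complex.I)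

theorem coe_boundaryPoint (g : ℕ) (x : ℝ) : (boundaryPoint g x : ℂ) = circlePoint g x := rfl

theorem norm_circlePoint (g : ℕ) (x : ℝ) : ‖circlePoint g x‖ = 1 :=
  Complex.norm_exp_ofReal_mul_I _

theorem circlePoint_add (g : ℕ) (x y : ℝ) :
    circlePoint g (x + y) = circlePoint g x * circlePoint g y := by
  rw [circlePoint, circlePoint, circlePoint, ← Complex.exp_add]
  congr 1
  push_cast
  ring

theorem circlePoint_zero (g : ℕ) : circlePoint g 0 = 1 := by simp [circlePoint]

theorem circlePoint_re (g : ℕ) (x : ℝ) :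
    (circlePoint g x).re = Real.cos (x * (Real.pi / (2 * g))) := by
  rw [circlePoint, Complex.exp_ofReal_mul_I_re]
  congr 1
  ring

theorem circlePoint_im (g : ℕ) (x : ℝ) :
    (circlePoint g x).im = Real.sin (x * (Real.pi / (2 * g))) := by
  rw [circlePoint, Complex.exp_ofReal_mul_I_im]
  congr 1
  ring

/-- `s` is the number of a side of type `a` or `b` of the `4g`-gon. -/
def IsSide (g s : ℕ) : Prop := s < 4 * g ∧ s % 4 < 2

/-- The lower end of the levels of chords between the sides `s` and `s + 2`. -/
def loLevel (g : ℕ) : ℝ := Real.cos (3 / 2 * (Real.pi / (2 * g)))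

/-- The upper end of the levels of chords between the sides `s` and `s + 2`. -/
def hiLevel (g : ℕ) : ℝ := Real.cos (1 / 2 * (Real.pi / (2 * g)))

/-! ### Trigonometry of the levels of chords -/

section Trig

variable {g : ℕ} (hg : 0 < g)

include hg

theorem unitAngle_pos : 0 < Real.pi / (2 * g) := by
  have : (0 : ℝ) < g := by exact_mod_cast hg
  have := Real.pi_pos
  positivity

theorem unitAngle_mul : 2 * (g : ℝ) * (Real.pi / (2 * g)) = Real.pi := by
  have : (0 : ℝ) < g := by exact_mod_cast hg
  field_simp

theorem one_le_cast : (1 : ℝ) ≤ g := by exact_mod_cast hg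

/-- Angles are measured in sides of the polygon: one side is π/(2g), and [0, 2g] corresponds to [0,
π], where the cosine decreases. -/
theorem cos_unit_lt_iff {x y : ℝ} (hx : 0 ≤ x) (hx' : x ≤ 2 * g) (hy : 0 ≤ y) (hy' : y ≤ 2 * g) :
    Real.cos (x * (Real.pi / (2 * g))) < Real.cos (y * (Real.pi / (2 * g))) ↔ y < x := by
  have h0 := unitAngle_pos hg
  have h1 := unitAngle_mul hg
  rw [Real.strictAntiOn_cos.lt_iff_gt ⟨by positivity, by nlinarith⟩ ⟨by positivity, by nlinarith⟩]
  exact mul_lt_mul_iff_left₀ h0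

theorem cos_unit_le_iff {x y : ℝ} (hx : 0 ≤ x) (hx' : x ≤ 2 * g) (hy : 0 ≤ y) (hy' : y ≤ 2 * g) :
    Real.cos (x * (Real.pi / (2 * g))) ≤ Real.cos (y * (Real.pi / (2 * g))) ↔ y ≤ x := by
  rw [← not_lt, cos_unit_lt_iff hg hy hy' hx hx', not_lt]

theorem loLevel_lt_hiLevel : loLevel g < hiLevel g := by
  have := one_le_cast hg
  exact (cos_unit_lt_iff hg (by norm_num) (by linarith) (by norm_num) (by linarith)).2 (by norm_num)

theorem hiLevel_lt_one : hiLevel g < 1 := by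
  have := one_le_cast hg
  have h := (cos_unit_lt_iff hg (x := 1 / 2) (y := 0) (by norm_num) (by linarith) (by norm_num)
    (by linarith)).2 (by norm_num)
  simpa [hiLevel] using h

theorem neg_one_lt_loLevel : -1 < loLevel g := by
  have := one_le_cast hg
  have h := (cos_unit_lt_iff hg (x := 2 * g) (y := 3 / 2) (by linarith) le_rfl (by norm_num)
    (by linarith)).2 (by linarith)
  rwa [unitAngle_mul hg, Real.cos_pi] at h

theorem sq_lt_one_of_level {r : ℝ} (h1 : loLevel g ≤ r) (h2 : r ≤ hiLevel g) : r ^ 2 < 1 := by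
  have h3 := neg_one_lt_loLevel hg
  have h4 := hiLevel_lt_one hg
  nlinarith

/-- A full turn is 4g sides; subtracting the nearest multiple brings `x` into the range where the
cosine is monotone in |x|. -/
theorem exists_int_cos (x : ℝ) : ∃ n : ℤ, |x - 4 * g * n| ≤ 2 * g ∧
    Real.cos (x * (Real.pi / (2 * g))) = Real.cos (|x - 4 * g * n| * (Real.pi / (2 * g))) := by
  have hg0 : (0 : ℝ) < g := by exact_mod_cast hg
  refine ⟨round (x / (4 * g)), ?_, ?_⟩
  · have h := abs_sub_round (x / (4 * g))
    have h2 : x - 4 * g * round (x / (4 * g)) = (4 * g) * (x / (4 * g) - round (x / (4 * g))) := by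
      field_simp
    rw [h2, abs_mul, abs_of_pos (by positivity : (0 : ℝ) < 4 * g)]
    nlinarith
  · have h0 := unitAngle_pos hg
    rw [← abs_of_pos h0, ← abs_mul, Real.cos_abs, abs_of_pos h0, sub_mul]
    rw [show 4 * (g : ℝ) * round (x / (4 * g)) * (Real.pi / (2 * g)) =
      round (x / (4 * g)) * (2 * Real.pi) by
        field_simp
        ring]
    rw [Real.cos_sub_int_mul_two_pi]

theorem abs_of_level {x : ℝ} (hx : |x| ≤ 2 * g)
    (h1 : loLevel g ≤ Real.cos (x * (Real.pi / (2 * g))))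
    (h2 : Real.cos (x * (Real.pi / (2 * g))) ≤ hiLevel g) : 1 / 2 ≤ |x| ∧ |x| ≤ 3 / 2 := by
  have := one_le_cast hg
  have h0 := unitAngle_pos hg
  rw [← Real.cos_abs, abs_mul, abs_of_pos h0] at h1 h2
  exact ⟨(cos_unit_le_iff hg (abs_nonneg x) hx (by norm_num) (by linarith)).1 h2,
    (cos_unit_le_iff hg (by norm_num) (by linarith) (abs_nonneg x) hx).1 h1⟩

theorem abs_of_level' {x : ℝ} (hx : |x| ≤ 2 * g)
    (h1 : loLevel g < Real.cos (x * (Real.pi / (2 * g))))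
    (h2 : Real.cos (x * (Real.pi / (2 * g))) < hiLevel g) : 1 / 2 < |x| ∧ |x| < 3 / 2 := by
  have := one_le_cast hg
  have h0 := unitAngle_pos hg
  rw [← Real.cos_abs, abs_mul, abs_of_pos h0] at h1 h2
  exact ⟨(cos_unit_lt_iff hg (abs_nonneg x) hx (by norm_num) (by linarith)).1 h2,
    (cos_unit_lt_iff hg (by norm_num) (by linarith) (abs_nonneg x) hx).1 h1⟩

theorem level_mem {x : ℝ} (h1 : 1 / 2 < |x|) (h2 : |x| < 3 / 2) :
    Real.cos (x * (Real.pi / (2 * g))) ∈ Set.Ioo (loLevel g) (hiLevel g) := by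
  have := one_le_cast hg
  have h0 := unitAngle_pos hg
  rw [← Real.cos_abs, abs_mul, abs_of_pos h0]
  exact ⟨(cos_unit_lt_iff hg (by norm_num) (by linarith) (abs_nonneg x) (by linarith)).2 h2,
    (cos_unit_lt_iff hg (abs_nonneg x) (by linarith) (by norm_num) (by linarith)).2 h1⟩

-- Admissible side numbers are 0 or 1 modulo 4, so they never differ by 2 modulo 4g; and both are
-- less than 4g.
omit hg in
theorem side_eq_of_int {s s' : ℕ} (hs : IsSide g s) (hs' : IsSide g s') {n : ℤ}
    (h : (s' : ℤ) - s - 4 * (g * n) = 0 ∨ (s' : ℤ) - s - 4 * (g * n) = 2) : s' = s := by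
  obtain ⟨h1, h2⟩ := hs
  obtain ⟨h3, h4⟩ := hs'
  rcases h with h | h
  · have hn : n = 0 := by
      by_contra hn
      rcases lt_or_gt_of_ne hn with hn | hn
      · have : (g : ℤ) * n ≤ g * (-1) := by
          apply mul_le_mul_of_nonneg_left <;> omega
        omega
      · have : (g : ℤ) * 1 ≤ g * n := by
          apply mul_le_mul_of_nonneg_left <;> omega
        omega
    subst hn
    simp at h
    omega
  · exfalso
    omega

/-- Modulo 4g the argument is D + t − 3/2 with D an integer, and its absolute value lies strictly
between 1/2 and 3/2. This forces D = 0 or D = 2, that is, side `s` or `s + 2`. -/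
theorem side_eq_of_level {s s' : ℕ} (hs : IsSide g s) (hs' : IsSide g s') {t : ℝ}
    (ht : t ∈ Set.Icc (0 : ℝ) 1)
    (h : Real.cos (((s' : ℝ) - s + t - 3 / 2) * (Real.pi / (2 * g))) ∈
      Set.Ioo (loLevel g) (hiLevel g)) : s' = s := by
  obtain ⟨n, hn, hc⟩ := exists_int_cos hg ((s' : ℝ) - s + t - 3 / 2)
  rw [hc] at h
  obtain ⟨h1, h2⟩ := abs_of_level' hg (by rwa [abs_abs]) h.1 h.2
  rw [abs_abs] at h1 h2
  set D : ℤ := (s' : ℤ) - s - 4 * (g * n) with hD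
  have hDr : (D : ℝ) = s' - s - 4 * (g * n) := by rw [hD]; push_cast; ring
  have hx : (s' : ℝ) - s + t - 3 / 2 - 4 * g * n = D + t - 3 / 2 := by rw [hDr]; ring
  rw [hx] at h1 h2
  apply side_eq_of_int hs hs' (n := n)
  obtain ⟨ht0, ht1⟩ := ht
  obtain ⟨h3, h4⟩ := abs_lt.1 h2
  rcases lt_abs.1 h1 with h5 | h5
  · right
    have h6 : (1 : ℝ) < D := by linarith
    have h7 : (D : ℝ) < 3 := by linarith
    have h6' : 1 < D := by exact_mod_cast h6
    have h7' : D < 3 := by exact_mod_cast h7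
    omega
  · left
    have h6 : (-1 : ℝ) < D := by linarith
    have h7 : (D : ℝ) < 1 := by linarith
    have h6' : -1 < D := by exact_mod_cast h6
    have h7' : D < 1 := by exact_mod_cast h7
    omega

/-- Here closed levels are allowed because `t` avoids 0 and 1: an open side stays away even from the
closures of the other bands. -/
theorem side_eq_of_level' {s s' : ℕ} (hs : IsSide g s) (hs' : IsSide g s') {t : ℝ}
    (ht : t ∈ Set.Ioo (0 : ℝ) 1)
    (h : Real.cos (((s' : ℝ) - s + t - 3 / 2) * (Real.pi / (2 * g))) ∈
      Set.Icc (loLevel g) (hiLevel g)) : s' = s := by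
  obtain ⟨n, hn, hc⟩ := exists_int_cos hg ((s' : ℝ) - s + t - 3 / 2)
  rw [hc] at h
  obtain ⟨h1, h2⟩ := abs_of_level hg (by rwa [abs_abs]) h.1 h.2
  rw [abs_abs] at h1 h2
  set D : ℤ := (s' : ℤ) - s - 4 * (g * n) with hD
  have hDr : (D : ℝ) = s' - s - 4 * (g * n) := by rw [hD]; push_cast; ring
  have hx : (s' : ℝ) - s + t - 3 / 2 - 4 * g * n = D + t - 3 / 2 := by rw [hDr]; ring
  rw [hx] at h1 h2
  apply side_eq_of_int hs hs' (n := n)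
  obtain ⟨ht0, ht1⟩ := ht
  obtain ⟨h3, h4⟩ := abs_le.1 h2
  rcases le_abs.1 h1 with h5 | h5
  · right
    have h6 : (1 : ℝ) < D := by linarith
    have h7 : (D : ℝ) < 3 := by linarith
    have h6' : 1 < D := by exact_mod_cast h6
    have h7' : D < 3 := by exact_mod_cast h7
    omega
  · left
    have h6 : (-1 : ℝ) < D := by linarith
    have h7 : (D : ℝ) < 1 := by linarith
    have h6' : -1 < D := by exact_mod_cast h6
    have h7' : D < 1 := by exact_mod_cast h7
    omega

end Trig

/-- The coordinate in which the chords between the sides `s` and `s + 2` are vertical. -/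
def sideCoord (g s : ℕ) (z : ℂ) : ℂ := z * circlePoint g (-(s + 3 / 2))

/-- The point with given `sideCoord`. -/
def sideInv (g s : ℕ) (w : ℂ) : ℂ := w * circlePoint g (s + 3 / 2)

/-! ### Coordinates adapted to a pair of glued sides, with the midpoint of side s + 1 rotated to 1
-/

section SideCoord

variable (g s : ℕ)

theorem sideInv_sideCoord (z : ℂ) : sideInv g s (sideCoord g s z) = z := by
  rw [sideInv, sideCoord, mul_assoc, ← circlePoint_add, neg_add_cancel, circlePoint_zero, mul_one]

theorem sideCoord_sideInv (w : ℂ) : sideCoord g s (sideInv g s w) = w := by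
  rw [sideInv, sideCoord, mul_assoc, ← circlePoint_add, add_neg_cancel, circlePoint_zero, mul_one]

theorem norm_sideCoord (z : ℂ) : ‖sideCoord g s z‖ = ‖z‖ := by
  rw [sideCoord, norm_mul, norm_circlePoint, mul_one]

theorem norm_sideInv (w : ℂ) : ‖sideInv g s w‖ = ‖w‖ := by
  rw [sideInv, norm_mul, norm_circlePoint, mul_one]

theorem continuous_sideCoord : Continuous (sideCoord g s) := by
  unfold sideCoord; fun_prop

theorem continuous_sideInv : Continuous (sideInv g s) := by
  unfold sideInv; fun_prop

theorem sideCoord_circlePoint (x : ℝ) :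
    sideCoord g s (circlePoint g x) = circlePoint g (x - s - 3 / 2) := by
  rw [sideCoord, ← circlePoint_add]
  congr 1
  ring

/-- The level of a point with respect to the side `s`. -/
def level (z : ℂ) : ℝ := (sideCoord g s z).re

theorem continuous_level : Continuous (level g s) :=
  Complex.continuous_re.comp (continuous_sideCoord g s)

theorem level_circlePoint (x : ℝ) :
    level g s (circlePoint g x) = Real.cos ((x - s - 3 / 2) * (Real.pi / (2 * g))) := by
  rw [level, sideCoord_circlePoint, circlePoint_re]

theorem level_add_smul (a b : ℝ) (z w : ℂ) :
    level g s (a • z + b • w) = a * level g s z + b * level g s w := by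
  simp only [level, sideCoord, add_mul, smul_mul_assoc, Complex.add_re, Complex.smul_re,
    smul_eq_mul]

theorem convex_level {I : Set ℝ} (hI : Convex ℝ I) : Convex ℝ {z | level g s z ∈ I} := by
  intro z hz w hw a b ha hb hab
  rw [Set.mem_ofPred_eq, level_add_smul]
  exact hI hz hw ha hb hab

/-- A boundary point on the level of a chord is an end point of this chord. -/
theorem exists_eq_circlePoint {g : ℕ} (hg : 0 < g) {z : ℂ} (hz : ‖z‖ = 1)
    (h : level g s z ∈ Set.Icc (loLevel g) (hiLevel g)) :
    ∃ t ∈ Set.Icc (0 : ℝ) 1, (level g s z ∈ Set.Ioo (loLevel g) (hiLevel g) → t ∈ Set.Ioo 0 1) ∧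
      ((sideCoord g s z).im ≤ 0 ∧ z = circlePoint g (s + t) ∨
        0 ≤ (sideCoord g s z).im ∧ z = circlePoint g (s + 3 - t)) := by
  have h0 := unitAngle_pos hg
  have h1 := unitAngle_mul hg
  set c := Real.pi / (2 * g) with hc
  set φ := Complex.arg (sideCoord g s z) with hφ
  have hw : sideCoord g s z = circlePoint g (φ / c) := by
    have h2 := Complex.norm_mul_exp_arg_mul_I (sideCoord g s z)
    rw [norm_sideCoord, hz, Complex.ofReal_one, one_mul] at h2
    rw [← h2, circlePoint]
    congr 2
    rw [← hφ, hc]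
    norm_cast
    push_cast
    have : (0 : ℝ) < g := by exact_mod_cast hg
    have := Real.pi_pos
    field_simp
    ring
  set x := φ / c with hx
  have hxb : |x| ≤ 2 * g := by
    rw [hx, abs_div, abs_of_pos h0, div_le_iff₀ h0, h1]
    exact Complex.abs_arg_le_pi _
  have hlev : level g s z = Real.cos (x * c) := by rw [level, hw, circlePoint_re]
  have hz' : z = circlePoint g (x + (s + 3 / 2)) := by
    rw [← sideInv_sideCoord g s z, hw, sideInv, ← circlePoint_add]
  have him : (sideCoord g s z).im = Real.sin (x * c) := by rw [hw, circlePoint_im]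
  have hxc : x * c = φ := by rw [hx, div_mul_cancel₀ _ h0.ne']
  rw [hlev] at h
  obtain ⟨h3, h4⟩ := abs_of_level hg hxb h.1 h.2
  -- `x` is the signed distance, in sides, from the midpoint of side s + 1; the two signs give the
  -- sides `s` and `s + 2`.
  refine ⟨3 / 2 - |x|, ⟨by linarith, by linarith⟩, fun h' => ?_, ?_⟩
  · rw [hlev] at h'
    obtain ⟨h3, h4⟩ := abs_of_level' hg hxb h'.1 h'.2
    exact ⟨by linarith, by linarith⟩
  · rcases le_total x 0 with h5 | h5
    · left
      refine ⟨?_, ?_⟩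
      · rw [him]
        apply Real.sin_nonpos_of_nonpos_of_neg_pi_le
        · exact mul_nonpos_of_nonpos_of_nonneg h5 h0.le
        · rw [hxc]; exact (Complex.neg_pi_lt_arg _).le
      · rw [abs_of_nonpos h5, hz']
        congr 1
        ring
    · right
      refine ⟨?_, ?_⟩
      · rw [him]
        apply Real.sin_nonneg_of_nonneg_of_le_pi
        · exact mul_nonneg h5 h0.le
        · rw [hxc]; exact Complex.arg_le_pi _
      · rw [abs_of_nonneg h5, hz']
        congr 1
        ring

end SideCoord

theorem conj_circlePoint (g : ℕ) (x : ℝ) :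
    (starRingEnd ℂ) (circlePoint g x) = circlePoint g (-x) := by
  apply Complex.ext
  · rw [Complex.conj_re, circlePoint_re, circlePoint_re, neg_mul, Real.cos_neg]
  · rw [Complex.conj_im, circlePoint_im, circlePoint_im, neg_mul, Real.sin_neg]

/-- A presentation of `S` as a quotient of the closed unit disc by the side identifications of the
`4g`-gon. -/
structure PolygonMap (g : ℕ) (S : Type*) [TopologicalSpace S] where
  /-- The quotient map, extended to the plane. -/
  toFun : ℂ → S
  continuousOn : ContinuousOn toFun (Metric.closedBall 0 1)
  exists_eq : ∀ x, ∃ z ∈ Metric.closedBall (0 : ℂ) 1, toFun z = x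
  isOpen_of : ∀ V : Set S, (∃ O, IsOpen O ∧
    toFun ⁻¹' V ∩ Metric.closedBall 0 1 = O ∩ Metric.closedBall 0 1) → IsOpen V
  glue : ∀ s, IsSide g s → ∀ t ∈ Set.Icc (0 : ℝ) 1,
    toFun (circlePoint g (s + t)) = toFun (circlePoint g (s + 3 - t))
  -- Universal property instead of a description of the equivalence relation: points are separated
  -- by test functions compatible with the gluing.
  eq_of : ∀ {T : Type} (F : ℂ → T), (∀ s, IsSide g s → ∀ t ∈ Set.Icc (0 : ℝ) 1,
    F (circlePoint g (s + t)) = F (circlePoint g (s + 3 - t))) →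
    ∀ z ∈ Metric.closedBall (0 : ℂ) 1, ∀ w ∈ Metric.closedBall (0 : ℂ) 1,
      toFun z = toFun w → F z = F w

/-- The point at height `(2u - 1)√(1 - r²)` of the chord at level `r`. -/
def chordPoint (g s : ℕ) (u r : ℝ) : ℂ := sideInv g s ⟨r, (2 * u - 1) * √(1 - r ^ 2)⟩

theorem level_chordPoint (g s : ℕ) (u r : ℝ) : level g s (chordPoint g s u r) = r := by
  rw [level, chordPoint, sideCoord_sideInv]

theorem continuous_chordPoint (g s : ℕ) :
    Continuous fun q : ℝ × ℝ => chordPoint g s q.1 q.2 := by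
  unfold chordPoint
  refine (continuous_sideInv g s).comp ?_
  refine (Complex.equivRealProdCLM.symm.continuous).comp
    (f := fun q : ℝ × ℝ => (q.2, (2 * q.1 - 1) * √(1 - q.2 ^ 2))) ?_
  fun_prop

theorem norm_sq_chordPoint {g : ℕ} (s : ℕ) (u : ℝ) {r : ℝ} (hr : r ^ 2 < 1) :
    ‖chordPoint g s u r‖ ^ 2 = r ^ 2 + (2 * u - 1) ^ 2 * (1 - r ^ 2) := by
  rw [chordPoint, norm_sideInv, Complex.sq_norm, Complex.normSq_mk, ← sq, ← sq, mul_pow,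
    Real.sq_sqrt (by linarith)]

theorem chordPoint_mem {g : ℕ} (s : ℕ) {u r : ℝ} (hr : r ^ 2 < 1) (hu : u ∈ Set.Icc (0 : ℝ) 1) :
    chordPoint g s u r ∈ Metric.closedBall (0 : ℂ) 1 := by
  rw [mem_closedBall_zero_iff, ← abs_of_nonneg (norm_nonneg _), ← sq_le_one_iff_abs_le_one,
    norm_sq_chordPoint s u hr]
  obtain ⟨h0, h1⟩ := hu
  have h2 : (2 * u - 1) ^ 2 ≤ 1 := by nlinarith
  nlinarith

/-- The first annulus coordinate of a point of the polygon. -/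
def chordCoord (g s : ℕ) (z : ℂ) : ℝ := (1 + (sideCoord g s z).im / √(1 - level g s z ^ 2)) / 2

theorem chordCoord_chordPoint {g : ℕ} (s : ℕ) (u : ℝ) {r : ℝ} (hr : r ^ 2 < 1) :
    chordCoord g s (chordPoint g s u r) = u := by
  have h : √(1 - r ^ 2) ≠ 0 := (Real.sqrt_pos.2 (by linarith)).ne'
  rw [chordCoord, level_chordPoint, chordPoint, sideCoord_sideInv, mul_div_cancel_right₀ _ h]
  ring

theorem chordPoint_chordCoord {g : ℕ} (s : ℕ) {z : ℂ} (hr : level g s z ^ 2 < 1) :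
    chordPoint g s (chordCoord g s z) (level g s z) = z := by
  have h : √(1 - level g s z ^ 2) ≠ 0 := (Real.sqrt_pos.2 (by linarith)).ne'
  conv_rhs => rw [← sideInv_sideCoord g s z]
  rw [chordPoint]
  congr 1
  apply Complex.ext
  · rfl
  · change (2 * chordCoord g s z - 1) * _ = _
    rw [chordCoord]
    field_simp
    ring

theorem chordCoord_mem {g : ℕ} (s : ℕ) {z : ℂ} (hz : z ∈ Metric.closedBall (0 : ℂ) 1)
    (hr : level g s z ^ 2 < 1) : chordCoord g s z ∈ Set.Icc (0 : ℝ) 1 := by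
  have h : 0 < √(1 - level g s z ^ 2) := Real.sqrt_pos.2 (by linarith)
  have h1 : |(sideCoord g s z).im| ≤ √(1 - level g s z ^ 2) := by
    apply Real.abs_le_sqrt
    rw [mem_closedBall_zero_iff, ← norm_sideCoord g s] at hz
    have h2 : ‖sideCoord g s z‖ ^ 2 ≤ 1 := by nlinarith [norm_nonneg (sideCoord g s z)]
    rw [Complex.sq_norm, Complex.normSq_apply] at h2
    unfold level
    nlinarith
  have h2 : |(sideCoord g s z).im / √(1 - level g s z ^ 2)| ≤ 1 := by
    rw [abs_div, abs_of_pos h]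
    exact (div_le_one h).2 h1
  obtain ⟨h3, h4⟩ := abs_le.1 h2
  unfold chordCoord
  exact ⟨by linarith, by linarith⟩

/-- The annulus coordinates of a point of the polygon. -/
def bandCoord (g s : ℕ) (z : ℂ) : AddCircle (1 : ℝ) × ℝ :=
  ((chordCoord g s z : ℝ), level g s z)

theorem continuousOn_bandCoord (g s : ℕ) :
    ContinuousOn (bandCoord g s) {z | level g s z ^ 2 < 1} := by
  have h1 := continuous_level g s
  have h2 : Continuous fun z => (sideCoord g s z).im :=
    Complex.continuous_im.comp (continuous_sideCoord g s)
  refine ContinuousOn.prodMk ((AddCircle.continuous_mk' (1 : ℝ)).comp_continuousOn ?_)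
    h1.continuousOn
  refine ContinuousOn.div_const (continuousOn_const.add (h2.continuousOn.div ?_ ?_)) _
  · fun_prop
  · intro z hz
    exact (Real.sqrt_pos.2 (by simpa using hz)).ne'

/-- In these coordinates the gluing of `s` with `s + 2` is complex conjugation. It preserves levels,
which is why each vertical chord closes up to a circle. -/
theorem sideCoord_other (g s : ℕ) (t : ℝ) : sideCoord g s (circlePoint g (s + 3 - t)) =
    (starRingEnd ℂ) (sideCoord g s (circlePoint g (s + t))) := by
  rw [sideCoord_circlePoint, sideCoord_circlePoint, conj_circlePoint]
  congr 1
  ring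

/-- The annulus coordinates are compatible with the gluing. -/
theorem bandCoord_glue {g : ℕ} (hg : 0 < g) {s s' : ℕ} (hs : IsSide g s) (hs' : IsSide g s') {t : ℝ}
    (ht : t ∈ Set.Icc (0 : ℝ) 1) :
    (level g s (circlePoint g (s' + t)) ∈ Set.Ioo (loLevel g) (hiLevel g) ↔
      level g s (circlePoint g (s' + 3 - t)) ∈ Set.Ioo (loLevel g) (hiLevel g)) ∧
    (level g s (circlePoint g (s' + t)) ∈ Set.Ioo (loLevel g) (hiLevel g) →
      bandCoord g s (circlePoint g (s' + t)) = bandCoord g s (circlePoint g (s' + 3 - t))) := by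
  by_cases h : s' = s
  · subst h
    have hl : level g s' (circlePoint g (s' + 3 - t)) = level g s' (circlePoint g (s' + t)) := by
      rw [level, sideCoord_other, Complex.conj_re, level]
    rw [hl]
    refine ⟨Iff.rfl, fun hr => Prod.ext ?_ hl.symm⟩
    have hsq := sq_lt_one_of_level hg hr.1.le hr.2.le
    set w := sideCoord g s' (circlePoint g (s' + t)) with hw
    change ((chordCoord g s' _ : ℝ) : AddCircle (1 : ℝ)) = (chordCoord g s' _ : ℝ)
    have hn : ‖w‖ ^ 2 = 1 := by rw [hw, norm_sideCoord, norm_circlePoint, one_pow]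
    rw [Complex.sq_norm, Complex.normSq_apply] at hn
    have hlw : level g s' (circlePoint g (s' + t)) = w.re := rfl
    rw [hlw] at hsq
    have hsqrt : √(1 - w.re ^ 2) = |w.im| := by
      rw [← Real.sqrt_sq_eq_abs]
      congr 1
      linarith
    have him : w.im ≠ 0 := fun h0 => by rw [h0] at hn; nlinarith
    rw [← sub_eq_zero, ← AddCircle.coe_sub, AddCircle.coe_eq_zero_iff]
    unfold chordCoord
    rw [hl, sideCoord_other, ← hw, hlw, hsqrt, Complex.conj_im]
    -- On the unit circle √(1 − re²) = |im|, so the ends of the chord have coordinates 0 and 1,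
    -- which agree in ℝ/ℤ.
    rcases lt_or_gt_of_ne him with h1 | h1
    · refine ⟨-1, ?_⟩
      rw [abs_of_neg h1]
      field_simp
      norm_num
    · refine ⟨1, ?_⟩
      rw [abs_of_pos h1]
      field_simp
      norm_num
  -- Neither side of another glued pair meets the open band.
  · have h1 : level g s (circlePoint g (s' + t)) ∉ Set.Ioo (loLevel g) (hiLevel g) := by
      rw [level_circlePoint]
      intro h1
      refine h (side_eq_of_level hg hs hs' ht ?_)
      convert h1 using 3
      ring
    have h2 : level g s (circlePoint g (s' + 3 - t)) ∉ Set.Ioo (loLevel g) (hiLevel g) := by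
      rw [level_circlePoint]
      intro h2
      refine h (side_eq_of_level hg hs' hs ht ?_).symm
      rw [← Real.cos_neg]
      convert h2 using 3
      ring
    exact ⟨iff_of_false h1 h2, fun h3 => absurd h3 h1⟩

/-! ### The annulus of chords between two glued sides -/

namespace PolygonMap

variable {g : ℕ} {S : Type*} [TopologicalSpace S] (P : PolygonMap g S)

theorem circlePoint_mem (x : ℝ) : circlePoint g x ∈ Metric.closedBall (0 : ℂ) 1 := by
  rw [mem_closedBall_zero_iff, norm_circlePoint]

/-- Images of open saturated sets are open. -/
theorem isOpen_image {O : Set ℂ} (hO : IsOpen O)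
    (hsat : ∀ z ∈ Metric.closedBall (0 : ℂ) 1, ∀ w ∈ Metric.closedBall (0 : ℂ) 1,
      P.toFun z = P.toFun w → z ∈ O → w ∈ O) :
    IsOpen (P.toFun '' (O ∩ Metric.closedBall 0 1)) := by
  refine P.isOpen_of _ ⟨O, hO, ?_⟩
  ext w
  constructor
  · rintro ⟨⟨z, hz, hzw⟩, hw⟩
    exact ⟨hsat z hz.2 w hw hzw hz.1, hw⟩
  · rintro ⟨hwO, hw⟩
    exact ⟨⟨w, ⟨hwO, hw⟩, rfl⟩, hw⟩

/-- Test function: interior points go to themselves, all other points to `none`. It respects the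
gluing because only boundary points are glued. -/
theorem norm_lt_one_of_eq {z w : ℂ} (hz : ‖z‖ < 1) (hw : w ∈ Metric.closedBall (0 : ℂ) 1)
    (h : P.toFun z = P.toFun w) : z = w := by
  classical
  have h1 := P.eq_of (fun z : ℂ => if ‖z‖ < 1 then some z else none)
    (fun s _ t _ => by simp [norm_circlePoint]) z (by simpa using hz.le) w hw h
  simp only [if_pos hz] at h1
  split_ifs at h1 with h2
  exact Option.some_injective _ h1

section Band

variable (hg : 0 < g) {s : ℕ} (hs : IsSide g s)

include hg hs

/-- The same device, with the annulus coordinates on the band and `none` outside as test function.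
-/
theorem bandCoord_eq {z w : ℂ} (hz : z ∈ Metric.closedBall (0 : ℂ) 1)
    (hw : w ∈ Metric.closedBall (0 : ℂ) 1) (h : P.toFun z = P.toFun w)
    (hl : level g s z ∈ Set.Ioo (loLevel g) (hiLevel g)) :
    level g s w ∈ Set.Ioo (loLevel g) (hiLevel g) ∧ bandCoord g s z = bandCoord g s w := by
  classical
  have h1 := P.eq_of (fun z : ℂ => if level g s z ∈ Set.Ioo (loLevel g) (hiLevel g) then
    some (bandCoord g s z) else none) (fun s' hs' t ht => by
      obtain ⟨h2, h3⟩ := bandCoord_glue hg hs hs' ht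
      by_cases h4 : level g s (circlePoint g (s' + t)) ∈ Set.Ioo (loLevel g) (hiLevel g)
      · rw [if_pos h4, if_pos (h2.1 h4), h3 h4]
      · rw [if_neg h4, if_neg fun h5 => h4 (h2.2 h5)]) z hz w hw h
  simp only [if_pos hl] at h1
  split_ifs at h1 with h2
  exact ⟨h2, Option.some_injective _ h1⟩

theorem chordPoint_glue {r : ℝ} (hr : r ∈ Set.Icc (loLevel g) (hiLevel g)) :
    P.toFun (chordPoint g s 0 r) = P.toFun (chordPoint g s 1 r) := by
  have hsq := sq_lt_one_of_level hg hr.1 hr.2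
  have hpos : 0 < √(1 - r ^ 2) := Real.sqrt_pos.2 (by linarith)
  have hn : ‖chordPoint g s 0 r‖ = 1 := by
    have h := norm_sq_chordPoint (g := g) s 0 hsq
    rw [← sq_eq_sq₀ (norm_nonneg _) zero_le_one, h]
    ring
  obtain ⟨t, ht, -, h | h⟩ := exists_eq_circlePoint s hg hn (by rwa [level_chordPoint])
  · have h1 : chordPoint g s 1 r = circlePoint g (s + 3 - t) := by
      rw [← sideInv_sideCoord g s (circlePoint g (s + 3 - t)), sideCoord_other, ← h.2, chordPoint,
        chordPoint, sideCoord_sideInv]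
      congr 1
      apply Complex.ext
      · simp
      · simp only [Complex.conj_im]
        ring
    rw [h.2, h1]
    exact P.glue s hs t ht
  -- The lower end of the chord has negative imaginary part, which excludes side `s + 2`.
  · rw [chordPoint, sideCoord_sideInv] at h
    have := h.1
    simp only at this
    linarith

theorem chordPoint_fract {u r : ℝ} (hu : u ∈ Set.Icc (0 : ℝ) 1)
    (hr : r ∈ Set.Icc (loLevel g) (hiLevel g)) :
    P.toFun (chordPoint g s (Int.fract u) r) = P.toFun (chordPoint g s u r) := by
  rcases hu.2.eq_or_lt with rfl | h
  · rw [Int.fract_one]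
    exact P.chordPoint_glue hg hs hr
  · rw [Int.fract_eq_self.2 ⟨hu.1, h⟩]

-- Clamping the level makes the formula meaningful for all real `r`; the jump of `Int.fract` is
-- harmless because the two ends of a chord are glued.
omit hs in
theorem continuous_band_cov (hs : IsSide g s) : Continuous fun q : ℝ × ℝ => P.toFun
    (chordPoint g s (Int.fract q.1) (Set.projIcc _ _ (loLevel_lt_hiLevel hg).le q.2)) := by
  have hproj : Continuous fun r : ℝ =>
      (Set.projIcc _ _ (loLevel_lt_hiLevel hg).le r : ℝ) :=
    continuous_subtype_val.comp continuous_projIcc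
  refine ContinuousOn.comp_fract (s := fun q : ℝ × ℝ => q.1)
    (f := fun (q : ℝ × ℝ) (u : ℝ) => P.toFun
      (chordPoint g s u (Set.projIcc _ _ (loLevel_lt_hiLevel hg).le q.2))) ?_ continuous_fst ?_
  · refine P.continuousOn.comp (Continuous.continuousOn ?_) ?_
    · exact (continuous_chordPoint g s).comp
        (continuous_snd.prodMk (hproj.comp (continuous_snd.comp continuous_fst)))
    · rintro ⟨q, u⟩ ⟨-, hu⟩
      have h := (Set.projIcc _ _ (loLevel_lt_hiLevel hg).le q.2).2
      exact chordPoint_mem s (sq_lt_one_of_level hg h.1 h.2) hu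
  · intro q
    exact P.chordPoint_glue hg hs (Set.projIcc _ _ (loLevel_lt_hiLevel hg).le q.2).2

end Band

/-- The set of points of the disc between the sides `s` and `s + 2`. -/
def bandSet (g s : ℕ) : Set ℂ := {z | level g s z ∈ Set.Ioo (loLevel g) (hiLevel g)}

theorem isOpen_bandSet (g s : ℕ) : IsOpen (bandSet g s) :=
  isOpen_Ioo.preimage (continuous_level g s)

/-- The parametrization of the annulus between the sides `s` and `s + 2`. -/
def bandFun (hg : 0 < g) (s : ℕ) (q : AddCircle (1 : ℝ) × ℝ) : S :=
  haveI : Fact ((0 : ℝ) < 1) := ⟨one_pos⟩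
  P.toFun (chordPoint g s (AddCircle.equivIco 1 0 q.1)
    (Set.projIcc _ _ (loLevel_lt_hiLevel hg).le q.2))

theorem bandFun_coe (hg : 0 < g) (s : ℕ) (u : ℝ) {r : ℝ}
    (hr : r ∈ Set.Icc (loLevel g) (hiLevel g)) :
    P.bandFun hg s (u, r) = P.toFun (chordPoint g s (Int.fract u) r) := by
  have : Fact ((0 : ℝ) < 1) := ⟨one_pos⟩
  have h : ((AddCircle.equivIco 1 0 (u : AddCircle (1 : ℝ)) : Set.Ico (0 : ℝ) (0 + 1)) : ℝ) =
      Int.fract u := by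
    simp [AddCircle.coe_equivIco_mk_apply]
  rw [bandFun, h, Set.projIcc_of_mem _ hr]

theorem continuous_bandFun (hg : 0 < g) {s : ℕ} (hs : IsSide g s) :
    Continuous (P.bandFun hg s) := by
  have : Fact ((0 : ℝ) < 1) := ⟨one_pos⟩
  have hq : IsOpenQuotientMap (Prod.map ((↑) : ℝ → AddCircle (1 : ℝ)) (id : ℝ → ℝ)) :=
    QuotientAddGroup.isOpenQuotientMap_mk.prodMap IsOpenQuotientMap.id
  rw [hq.isQuotientMap.continuous_iff]
  convert P.continuous_band_cov hg hs using 2 with q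
  have h : ((AddCircle.equivIco 1 0 (q.1 : AddCircle (1 : ℝ)) : Set.Ico (0 : ℝ) (0 + 1)) : ℝ) =
      Int.fract q.1 := by
    simp [AddCircle.coe_equivIco_mk_apply]
  change P.toFun (chordPoint g s (AddCircle.equivIco 1 0 (q.1 : AddCircle (1 : ℝ))) _) = _
  rw [h]
  rfl

theorem bandFun_bandCoord (hg : 0 < g) {s : ℕ} (hs : IsSide g s) {z : ℂ}
    (hz : z ∈ Metric.closedBall (0 : ℂ) 1) (hl : z ∈ bandSet g s) :
    P.bandFun hg s (bandCoord g s z) = P.toFun z := by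
  have hr : level g s z ∈ Set.Icc (loLevel g) (hiLevel g) := Set.Ioo_subset_Icc_self hl
  have hsq := sq_lt_one_of_level hg hr.1 hr.2
  rw [bandCoord, P.bandFun_coe hg s _ hr, P.chordPoint_fract hg hs (chordCoord_mem s hz hsq) hr,
    chordPoint_chordCoord s hsq]

/-- The inverse of `bandFun`. -/
def bandInv (s : ℕ) (x : S) : AddCircle (1 : ℝ) × ℝ := bandCoord g s (P.exists_eq x).choose

/-- On the band the arbitrary preimage chosen in `bandInv` does not matter, by `bandCoord_eq`. -/
theorem bandInv_toFun (hg : 0 < g) {s : ℕ} (hs : IsSide g s) {z : ℂ}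
    (hz : z ∈ Metric.closedBall (0 : ℂ) 1) (hl : z ∈ bandSet g s) :
    P.bandInv s (P.toFun z) = bandCoord g s z := by
  have h := (P.exists_eq (P.toFun z)).choose_spec
  exact (P.bandCoord_eq hg hs hz h.1 h.2.symm hl).2.symm

/-- The annulus between the sides `s` and `s + 2`. -/
def bandAnnulus (hg : 0 < g) {s : ℕ} (hs : IsSide g s) : Annulus S where
  chart :=
    { toFun := P.bandFun hg s
      invFun := P.bandInv s
      source := Set.univ ×ˢ Set.Ioo (loLevel g) (hiLevel g)
      target := P.toFun '' (bandSet g s ∩ Metric.closedBall 0 1)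
      map_source' := by
        rintro ⟨θ, r⟩ ⟨-, hr⟩
        obtain ⟨u, rfl⟩ := QuotientAddGroup.mk_surjective θ
        have hr' := Set.Ioo_subset_Icc_self hr
        refine ⟨_, ⟨?_, chordPoint_mem s (sq_lt_one_of_level hg hr'.1 hr'.2)
          ⟨Int.fract_nonneg u, (Int.fract_lt_one u).le⟩⟩, (P.bandFun_coe hg s u hr').symm⟩
        rw [bandSet, Set.mem_ofPred_eq, level_chordPoint]
        exact hr
      map_target' := by
        rintro _ ⟨z, ⟨hl, hz⟩, rfl⟩
        rw [P.bandInv_toFun hg hs hz hl]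
        exact ⟨trivial, hl⟩
      left_inv' := by
        rintro ⟨θ, r⟩ ⟨-, hr⟩
        obtain ⟨u, rfl⟩ := QuotientAddGroup.mk_surjective θ
        have hr' := Set.Ioo_subset_Icc_self hr
        have hsq := sq_lt_one_of_level hg hr'.1 hr'.2
        refine (congrArg _ (P.bandFun_coe hg s u hr')).trans ?_
        rw [P.bandInv_toFun hg hs (chordPoint_mem s hsq
          ⟨Int.fract_nonneg u, (Int.fract_lt_one u).le⟩)
          (by rw [bandSet, Set.mem_ofPred_eq, level_chordPoint]; exact hr), bandCoord,
          level_chordPoint, chordCoord_chordPoint s _ hsq]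
        refine Prod.ext ?_ rfl
        change ((Int.fract u : ℝ) : AddCircle (1 : ℝ)) = (u : AddCircle (1 : ℝ))
        rw [eq_comm, ← sub_eq_zero, ← AddCircle.coe_sub, AddCircle.coe_eq_zero_iff]
        exact ⟨⌊u⌋, by rw [zsmul_one, Int.self_sub_fract]⟩
      right_inv' := by
        rintro _ ⟨z, ⟨hl, hz⟩, rfl⟩
        rw [P.bandInv_toFun hg hs hz hl, P.bandFun_bandCoord hg hs hz hl]
      open_source := isOpen_univ.prod isOpen_Ioo
      open_target := P.isOpen_image (isOpen_bandSet g s) fun z hz w hw h hzO =>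
        (P.bandCoord_eq hg hs hz hw h hzO).1
      continuousOn_toFun := (P.continuous_bandFun hg hs).continuousOn
      continuousOn_invFun := by
        have hopen := P.isOpen_image (isOpen_bandSet g s) fun z hz w hw h hzO =>
          (P.bandCoord_eq hg hs hz hw h hzO).1
        rw [continuousOn_open_iff hopen]
        intro O hO
        have hc : ContinuousOn (bandCoord g s) (bandSet g s) :=
          (continuousOn_bandCoord g s).mono fun z hz => sq_lt_one_of_level hg hz.1.le hz.2.le
        have h1 := hc.isOpen_inter_preimage (isOpen_bandSet g s) hO
        have h2 := P.isOpen_image h1 fun z hz w hw h hzO => by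
          obtain ⟨h3, h4⟩ := P.bandCoord_eq hg hs hz hw h hzO.1
          refine ⟨h3, ?_⟩
          rw [Set.mem_preimage, ← h4]
          exact hzO.2
        convert h2 using 1
        ext x
        constructor
        · rintro ⟨⟨z, ⟨hl, hz⟩, rfl⟩, hx⟩
          rw [Set.mem_preimage, P.bandInv_toFun hg hs hz hl] at hx
          exact ⟨z, ⟨⟨hl, hx⟩, hz⟩, rfl⟩
        · rintro ⟨z, ⟨⟨hl, hx⟩, hz⟩, rfl⟩
          refine ⟨⟨z, ⟨hl, hz⟩, rfl⟩, ?_⟩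
          rw [Set.mem_preimage, P.bandInv_toFun hg hs hz hl]
          exact hx }
  lo := loLevel g
  hi := hiLevel g
  source_eq := rfl

end PolygonMap

/-! ### Cocycles on a punctured polygon -/

theorem circlePoint_add_int {g : ℕ} (hg : 0 < g) (x : ℝ) (n : ℤ) :
    circlePoint g (x + 4 * g * n) = circlePoint g x := by
  have h0 : (g : ℂ) ≠ 0 := by exact_mod_cast hg.ne'
  rw [circlePoint_add]
  have h : circlePoint g (4 * g * n) = 1 := by
    rw [circlePoint, Complex.exp_eq_one_iff]
    refine ⟨n, ?_⟩
    push_cast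
    field_simp
  rw [h, mul_one]

theorem exists_circlePoint_eq {g : ℕ} (hg : 0 < g) {z : ℂ} (hz : ‖z‖ = 1) :
    ∃ j < 4 * g, ∃ t ∈ Set.Ico (0 : ℝ) 1, z = circlePoint g (j + t) := by
  have hg0 : (0 : ℝ) < g := by exact_mod_cast hg
  set x : ℝ := Complex.arg z * (4 * g) / (2 * Real.pi) with hx
  have hzx : z = circlePoint g x := by
    have h2 := Complex.norm_mul_exp_arg_mul_I z
    rw [hz, Complex.ofReal_one, one_mul] at h2
    have h3 : 2 * Real.pi * x / (4 * g) = Complex.arg z := by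
      have := Real.pi_pos
      rw [hx]
      field_simp
    rw [circlePoint, h3, h2]
  set N : ℤ := ((4 * g : ℕ) : ℤ) with hN
  have hNpos : 0 < N := by omega
  have hj0 : 0 ≤ ⌊x⌋ % N := Int.emod_nonneg _ hNpos.ne'
  have hj1 : ⌊x⌋ % N < N := Int.emod_lt_of_pos _ hNpos
  refine ⟨(⌊x⌋ % N).toNat, by omega, Int.fract x, ⟨Int.fract_nonneg x, Int.fract_lt_one x⟩, ?_⟩
  have h3 : (((⌊x⌋ % N).toNat : ℕ) : ℝ) = ((⌊x⌋ % N : ℤ) : ℝ) := by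
    rw [← Int.cast_natCast, Int.toNat_of_nonneg hj0]
  have h4 : (⌊x⌋ : ℝ) = ((⌊x⌋ % N : ℤ) : ℝ) + 4 * g * ((⌊x⌋ / N : ℤ) : ℝ) := by
    have h5 : (⌊x⌋ : ℤ) = ⌊x⌋ % N + N * (⌊x⌋ / N) := (Int.emod_add_mul_ediv ⌊x⌋ N).symm
    have h6 := congrArg (Int.cast : ℤ → ℝ) h5
    rw [Int.cast_add, Int.cast_mul, hN] at h6
    rw [hN]
    push_cast at h6 ⊢
    exact h6
  rw [hzx, h3, ← circlePoint_add_int hg (((⌊x⌋ % N : ℤ) : ℝ) + Int.fract x) (⌊x⌋ / N)]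
  congr 1
  linarith [Int.floor_add_fract x]

/-! ### Filling in single points -/

section Points

variable {S : Type*} [TopologicalSpace S] [ChartedSpace ℂ S]
  [HasGroupoid S orientationGroupoid] {Y : Finset S}

theorem finTriv_empty : FinTriv Y (∅ : Set S) :=
  ⟨∅, Set.finite_empty, by simp, fun _ _ _ _ => ⟨1, fun _ _ _ hp => (hp 0).elim⟩⟩

variable [T1Space S]

/-- Every point has a small simply connected neighbourhood. -/
theorem exists_finTriv_nhd {v : S} {K : Set S} (hK : IsClosed K) (hvK : v ∉ K)
    (hYK : (Y : Set S) ⊆ K) :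
    ∃ B : Set S, IsOpen B ∧ v ∈ B ∧ B ∩ K = ∅ ∧ IsPreconnected B ∧ FinTriv Y B := by
  let c := chartAt ℂ v
  have hvc : v ∈ c.source := mem_chart_source ℂ v
  have hV : IsOpen (c.target ∩ c.symm ⁻¹' Kᶜ) := c.isOpen_inter_preimage_symm hK.isOpen_compl
  obtain ⟨r, hr, hb⟩ := Metric.isOpen_iff.1 hV (c v)
    ⟨c.map_source hvc, by simpa [c.left_inv hvc] using hvK⟩
  have hbt : Metric.ball (c v) r ⊆ c.target := fun z hz => (hb hz).1
  have : ContractibleSpace (Metric.ball (c v) r) :=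
    (convex_ball _ _).contractibleSpace ⟨_, Metric.mem_ball_self hr⟩
  have hloc : IsLocalHomeomorph fun z : Metric.ball (c v) r => c.symm z := by
    rw [isLocalHomeomorph_iff_isLocalHomeomorphOn_univ]
    refine IsLocalHomeomorphOn.comp (g := c.symm) (t := c.target) ?_
      (Metric.isOpen_ball.isOpenEmbedding_subtypeVal.isLocalHomeomorph.isLocalHomeomorphOn.mono
        (Set.subset_univ _)) fun z _ => hbt z.2
    exact IsLocalHomeomorphOn.mk _ _ fun x hx => ⟨c.symm, hx, fun _ _ => rfl⟩
  have hemb := hloc.isOpenEmbedding_of_injective fun z w h =>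
    Subtype.ext (c.symm.injOn (hbt z.2) (hbt w.2) h)
  refine ⟨_, hemb.isOpen_range, ⟨⟨c v, Metric.mem_ball_self hr⟩, c.left_inv hvc⟩, ?_, ?_,
    finTriv_range hemb fun z hz => (hb z.2).2 (hYK hz)⟩
  · ext x
    refine iff_of_false ?_ (Set.notMem_empty x)
    rintro ⟨⟨z, rfl⟩, hz⟩
    exact (hb z.2).2 hz
  · exact isPreconnected_range hemb.continuous

/-- Points of `Y` cost nothing. Any other point is covered by a small disc avoiding `Y` and the
remaining points, and this disc meets the rest in a punctured disc, which is connected. -/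
theorem FinTriv.univ_of_compl_finset (F : Finset S) (h : FinTriv Y ((F : Set S)ᶜ)) :
    FinTriv Y Set.univ := by
  classical
  induction F using Finset.induction_on with
  | empty => simpa using h
  | insert v F hv ih =>
    apply ih
    by_cases hvY : v ∈ Y
    · refine FinTriv.of_diff (h.mono ?_)
      rintro x ⟨hx, hxY⟩
      simp only [Finset.coe_insert, Set.mem_compl_iff, Set.mem_insert_iff, not_or]
      exact ⟨fun hxv => hxY (hxv ▸ hvY), hx⟩
    · obtain ⟨B, hB, hvB, hBK, hBc, hBt⟩ := exists_finTriv_nhd (Y := Y) (v := v)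
        (K := (Y : Set S) ∪ F) (Y.finite_toSet.isClosed.union F.finite_toSet.isClosed)
        (by simp [hvY, hv]) Set.subset_union_left
      have hint : ((insert v F : Finset S) : Set S)ᶜ ∩ B = B \ {v} := by
        ext x
        simp only [Finset.coe_insert, Set.mem_inter_iff, Set.mem_compl_iff, Set.mem_insert_iff,
          not_or, Set.mem_sdiff, Set.mem_singleton_iff]
        constructor
        · rintro ⟨⟨h1, -⟩, h2⟩
          exact ⟨h2, h1⟩
        · rintro ⟨h1, h2⟩
          refine ⟨⟨h2, fun h3 => ?_⟩, h1⟩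
          have : x ∈ B ∩ ((Y : Set S) ∪ F) := ⟨h1, Or.inr h3⟩
          rw [hBK] at this
          exact this
      refine (h.union (Finset.finite_toSet _).isClosed.isOpen_compl hB ?_ hBt).mono ?_
      · rw [hint]
        exact isPreconnected_diff_singleton hB hBc v
      · intro x hx
        by_cases hxv : x = v
        · exact Or.inr (hxv ▸ hvB)
        · left
          simp only [Finset.coe_insert, Set.mem_compl_iff, Set.mem_insert_iff, not_or]
          exact ⟨hxv, hx⟩

end Points

/-! ### Covering the surface by the open disc and the annuli -/

namespace PolygonMap

variable {g : ℕ} {S : Type*} [TopologicalSpace S] (P : PolygonMap g S)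

theorem ball_subset : Metric.ball (0 : ℂ) 1 ⊆ Metric.closedBall 0 1 := Metric.ball_subset_closedBall

theorem injOn_ball : Set.InjOn P.toFun (Metric.ball 0 1) := fun z hz w hw h =>
  P.norm_lt_one_of_eq (by simpa using hz) (ball_subset hw) h

theorem isOpen_image_of_subset_ball {O : Set ℂ} (hO : IsOpen O) (hO1 : O ⊆ Metric.ball 0 1) :
    IsOpen (P.toFun '' O) := by
  have h := P.isOpen_image hO fun z _ w hw h hzO => by
    rwa [← P.norm_lt_one_of_eq (by simpa using hO1 hzO) hw h]
  rwa [Set.inter_eq_self_of_subset_left (hO1.trans ball_subset)] at h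

theorem isPreconnected_image {C : Set ℂ} (hC : Convex ℝ C) (hC1 : C ⊆ Metric.closedBall 0 1) :
    IsPreconnected (P.toFun '' C) :=
  hC.isPreconnected.image _ (P.continuousOn.mono hC1)

theorem finTriv_image [T1Space S] [ChartedSpace ℂ S] [HasGroupoid S orientationGroupoid]
    {Y : Finset S} {C : Set ℂ} (hCo : IsOpen C) (hC : Convex ℝ C)
    (hC1 : C ⊆ Metric.ball 0 1) (hY : ∀ z ∈ C, P.toFun z ∉ Y) : FinTriv Y (P.toFun '' C) := by
  rcases C.eq_empty_or_nonempty with rfl | hne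
  · rw [Set.image_empty]
    exact finTriv_empty
  have := hC.contractibleSpace hne
  have hemb : IsOpenEmbedding fun z : C => P.toFun z := by
    refine IsOpenEmbedding.of_continuous_injective_isOpenMap ?_ ?_ ?_
    · exact P.continuousOn.comp_continuous continuous_subtype_val
        fun z => ball_subset (hC1 z.2)
    · exact fun z w h => Subtype.ext (P.injOn_ball (hC1 z.2) (hC1 w.2) h)
    · intro O hO
      have h1 := P.isOpen_image_of_subset_ball (hCo.isOpenMap_subtype_val O hO)
        (by rintro _ ⟨z, -, rfl⟩; exact hC1 z.2)
      rwa [Set.image_image] at h1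
  have h1 := finTriv_range (Y := Y) hemb fun z => hY z z.2
  rwa [← Set.image_eq_range] at h1

section Band

variable (hg : 0 < g) {s : ℕ} (hs : IsSide g s)

include hg hs

theorem image_chart_Icc {a b : ℝ} (ha : loLevel g < a) (hb : b < hiLevel g) {z : ℂ}
    (hz : z ∈ Metric.closedBall (0 : ℂ) 1) :
    P.toFun z ∈ (P.bandAnnulus hg hs).chart '' (Set.univ ×ˢ Set.Icc a b) ↔
      level g s z ∈ Set.Icc a b := by
  constructor
  · rintro ⟨⟨θ, r⟩, ⟨-, hr⟩, h⟩
    obtain ⟨u, rfl⟩ := QuotientAddGroup.mk_surjective θ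
    have hrI : r ∈ Set.Ioo (loLevel g) (hiLevel g) := ⟨ha.trans_le hr.1, hr.2.trans_lt hb⟩
    have hr' := Set.Ioo_subset_Icc_self hrI
    have h1 := (P.bandFun_coe hg s u hr').symm.trans h
    obtain ⟨-, h2⟩ := P.bandCoord_eq hg hs (chordPoint_mem s (sq_lt_one_of_level hg hr'.1 hr'.2)
      ⟨Int.fract_nonneg u, (Int.fract_lt_one u).le⟩) hz h1 (by rwa [level_chordPoint])
    have h3 : level g s (chordPoint g s (Int.fract u) r) = level g s z := congrArg Prod.snd h2
    rw [level_chordPoint] at h3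
    rwa [← h3]
  · intro h
    exact ⟨bandCoord g s z, ⟨trivial, h⟩, P.bandFun_bandCoord hg hs hz
      ⟨ha.trans_le h.1, h.2.trans_lt hb⟩⟩

/-- The annulus does not separate the surface. -/
theorem isPreconnected_compl_band {a b : ℝ} (ha : loLevel g < a)
    (hb : b < hiLevel g) :
    IsPreconnected ((P.bandAnnulus hg hs).chart '' (Set.univ ×ˢ Set.Icc a b))ᶜ := by
  -- The complement is the image of two convex caps of the disc, so it suffices that a boundary
  -- point of one is glued to a boundary point of the other.
  have heq : ((P.bandAnnulus hg hs).chart '' (Set.univ ×ˢ Set.Icc a b))ᶜ =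
      P.toFun '' ({z | level g s z ∈ Set.Iio a} ∩ Metric.closedBall 0 1) ∪
      P.toFun '' ({z | level g s z ∈ Set.Ioi b} ∩ Metric.closedBall 0 1) := by
    ext x
    obtain ⟨z, hz, rfl⟩ := P.exists_eq x
    rw [Set.mem_compl_iff, P.image_chart_Icc hg hs ha hb hz]
    constructor
    · intro h
      by_cases h1 : level g s z < a
      · exact Or.inl ⟨z, ⟨h1, hz⟩, rfl⟩
      · refine Or.inr ⟨z, ⟨?_, hz⟩, rfl⟩
        by_contra h2
        exact h ⟨not_lt.1 h1, not_lt.1 h2⟩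
    · rintro (⟨w, ⟨hl, hw⟩, hwz⟩ | ⟨w, ⟨hl, hw⟩, hwz⟩) <;> intro h
      · rw [← P.image_chart_Icc hg hs ha hb hz, ← hwz, P.image_chart_Icc hg hs ha hb hw] at h
        exact not_le.2 hl h.1
      · rw [← P.image_chart_Icc hg hs ha hb hz, ← hwz, P.image_chart_Icc hg hs ha hb hw] at h
        exact not_le.2 hl h.2
  have hg1 := one_le_cast hg
  have hone : b < 1 := hb.trans (hiLevel_lt_one hg)
  have hcos : Real.cos (2 * (Real.pi / (2 * g))) < a :=
    ((cos_unit_lt_iff hg (by norm_num) (by linarith) (by norm_num) (by linarith)).2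
      (by norm_num) : Real.cos (2 * (Real.pi / (2 * g))) <
        Real.cos (3 / 2 * (Real.pi / (2 * g)))).trans ha
  -- Side `s + 1` belongs to the other pair of the same handle. Its midpoint has level 1 and is
  -- glued to the midpoint of `s + 3` or `s - 1`, which has level cos(π/g), below `loLevel g`.
  obtain ⟨z, w, hzw, hlz, hlw⟩ : ∃ z w : ℝ, P.toFun (circlePoint g z) =
      P.toFun (circlePoint g w) ∧ level g s (circlePoint g z) < a ∧
        b < level g s (circlePoint g w) := by
    obtain ⟨hs1, hs2⟩ := hs
    rcases Nat.lt_or_ge (s % 4) 1 with h | h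
    · refine ⟨_, _, (P.glue (s + 1) ⟨by omega, by omega⟩ (1 / 2) ⟨by norm_num, by norm_num⟩).symm,
        ?_, ?_⟩
      · rw [level_circlePoint]
        convert hcos using 3
        push_cast
        ring
      · rw [level_circlePoint]
        rwa [show (((s + 1 : ℕ) : ℝ) + 1 / 2 - s - 3 / 2) * (Real.pi / (2 * g)) = 0 by
          push_cast; ring, Real.cos_zero]
    · have hcast : ((s - 1 : ℕ) : ℝ) = s - 1 := by
        rw [Nat.cast_sub (by omega), Nat.cast_one]
      refine ⟨_, _, P.glue (s - 1) ⟨by omega, by omega⟩ (1 / 2) ⟨by norm_num, by norm_num⟩, ?_, ?_⟩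
      · rw [level_circlePoint, hcast, ← Real.cos_neg]
        convert hcos using 3
        ring
      · rw [level_circlePoint, hcast]
        rwa [show ((s : ℝ) - 1 + 3 - 1 / 2 - s - 3 / 2) * (Real.pi / (2 * g)) = 0 by ring,
          Real.cos_zero]
  rw [heq]
  refine IsPreconnected.union (P.toFun (circlePoint g z))
    ⟨_, ⟨hlz, circlePoint_mem z⟩, rfl⟩ ⟨_, ⟨hlw, circlePoint_mem w⟩, hzw.symm⟩ ?_ ?_
  · exact P.isPreconnected_image ((convex_level g s (convex_Iio a)).inter
      (convex_closedBall _ _)) Set.inter_subset_right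
  · exact P.isPreconnected_image ((convex_level g s (convex_Ioi b)).inter
      (convex_closedBall _ _)) Set.inter_subset_right

/-- A boundary point on a chord is one of its two ends, and these are glued. So each level of the
annulus contains only one point coming from the boundary. -/
theorem toFun_of_norm_eq_one {z : ℂ} (hz : ‖z‖ = 1)
    (hl : level g s z ∈ Set.Icc (loLevel g) (hiLevel g)) :
    P.toFun z = P.toFun (chordPoint g s 0 (level g s z)) := by
  have hsq := sq_lt_one_of_level hg hl.1 hl.2
  have h1 := norm_sq_chordPoint (g := g) s (chordCoord g s z) hsq
  have h2 := chordPoint_chordCoord s hsq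
  rw [h2, hz] at h1
  have h3 : (1 - level g s z ^ 2) * (chordCoord g s z * (chordCoord g s z - 1)) = 0 := by
    linear_combination (-1 / 4 : ℝ) * h1
  rw [mul_eq_zero, or_iff_right (by linarith), mul_eq_zero] at h3
  rcases h3 with h3 | h3
  · rw [h3] at h2
    rw [h2]
  · rw [sub_eq_zero.1 h3] at h2
    rw [P.chordPoint_glue hg hs hl, h2]

-- Bands may cross inside the disc, but they meet its boundary in disjoint arcs.
omit P in
theorem side_unique {s' : ℕ} (hs' : IsSide g s') {z : ℂ} (hz : ‖z‖ = 1) (h1 : z ∈ bandSet g s)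
    (h2 : z ∈ bandSet g s') : s' = s := by
  obtain ⟨t, ht, -, h | h⟩ := exists_eq_circlePoint s hg hz (Set.Ioo_subset_Icc_self h1)
  · rw [h.2, bandSet, Set.mem_ofPred_eq, level_circlePoint] at h2
    refine (side_eq_of_level hg hs' hs ht ?_).symm
    convert h2 using 3
    ring
  · rw [h.2, bandSet, Set.mem_ofPred_eq, level_circlePoint] at h2
    refine side_eq_of_level hg hs hs' ht ?_
    rw [← Real.cos_neg]
    convert h2 using 3
    ring

theorem band_eq : (P.bandAnnulus hg hs).band (loLevel g) (hiLevel g) =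
    P.toFun '' (bandSet g s ∩ Metric.closedBall 0 1) :=
  (P.bandAnnulus hg hs).chart.image_source_eq_target

theorem isOpen_band : IsOpen (P.toFun '' (bandSet g s ∩ Metric.closedBall 0 1)) :=
  P.isOpen_image (isOpen_bandSet g s) fun _ hz _ hw h hzO => (P.bandCoord_eq hg hs hz hw h hzO).1

end Band

section Main

variable [T2Space S] [ChartedSpace ℂ S] [HasGroupoid S orientationGroupoid]

/-- The points of `Y` in the open polygon lie on distinct levels of the band of the side `0`, and
in no other band. -/
structure GoodPosition (P : PolygonMap g S) (Y : Finset S) : Prop where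
  mem_bandSet : ∀ z ∈ Metric.ball (0 : ℂ) 1, P.toFun z ∈ Y → z ∈ bandSet g 0
  side_eq_zero : ∀ z ∈ Metric.ball (0 : ℂ) 1, P.toFun z ∈ Y → ∀ s, IsSide g s →
    z ∈ bandSet g s → s = 0
  -- Here `w` may lie on the boundary: interior punctures must also avoid the levels of punctures on
  -- the sides.
  eq_of_level_eq : ∀ z ∈ Metric.ball (0 : ℂ) 1, P.toFun z ∈ Y →
    ∀ w ∈ Metric.closedBall (0 : ℂ) 1, P.toFun w ∈ Y → level g 0 z = level g 0 w →
      P.toFun z = P.toFun w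

variable {P} {Y : Finset S} (hP : P.GoodPosition Y) (hg : 0 < g)

include hP hg

/-- For `s ≠ 0` all punctures in the band lie on the glued sides, one at most on each level; for `s
= 0` good position separates the levels. -/
theorem GoodPosition.finTriv_band {s : ℕ} (hs : IsSide g s) :
    FinTriv Y (P.toFun '' (bandSet g s ∩ Metric.closedBall 0 1)) := by
  rw [← P.band_eq hg hs]
  refine (P.bandAnnulus hg hs).finTriv_of_distinct_levels
    (fun _ _ ha _ hb => P.isPreconnected_compl_band hg hs ha hb) ?_
  intro r hr u v hu hv
  have hr' : r ∈ Set.Icc (loLevel g) (hiLevel g) := Set.Ioo_subset_Icc_self hr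
  have hsq := sq_lt_one_of_level hg hr'.1 hr'.2
  have hcov : ∀ u, (P.bandAnnulus hg hs).cov (u, r) =
      P.toFun (chordPoint g s (Int.fract u) r) := fun u => P.bandFun_coe hg s u hr'
  rw [hcov] at hu hv ⊢
  rw [hcov]
  have hmem : ∀ u, chordPoint g s (Int.fract u) r ∈ Metric.closedBall (0 : ℂ) 1 := fun u =>
    chordPoint_mem s hsq ⟨Int.fract_nonneg u, (Int.fract_lt_one u).le⟩
  have hband : ∀ u, chordPoint g s (Int.fract u) r ∈ bandSet g s := fun u => by
    rw [bandSet, Set.mem_ofPred_eq, level_chordPoint]; exact hr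
  have key : ∀ u v, P.toFun (chordPoint g s (Int.fract u) r) ∈ Y →
      P.toFun (chordPoint g s (Int.fract v) r) ∈ Y →
      chordPoint g s (Int.fract u) r ∈ Metric.ball (0 : ℂ) 1 →
      P.toFun (chordPoint g s (Int.fract u) r) = P.toFun (chordPoint g s (Int.fract v) r) := by
    intro u v hu hv h
    have h0 := hP.side_eq_zero _ h hu s hs (hband u)
    subst h0
    exact hP.eq_of_level_eq _ h hu _ (hmem v) hv (by rw [level_chordPoint, level_chordPoint])
  by_cases h1 : chordPoint g s (Int.fract u) r ∈ Metric.ball (0 : ℂ) 1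
  · exact key u v hu hv h1
  by_cases h2 : chordPoint g s (Int.fract v) r ∈ Metric.ball (0 : ℂ) 1
  · exact (key v u hv hu h2).symm
  have hnorm : ∀ u, chordPoint g s (Int.fract u) r ∉ Metric.ball (0 : ℂ) 1 →
      ‖chordPoint g s (Int.fract u) r‖ = 1 := fun u h =>
    le_antisymm (by simpa using hmem u) (by simpa using h)
  rw [P.toFun_of_norm_eq_one hg hs (hnorm u h1) (by rwa [level_chordPoint]),
    P.toFun_of_norm_eq_one hg hs (hnorm v h2) (by rwa [level_chordPoint]), level_chordPoint,
    level_chordPoint]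

/-- The open disc is the strip of the band of side 0 together with two convex caps without punctures
that overlap it. The strip inherits triviality from the annulus containing it. -/
theorem GoodPosition.finTriv_ball : FinTriv Y (P.toFun '' Metric.ball 0 1) := by
  have hs : IsSide g 0 := ⟨by omega, by omega⟩
  have hlh := loLevel_lt_hiLevel hg
  let L : Set ℝ := level g 0 '' (Metric.ball 0 1 ∩ P.toFun ⁻¹' Y)
  have hLfin : L.Finite := by
    refine Set.Finite.image _ (Set.Finite.of_finite_image (f := P.toFun) ?_ ?_)
    · exact Y.finite_toSet.subset (by rintro _ ⟨z, hz, rfl⟩; exact hz.2)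
    · exact P.injOn_ball.mono Set.inter_subset_left
  have hLband : ∀ r ∈ L, r ∈ Set.Ioo (loLevel g) (hiLevel g) := by
    rintro _ ⟨z, hz, rfl⟩
    exact hP.mem_bandSet z hz.1 hz.2
  obtain ⟨e₁, he₁, hL₁⟩ := Metric.isOpen_iff.1 hLfin.isClosed.isOpen_compl (loLevel g)
    fun h => lt_irrefl _ (hLband _ h).1
  obtain ⟨e₂, he₂, hL₂⟩ := Metric.isOpen_iff.1 hLfin.isClosed.isOpen_compl (hiLevel g)
    fun h => lt_irrefl _ (hLband _ h).2
  -- The margin is smaller than the distance of the puncture levels from both ends of the strip, and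
  -- 2e ≤ hi − lo keeps the caps disjoint.
  set e := min (min e₁ e₂) (hiLevel g - loLevel g) / 2 with he
  have he0 : 0 < e := half_pos (lt_min (lt_min he₁ he₂) (by linarith))
  have hem1 : 2 * e ≤ e₁ := by
    rw [he]; linarith [(min_le_left (min e₁ e₂) (hiLevel g - loLevel g)).trans (min_le_left _ _)]
  have hem2 : 2 * e ≤ e₂ := by
    rw [he]; linarith [(min_le_left (min e₁ e₂) (hiLevel g - loLevel g)).trans (min_le_right _ _)]
  have hem3 : 2 * e ≤ hiLevel g - loLevel g := by
    rw [he]; linarith [min_le_right (min e₁ e₂) (hiLevel g - loLevel g)]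
  set a := loLevel g + e with ha
  set b := hiLevel g - e with hb
  have hYa : ∀ z ∈ Metric.ball (0 : ℂ) 1, P.toFun z ∈ Y → a < level g 0 z := by
    intro z hz hzY
    by_contra h
    have hzL : level g 0 z ∈ L := ⟨z, ⟨hz, hzY⟩, rfl⟩
    refine hL₁ ?_ hzL
    rw [Metric.mem_ball, Real.dist_eq, abs_lt]
    have := (hLband _ hzL).1
    constructor <;> linarith
  have hYb : ∀ z ∈ Metric.ball (0 : ℂ) 1, P.toFun z ∈ Y → level g 0 z < b := by
    intro z hz hzY
    by_contra h
    have hzL : level g 0 z ∈ L := ⟨z, ⟨hz, hzY⟩, rfl⟩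
    refine hL₂ ?_ hzL
    rw [Metric.mem_ball, Real.dist_eq, abs_lt]
    have := (hLband _ hzL).2
    constructor <;> linarith
  have hlev := continuous_level g 0
  let D (I : Set ℝ) : Set ℂ := Metric.ball 0 1 ∩ {z | level g 0 z ∈ I}
  have hDb : ∀ I, D I ⊆ Metric.ball 0 1 := fun I => Set.inter_subset_left
  have hDo : ∀ {I}, IsOpen I → IsOpen (D I) := fun hI =>
    Metric.isOpen_ball.inter (hI.preimage hlev)
  have hDc : ∀ {I}, Convex ℝ I → Convex ℝ (D I) := fun hI =>
    (convex_ball _ _).inter (convex_level g 0 hI)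
  have hDi : ∀ I J, P.toFun '' D I ∩ P.toFun '' D J = P.toFun '' D (I ∩ J) := by
    intro I J
    rw [← P.injOn_ball.image_inter (hDb I) (hDb J)]
    congr 1
    ext z
    simp only [D, Set.mem_inter_iff, Set.mem_ofPred_eq]
    tauto
  have hDp : ∀ {I}, Convex ℝ I → IsPreconnected (P.toFun '' D I) := fun {I} hI =>
    P.isPreconnected_image (hDc hI) ((hDb I).trans ball_subset)
  have hDO : ∀ {I}, IsOpen I → IsOpen (P.toFun '' D I) := fun {I} hI =>
    P.isOpen_image_of_subset_ball (hDo hI) (hDb I)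
  have h1 : FinTriv Y (P.toFun '' D (Set.Iio a)) :=
    P.finTriv_image (hDo isOpen_Iio) (hDc (convex_Iio a)) (hDb _)
      fun z hz hzY => lt_asymm hz.2 (hYa z hz.1 hzY)
  have h2 : FinTriv Y (P.toFun '' D (Set.Ioi b)) :=
    P.finTriv_image (hDo isOpen_Ioi) (hDc (convex_Ioi b)) (hDb _)
      fun z hz hzY => lt_asymm hz.2 (hYb z hz.1 hzY)
  have h3 : FinTriv Y (P.toFun '' D (Set.Ioo (loLevel g) (hiLevel g))) :=
    (hP.finTriv_band hg hs).mono (Set.image_mono fun z hz => ⟨hz.2, ball_subset hz.1⟩)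
  have h4 := h1.union (hDO isOpen_Iio) (hDO isOpen_Ioo) (by
    rw [hDi]; exact hDp ((convex_Iio a).inter (convex_Ioo _ _))) h3
  have h5 := h4.union ((hDO isOpen_Iio).union (hDO isOpen_Ioo)) (hDO isOpen_Ioi) (by
    have hemp : Set.Iio a ∩ Set.Ioi b = ∅ := by
      ext r
      refine iff_of_false ?_ (Set.notMem_empty r)
      rintro ⟨hr1, hr2⟩
      rw [Set.mem_Iio] at hr1
      rw [Set.mem_Ioi] at hr2
      linarith
    rw [Set.union_inter_distrib_right, hDi, hDi, hemp]
    have : P.toFun '' D ∅ = ∅ := by simp [D]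
    rw [this, Set.empty_union]
    exact hDp ((convex_Ioo _ _).inter (convex_Ioi b))) h2
  refine h5.mono ?_
  rintro _ ⟨z, hz, rfl⟩
  by_cases h6 : level g 0 z < a
  · exact Or.inl (Or.inl ⟨z, ⟨hz, h6⟩, rfl⟩)
  by_cases h7 : b < level g 0 z
  · exact Or.inr ⟨z, ⟨hz, h7⟩, rfl⟩
  · exact Or.inl (Or.inr ⟨z, ⟨hz, by rw [Set.mem_ofPred_eq]; constructor <;> linarith⟩, rfl⟩)

/-- A new band shares no boundary points with the earlier ones, so it meets the union exactly in its
part inside the open disc, which is convex. -/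
theorem GoodPosition.finTriv_bands (J : Finset ℕ) (hJ : ∀ s ∈ J, IsSide g s) :
    FinTriv Y (P.toFun '' Metric.ball 0 1 ∪
      ⋃ s ∈ J, P.toFun '' (bandSet g s ∩ Metric.closedBall 0 1)) := by
  classical
  induction J using Finset.induction_on with
  | empty => simpa using hP.finTriv_ball hg
  | insert s J hsJ ih =>
    have hJ' : ∀ s ∈ J, IsSide g s := fun s hs => hJ s (Finset.mem_insert_of_mem hs)
    have hs := hJ s (Finset.mem_insert_self s J)
    have hO : IsOpen (⋃ s ∈ J, P.toFun '' (bandSet g s ∩ Metric.closedBall 0 1)) :=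
      isOpen_biUnion fun s' hs' => P.isOpen_band hg (hJ' s' hs')
    have h1 := (ih hJ').union ((P.isOpen_image_of_subset_ball Metric.isOpen_ball le_rfl).union hO)
      (P.isOpen_band hg hs) (by
        have heq : (P.toFun '' Metric.ball 0 1 ∪
            ⋃ s ∈ J, P.toFun '' (bandSet g s ∩ Metric.closedBall 0 1)) ∩
            P.toFun '' (bandSet g s ∩ Metric.closedBall 0 1) =
            P.toFun '' (bandSet g s ∩ Metric.ball 0 1) := by
          ext x
          constructor
          · rintro ⟨h, ⟨w, ⟨hwl, hw⟩, rfl⟩⟩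
            by_cases hw1 : w ∈ Metric.ball (0 : ℂ) 1
            · exact ⟨w, ⟨hwl, hw1⟩, rfl⟩
            exfalso
            rcases h with ⟨z, hz, hzw⟩ | h
            · rw [P.norm_lt_one_of_eq (by simpa using hz) hw hzw] at hz
              exact hw1 hz
            · simp only [Set.mem_iUnion] at h
              obtain ⟨s', hs', z, ⟨hzl, hz⟩, hzw⟩ := h
              have hwn : ‖w‖ = 1 := le_antisymm (by simpa using hw) (by simpa using hw1)
              have h2 := (P.bandCoord_eq hg (hJ' s' hs') hz hw hzw hzl).1
              have h3 := side_unique hg (hJ' s' hs') hs hwn h2 hwl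
              exact hsJ (h3 ▸ hs')
          · rintro ⟨z, ⟨hzl, hz⟩, rfl⟩
            exact ⟨Or.inl ⟨z, hz, rfl⟩, z, ⟨hzl, ball_subset hz⟩, rfl⟩
        rw [heq]
        exact P.isPreconnected_image ((convex_level g s (convex_Ioo _ _)).inter (convex_ball _ _))
          (Set.inter_subset_right.trans ball_subset)) (hP.finTriv_band hg hs)
    rwa [Finset.set_biUnion_insert, ← Set.union_assoc, Set.union_right_comm]

/-- A boundary point that is not a vertex lies in the interior of some side j, hence in the band of
j or of j − 2. Only the finitely many vertices are left to fill in. -/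
theorem GoodPosition.finTriv_univ : FinTriv Y Set.univ := by
  classical
  let J : Finset ℕ := (Finset.range (4 * g)).filter (IsSide g)
  have hJ : ∀ s, s ∈ J ↔ IsSide g s := fun s => by
    simp only [J, Finset.mem_filter, Finset.mem_range, and_iff_right_iff_imp]
    exact fun h => h.1
  refine FinTriv.univ_of_compl_finset ((Finset.range (4 * g)).image fun j : ℕ =>
    P.toFun (circlePoint g j)) ((hP.finTriv_bands hg J fun s hs => (hJ s).1 hs).mono ?_)
  intro x hx
  obtain ⟨z, hz, rfl⟩ := P.exists_eq x
  by_cases hz1 : z ∈ Metric.ball (0 : ℂ) 1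
  · exact Or.inl ⟨z, hz1, rfl⟩
  right
  have hzn : ‖z‖ = 1 := le_antisymm (by simpa using hz) (by simpa using hz1)
  obtain ⟨j, hj, t, ⟨ht0, ht1⟩, rfl⟩ := exists_circlePoint_eq hg hzn
  rcases ht0.eq_or_lt with rfl | ht0
  · rw [add_zero] at hx
    exact absurd (Finset.mem_coe.2 (Finset.mem_image_of_mem _ (Finset.mem_range.2 hj))) hx
  simp only [Set.mem_iUnion]
  by_cases hj4 : j % 4 < 2
  · refine ⟨j, (hJ j).2 ⟨hj, hj4⟩, _, ⟨?_, hz⟩, rfl⟩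
    rw [bandSet, Set.mem_ofPred_eq, level_circlePoint]
    apply level_mem hg
    · rw [lt_abs]; right; linarith
    · rw [abs_lt]; constructor <;> linarith
  · have hcast : ((j - 2 : ℕ) : ℝ) = j - 2 := by
      rw [Nat.cast_sub (by omega), Nat.cast_ofNat]
    refine ⟨j - 2, (hJ _).2 ⟨by omega, by omega⟩, _, ⟨?_, hz⟩, rfl⟩
    rw [bandSet, Set.mem_ofPred_eq, level_circlePoint, hcast]
    apply level_mem hg
    · rw [lt_abs]; left; linarith
    · rw [abs_lt]; constructor <;> linarith

end Main

end PolygonMap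

/-! ### Moving the punctures into good position -/

/-- A cut-off function that is `1` on `[0, r]` and `0` at `1`. -/
def discCutoff (r x : ℝ) : ℝ := min 1 ((1 - x) / (1 - r))

section DiscCutoff

variable {r : ℝ} (hr : r < 1)

theorem continuous_discCutoff (r : ℝ) : Continuous (discCutoff r) := by
  unfold discCutoff; fun_prop

theorem discCutoff_one (r : ℝ) : discCutoff r 1 = 0 := by simp [discCutoff]

include hr

theorem discCutoff_of_le {x : ℝ} (hx : x ≤ r) : discCutoff r x = 1 :=
  min_eq_left ((one_le_div (by linarith)).2 (by linarith))

theorem discCutoff_nonneg {x : ℝ} (hx : x ≤ 1) : 0 ≤ discCutoff r x :=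
  le_min zero_le_one (div_nonneg (by linarith) (by linarith))

theorem antitone_discCutoff : Antitone (discCutoff r) := fun x y h =>
  min_le_min le_rfl (div_le_div_of_nonneg_right (by linarith) (by linarith))

theorem abs_discCutoff_sub_le (x y : ℝ) :
    |discCutoff r x - discCutoff r y| ≤ |x - y| / (1 - r) := by
  have h := abs_min_sub_min_le_max 1 ((1 - x) / (1 - r)) 1 ((1 - y) / (1 - r))
  have hpos : 0 < 1 - r := by linarith
  rw [sub_self, abs_zero, max_eq_right (abs_nonneg _), ← sub_div, abs_div, abs_of_pos hpos,
    sub_sub_sub_cancel_left, abs_sub_comm y x] at h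
  exact h

/-- A translation near the origin extends to the disc. -/
theorem bijOn_disc_translation {w : ℂ} (h : r + ‖w‖ < 1) :
    Set.BijOn (fun z : ℂ => z + discCutoff r ‖z‖ * w) (Metric.closedBall 0 1)
      (Metric.closedBall 0 1) := by
  have hpos : 0 < 1 - r := by linarith
  refine ⟨fun z hz => ?_, fun z hz z' hz' hzz => ?_, fun p hp => ?_⟩
  · rw [mem_closedBall_zero_iff] at hz ⊢
    have h0 := discCutoff_nonneg hr hz
    have h1 : discCutoff r ‖z‖ * ‖w‖ ≤ 1 - ‖z‖ := by
      calc discCutoff r ‖z‖ * ‖w‖ ≤ (1 - ‖z‖) / (1 - r) * (1 - r) :=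
            mul_le_mul (min_le_right _ _) (by linarith) (norm_nonneg _)
              (div_nonneg (by linarith) hpos.le)
        _ = 1 - ‖z‖ := div_mul_cancel₀ _ hpos.ne'
    refine (norm_add_le _ _).trans ?_
    rw [norm_mul, Complex.norm_real, Real.norm_eq_abs, abs_of_nonneg h0]
    linarith
  · have h1 : z - z' = ((discCutoff r ‖z'‖ - discCutoff r ‖z‖ : ℝ) : ℂ) * w := by
      have h2 : z + discCutoff r ‖z‖ * w = z' + discCutoff r ‖z'‖ * w := hzz
      push_cast
      linear_combination h2
    -- The displacement is Lipschitz with constant ‖w‖/(1 − r) < 1, hence injectivity.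
    have h2 : ‖z - z'‖ ≤ ‖z - z'‖ / (1 - r) * ‖w‖ := by
      conv_lhs => rw [h1]
      rw [norm_mul, Complex.norm_real, Real.norm_eq_abs]
      refine mul_le_mul_of_nonneg_right ((abs_discCutoff_sub_le hr _ _).trans
        (div_le_div_of_nonneg_right ?_ hpos.le)) (norm_nonneg _)
      rw [norm_sub_rev]
      exact abs_norm_sub_norm_le _ _
    rw [← sub_eq_zero, ← norm_eq_zero]
    by_contra hne
    have h3 : 0 < ‖z - z'‖ := lt_of_le_of_ne (norm_nonneg _) (Ne.symm hne)
    rw [div_mul_eq_mul_div, le_div_iff₀ hpos] at h2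
    nlinarith
  · rw [mem_closedBall_zero_iff] at hp
    -- The cutoff depends only on the norm of the preimage, so it suffices to find that norm `x` by
    -- the intermediate value theorem.
    have hc : ContinuousOn (fun x : ℝ => x - ‖p - discCutoff r x * w‖) (Set.Icc 0 1) := by
      have := continuous_discCutoff r
      fun_prop
    obtain ⟨x, hx, hx0⟩ := intermediate_value_Icc zero_le_one hc (show (0 : ℝ) ∈ _ from
      ⟨by simp, by simpa [discCutoff_one] using hp⟩)
    have hx1 : ‖p - discCutoff r x * w‖ = x := by
      have : x - ‖p - discCutoff r x * w‖ = 0 := hx0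
      linarith
    refine ⟨p - discCutoff r x * w, ?_, ?_⟩
    · rw [mem_closedBall_zero_iff, hx1]
      exact hx.2
    · change p - discCutoff r x * w + discCutoff r ‖p - discCutoff r x * w‖ * w = p
      rw [hx1, sub_add_cancel]

/-- A contracting linear map near the origin extends to the disc. -/
theorem bijOn_disc_contraction {c : ℂ} (hc : c.re ≤ 0) :
    Set.BijOn (fun z : ℂ => z * Complex.exp (discCutoff r ‖z‖ * c)) (Metric.closedBall 0 1)
      (Metric.closedBall 0 1) := by
  have hnorm : ∀ (z : ℂ) (x : ℝ), ‖z * Complex.exp (discCutoff r x * c)‖ =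
      ‖z‖ * Real.exp (discCutoff r x * c.re) := fun z x => by
    rw [norm_mul, Complex.norm_exp, Complex.re_ofReal_mul]
  -- The norm of the image is a strictly increasing function of the norm, so the norm, and then the
  -- rotation, can be undone.
  have hmono : ∀ x y : ℝ, 0 ≤ x → x < y →
      x * Real.exp (discCutoff r x * c.re) < y * Real.exp (discCutoff r y * c.re) := by
    intro x y hx hxy
    refine mul_lt_mul hxy (Real.exp_le_exp.2 ?_) (Real.exp_pos _) (hx.trans hxy.le)
    exact mul_le_mul_of_nonpos_right (antitone_discCutoff hr hxy.le) hc
  refine ⟨fun z hz => ?_, fun z hz z' hz' hzz => ?_, fun p hp => ?_⟩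
  · rw [mem_closedBall_zero_iff] at hz ⊢
    rw [hnorm]
    refine mul_le_one₀ hz (Real.exp_pos _).le (Real.exp_le_one_iff.2 ?_)
    exact mul_nonpos_of_nonneg_of_nonpos (discCutoff_nonneg hr hz) hc
  · have h1 := congrArg norm hzz
    simp only [hnorm] at h1
    have h2 : ‖z‖ = ‖z'‖ := by
      rcases lt_trichotomy ‖z‖ ‖z'‖ with h | h | h
      · exact absurd h1 (hmono _ _ (norm_nonneg _) h).ne
      · exact h
      · exact absurd h1 (hmono _ _ (norm_nonneg _) h).ne'
    simp only [h2] at hzz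
    exact mul_right_cancel₀ (Complex.exp_ne_zero _) hzz
  · rw [mem_closedBall_zero_iff] at hp
    have hcont : ContinuousOn (fun x : ℝ => x * Real.exp (discCutoff r x * c.re))
        (Set.Icc 0 1) := by
      have := continuous_discCutoff r
      fun_prop
    obtain ⟨x, hx, hx0⟩ := intermediate_value_Icc zero_le_one hcont (show ‖p‖ ∈ _ from
      ⟨by simp, by simpa [discCutoff_one] using hp⟩)
    have hx1 : ‖p * Complex.exp (-(discCutoff r x * c))‖ = x := by
      have h3 : x * Real.exp (discCutoff r x * c.re) = ‖p‖ := hx0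
      rw [norm_mul, Complex.norm_exp, Complex.neg_re, Complex.re_ofReal_mul, ← h3, mul_assoc,
        ← Real.exp_add, add_neg_cancel, Real.exp_zero, mul_one]
    refine ⟨p * Complex.exp (-(discCutoff r x * c)), ?_, ?_⟩
    · rw [mem_closedBall_zero_iff, hx1]
      exact hx.2
    · change p * Complex.exp (-(discCutoff r x * c)) *
        Complex.exp (discCutoff r ‖p * Complex.exp (-(discCutoff r x * c))‖ * c) = p
      rw [hx1, mul_assoc, ← Complex.exp_add, neg_add_cancel, Complex.exp_zero, mul_one]

/-- A self-map of the disc that fixes the boundary and is a given contracting similarity on a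
smaller disc. -/
theorem exists_disc_similarity {u w : ℂ} (hu : u ≠ 0) (h : ‖u‖ + ‖w‖ < 1) :
    ∃ f : ℂ → ℂ, Continuous f ∧
      Set.BijOn f (Metric.closedBall 0 1) (Metric.closedBall 0 1) ∧
      (∀ z, ‖z‖ = 1 → f z = z) ∧ ∀ z, ‖z‖ ≤ r → f z = u * z + w := by
  have hu1 : ‖u‖ < 1 := by linarith [norm_nonneg w]
  have hc : (Complex.log u).re ≤ 0 := by
    rw [Complex.log_re]
    exact Real.log_nonpos (norm_nonneg _) hu1.le
  have h1 := continuous_discCutoff r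
  have h2 := continuous_discCutoff ‖u‖
  refine ⟨_, ?_, (bijOn_disc_translation hu1 h).comp (bijOn_disc_contraction hr hc),
    fun z hz => ?_, fun z hz => ?_⟩
  · refine Continuous.comp (g := fun z : ℂ => z + discCutoff ‖u‖ ‖z‖ * w) ?_ ?_ <;> fun_prop
  · simp [hz, discCutoff_one]
  -- First multiplication by `u`, which lands in the disc of radius ‖u‖, where the second map is the
  -- translation by `w`.
  · have h3 : z * Complex.exp (discCutoff r ‖z‖ * Complex.log u) = u * z := by
      rw [discCutoff_of_le hr hz, Complex.ofReal_one, one_mul, Complex.exp_log hu, mul_comm]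
    have h4 : ‖u * z‖ ≤ ‖u‖ := by
      rw [norm_mul]
      exact mul_le_of_le_one_right (norm_nonneg _) (hz.trans hr.le)
    rw [Function.comp_apply, h3, discCutoff_of_le hu1 h4, Complex.ofReal_one, one_mul]

end DiscCutoff

namespace PolygonMap

variable {g : ℕ} {S : Type*} [TopologicalSpace S]

/-- The quotient map of the standard surface. -/
def diskQuotient (g : ℕ) : Metric.closedBall (0 : ℂ) 1 → GenusSurface g := Quot.mk (sideGluing g)

/-- The polygon map defined by a homeomorphism to the standard surface and a reparametrization of
the disc that fixes the boundary. -/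
def ofHomeomorph (q : S ≃ₜ GenusSurface g)
    (Φ : Metric.closedBall (0 : ℂ) 1 ≃ₜ Metric.closedBall (0 : ℂ) 1)
    (hΦ : ∀ z : Metric.closedBall (0 : ℂ) 1, ‖(z : ℂ)‖ = 1 → Φ z = z) : PolygonMap g S :=
  have hbd : ∀ x, Φ (boundaryPoint g x) = boundaryPoint g x := fun x =>
    hΦ _ (norm_circlePoint g x)
  have hext : ∀ z : Metric.closedBall (0 : ℂ) 1,
      Function.extend Subtype.val (fun z => q.symm (diskQuotient g (Φ z)))
        (fun _ => q.symm (diskQuotient g (boundaryPoint g 0))) (z : ℂ) = q.symm (diskQuotient g (Φ z)) :=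
    fun z => Subtype.val_injective.extend_apply _ _ z
  have hquot : IsQuotientMap fun z : Metric.closedBall (0 : ℂ) 1 =>
      q.symm (diskQuotient g (Φ z)) :=
    q.symm.isQuotientMap.comp (IsQuotientMap.comp (g := diskQuotient g) isQuotientMap_quot_mk Φ.isQuotientMap)
  -- The constant value outside the closed disc is never used.
  { toFun := Function.extend Subtype.val (fun z => q.symm (diskQuotient g (Φ z)))
      (fun _ => q.symm (diskQuotient g (boundaryPoint g 0)))
    continuousOn := by
      rw [continuousOn_iff_continuous_domRestrict]
      exact hquot.continuous.congr fun z => (hext z).symm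
    exists_eq := fun x => by
      obtain ⟨z, hz⟩ := hquot.surjective x
      exact ⟨z, z.2, (hext z).trans hz⟩
    isOpen_of := by
      rintro V ⟨O, hO, h⟩
      rw [← hquot.isOpen_preimage]
      convert hO.preimage (continuous_subtype_val (p := (· ∈ Metric.closedBall (0 : ℂ) 1)))
        using 1
      ext z
      have h1 := Set.ext_iff.1 h z
      simp only [Set.mem_inter_iff, z.2, and_true, Set.mem_preimage] at h1
      rw [hext] at h1
      exact h1
    glue := by
      rintro s ⟨hs1, hs2⟩ t ht
      have h : sideGluing g (boundaryPoint g (s + t)) (boundaryPoint g (s + 3 - t)) := by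
        have hs : (s : ℝ) = 4 * ((s / 4 : ℕ) : ℝ) + ((s % 4 : ℕ) : ℝ) := by
          exact_mod_cast (Nat.div_add_mod s 4).symm
        exact ⟨s / 4, by omega, s % 4, hs2, t, ht, by rw [← hs], by rw [← hs]⟩
      rw [← coe_boundaryPoint, ← coe_boundaryPoint, hext, hext, hbd, hbd]
      exact congrArg q.symm (Quot.sound h)
    eq_of := by
      intro T F hF z hz w hw h
      have h1 : ∀ a b, sideGluing g a b → F (Φ.symm a) = F (Φ.symm b) := by
        rintro _ _ ⟨k, hk, i, hi, t, ht, rfl, rfl⟩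
        rw [Φ.symm_apply_eq.2 (hbd _).symm, Φ.symm_apply_eq.2 (hbd _).symm]
        have h2 := hF (4 * k + i) ⟨by omega, by omega⟩ t ht
        push_cast at h2
        exact h2
      rw [hext ⟨z, hz⟩, hext ⟨w, hw⟩] at h
      have h2 := congrArg (Quot.lift (fun a => F (Φ.symm a)) h1) (q.symm.injective h)
      change F (Φ.symm (Φ _)) = F (Φ.symm (Φ _)) at h2
      rwa [Φ.symm_apply_apply, Φ.symm_apply_apply] at h2 }

theorem ofHomeomorph_apply (q : S ≃ₜ GenusSurface g)
    (Φ : Metric.closedBall (0 : ℂ) 1 ≃ₜ Metric.closedBall (0 : ℂ) 1)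
    (hΦ : ∀ z : Metric.closedBall (0 : ℂ) 1, ‖(z : ℂ)‖ = 1 → Φ z = z)
    (z : Metric.closedBall (0 : ℂ) 1) :
    (ofHomeomorph q Φ hΦ).toFun z = q.symm (diskQuotient g (Φ z)) :=
  Subtype.val_injective.extend_apply (fun z => q.symm (diskQuotient g (Φ z)))
    (fun _ => q.symm (diskQuotient g (boundaryPoint g 0))) z

/-- The polygon map can be changed by a reparametrization of the disc that fixes the boundary. -/
theorem exists_comp_eq (q : S ≃ₜ GenusSurface g) {f : ℂ → ℂ} (hf : Continuous f)
    (hb : Set.BijOn f (Metric.closedBall 0 1) (Metric.closedBall 0 1))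
    (hf1 : ∀ z, ‖z‖ = 1 → f z = z) : ∃ P : PolygonMap g S, ∀ z ∈ Metric.closedBall (0 : ℂ) 1,
      P.toFun (f z) = (ofHomeomorph q (Homeomorph.refl _) fun _ _ => rfl).toFun z := by
  let e : Metric.closedBall (0 : ℂ) 1 ≃ Metric.closedBall (0 : ℂ) 1 := hb.equiv f
  have he : Continuous e := Continuous.subtype_mk (hf.comp continuous_subtype_val) _
  let Θ := he.homeoOfEquivCompactToT2
  have hΘ : ∀ z, (Θ z : ℂ) = f z := fun _ => rfl
  -- Precomposing with the inverse of `f` moves the preimages of points of `S` by `f`.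
  refine ⟨ofHomeomorph q Θ.symm fun z hz => Θ.symm_apply_eq.2 (Subtype.ext ?_), fun z hz => ?_⟩
  · rw [hΘ, hf1 _ hz]
  · rw [← hΘ ⟨z, hz⟩, ofHomeomorph_apply, Θ.symm_apply_apply]
    exact (ofHomeomorph_apply q (Homeomorph.refl _) (fun _ _ => rfl) ⟨z, hz⟩).symm

theorem finite_interior (P : PolygonMap g S) (Y : Finset S) :
    (Metric.ball (0 : ℂ) 1 ∩ P.toFun ⁻¹' Y).Finite := by
  refine Set.Finite.of_finite_image (f := P.toFun) (Y.finite_toSet.subset ?_) ?_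
  · rintro _ ⟨z, hz, rfl⟩
    exact hz.2
  · intro z hz w hw h
    exact P.norm_lt_one_of_eq (by simpa using hz.1) (Metric.ball_subset_closedBall hw.1) h

end PolygonMap

theorem level_add (g s : ℕ) (z w : ℂ) : level g s (z + w) = level g s z + level g s w := by
  simp [level, sideCoord, add_mul]

/-- A generic small complex number separates the levels of finitely many points. -/
theorem exists_small_mul_injOn_level (g s : ℕ) {Z : Set ℂ} (hZ : Z.Finite) {η : ℝ} (hη : 0 < η) :
    ∃ u : ℂ, u ≠ 0 ∧ ‖u‖ < η ∧ Set.InjOn (fun z => level g s (u * z)) Z := by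
  have hfin : ((fun v : ℂ × ℂ => (sideCoord g s (v.1 - v.2)).re / (sideCoord g s (v.1 - v.2)).im)
    '' (Z ×ˢ Z)).Finite := (hZ.prod hZ).image _
  -- Multiplication by 1 + ti identifies the levels of two points only if v.re = t · v.im for their
  -- rotated difference v; so `t` must avoid finitely many ratios.
  obtain ⟨t, ht, htn⟩ := (Set.Ioo_infinite (zero_lt_one' ℝ)).exists_notMem_finite hfin
  have hu0 : (1 + t * Complex.I : ℂ) ≠ 0 := fun h => by
    have := congrArg Complex.re h
    simp at this
  have hδ : ((η / 4 : ℝ) : ℂ) ≠ 0 := by exact_mod_cast (by positivity : η / 4 ≠ 0)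
  refine ⟨(η / 4 : ℝ) * (1 + t * Complex.I), mul_ne_zero hδ hu0, ?_, fun z hz w hw h => ?_⟩
  · have h1 : ‖(1 + t * Complex.I : ℂ)‖ ≤ 2 := by
      refine (norm_add_le _ _).trans ?_
      rw [norm_one, norm_mul, Complex.norm_I, Complex.norm_real, Real.norm_eq_abs,
        abs_of_pos ht.1]
      linarith [ht.2]
    rw [norm_mul, Complex.norm_real, Real.norm_eq_abs, abs_of_pos (by positivity)]
    nlinarith
  · by_contra hne
    set v := sideCoord g s (z - w) with hv
    have hv0 : v ≠ 0 := by
      rw [← norm_ne_zero_iff, hv, norm_sideCoord, norm_ne_zero_iff]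
      exact sub_ne_zero.2 hne
    have h1 : v.re - t * v.im = 0 := by
      have h2 : level g s ((η / 4 : ℝ) * (1 + t * Complex.I) * z) =
        level g s ((η / 4 : ℝ) * (1 + t * Complex.I) * w) := h
      have h3 : (((η / 4 : ℝ) : ℂ) * ((1 + t * Complex.I) * v)).re = 0 := by
        rw [← sub_eq_zero] at h2
        rw [← h2, level, level, ← Complex.sub_re, hv]
        congr 1
        unfold sideCoord
        ring
      rw [Complex.re_ofReal_mul] at h3
      have h4 := (mul_eq_zero.1 h3).resolve_left (by positivity)
      simpa [add_mul, mul_assoc, sub_eq_add_neg] using h4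
    by_cases him : v.im = 0
    · rw [him, mul_zero, sub_zero] at h1
      exact hv0 (Complex.ext h1 him)
    · refine htn ⟨(z, w), ⟨hz, hw⟩, ?_⟩
      change v.re / v.im = t
      rw [div_eq_iff him]
      linarith

/-- Levels along the open side 0 vary injectively, so some point of it avoids `L`; it lies outside
the closures of all other bands. All these conditions are open. -/
theorem exists_generic_point {g : ℕ} (hg : 0 < g) {L : Set ℝ} (hL : L.Finite) :
    ∃ p : ℂ, ‖p‖ = 1 ∧ ∃ ε > 0, ∀ z ∈ Metric.ball p ε, z ∈ PolygonMap.bandSet g 0 ∧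
      level g 0 z ∉ L ∧ ∀ s, IsSide g s → z ∈ PolygonMap.bandSet g s → s = 0 := by
  have hg1 := one_le_cast hg
  have hinj : Set.InjOn (fun t : ℝ => Real.cos ((3 / 2 - t) * (Real.pi / (2 * g))))
      (Set.Ioo 0 1) := by
    refine StrictMonoOn.injOn fun x hx y hy hxy => ?_
    exact (cos_unit_lt_iff hg (by linarith [hx.2]) (by linarith [hx.1]) (by linarith [hy.2])
      (by linarith [hy.1])).2 (by linarith)
  obtain ⟨_, ⟨t, ht, rfl⟩, htL⟩ :=
    ((Set.Ioo_infinite (zero_lt_one' ℝ)).image hinj).exists_notMem_finite hL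
  have hlev : level g 0 (circlePoint g t) = Real.cos ((3 / 2 - t) * (Real.pi / (2 * g))) := by
    rw [level_circlePoint, ← Real.cos_neg]
    congr 1
    push_cast
    ring
  have hopen : IsOpen (PolygonMap.bandSet g 0 ∩ (level g 0 ⁻¹' Lᶜ ∩
      ⋂ s ∈ (Finset.range (4 * g)).erase 0,
        {z | IsSide g s → level g s z ∈ (Set.Icc (loLevel g) (hiLevel g))ᶜ})) := by
    refine (PolygonMap.isOpen_bandSet g 0).inter
      ((hL.isClosed.isOpen_compl.preimage (continuous_level g 0)).inter
        (isOpen_biInter_finset fun s _ => ?_))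
    by_cases hs : IsSide g s
    · simp only [hs, forall_const]
      exact isClosed_Icc.isOpen_compl.preimage (continuous_level g s)
    · simp [hs]
  obtain ⟨ε, hε, hb⟩ := Metric.isOpen_iff.1 hopen (circlePoint g t) (by
    refine ⟨?_, ?_, ?_⟩
    · rw [PolygonMap.bandSet, Set.mem_ofPred_eq, hlev]
      apply level_mem hg
      · rw [lt_abs]; left; linarith [ht.2]
      · rw [abs_lt]; constructor <;> linarith [ht.1, ht.2]
    · rw [Set.mem_preimage, hlev]
      exact htL
    · simp only [Set.mem_iInter]
      intro s hs hside h
      rw [level_circlePoint] at h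
      refine Finset.ne_of_mem_erase hs (side_eq_of_level' hg hside (s' := 0)
        ⟨by omega, by omega⟩ ht ?_).symm
      convert h using 3
      push_cast
      ring)
  refine ⟨circlePoint g t, norm_circlePoint g t, ε, hε, fun z hz => ?_⟩
  obtain ⟨h1, h2, h3⟩ := hb hz
  refine ⟨h1, h2, fun s hs hz => ?_⟩
  by_contra h0
  simp only [Set.mem_iInter] at h3
  exact h3 s (Finset.mem_erase.2 ⟨h0, Finset.mem_range.2 hs.1⟩) hs (Set.Ioo_subset_Icc_self hz)

/-- The surface is left alone and the polygon is reparametrized: a map of the disc fixing the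
boundary shrinks all interior punctures by a generic similarity into a small disc near a generic
point of side 0. -/
theorem exists_goodPosition {g : ℕ} (hg : 0 < g) {S : Type*} [TopologicalSpace S]
    (q : S ≃ₜ GenusSurface g) (Y : Finset S) : ∃ P : PolygonMap g S, P.GoodPosition Y := by
  let P₀ : PolygonMap g S := PolygonMap.ofHomeomorph q (Homeomorph.refl _) fun _ _ => rfl
  have hs0 : IsSide g 0 := ⟨by omega, by omega⟩
  set Z := Metric.ball (0 : ℂ) 1 ∩ P₀.toFun ⁻¹' Y with hZ
  have hZfin : Z.Finite := P₀.finite_interior Y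
  obtain ⟨r, hr, hZr⟩ : ∃ r < 1, ∀ z ∈ Z, ‖z‖ ≤ r := by
    rcases Z.eq_empty_or_nonempty with h | h
    · exact ⟨0, one_pos, by simp [h]⟩
    · obtain ⟨z, hz, hmax⟩ := Set.exists_max_image Z norm hZfin h
      exact ⟨‖z‖, by simpa using hz.1, hmax⟩
  -- The forbidden levels include those of punctures on the boundary; values of `bandInv` at points
  -- outside the band only forbid finitely many more.
  obtain ⟨p, hp, ε, hε, hpε⟩ := exists_generic_point hg
    (Y.finite_toSet.image fun y => (P₀.bandInv 0 y).2)
  -- The new positions are within ‖u‖ + η < 2η ≤ ε of `p`, and ‖u‖ < η keeps the shrunken disc,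
  -- centred at (1 − η)p, inside the unit disc.
  set η := min (ε / 2) (1 / 2) with hη
  have hη0 : 0 < η := by positivity
  have hη1 : η ≤ ε / 2 := min_le_left _ _
  have hη2 : η ≤ 1 / 2 := min_le_right _ _
  obtain ⟨u, hu, huη, hinj⟩ := exists_small_mul_injOn_level g 0 hZfin hη0
  have hw : ‖((1 - η : ℝ) : ℂ) * p‖ = 1 - η := by
    rw [norm_mul, hp, mul_one, Complex.norm_real, Real.norm_eq_abs, abs_of_pos (by linarith)]
  obtain ⟨f, hf, hb, hf1, hfr⟩ := exists_disc_similarity hr hu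
    (w := ((1 - η : ℝ) : ℂ) * p) (by rw [hw]; linarith)
  obtain ⟨P, hP⟩ := PolygonMap.exists_comp_eq q hf hb hf1
  have hint : ∀ z ∈ Metric.ball (0 : ℂ) 1, P.toFun z ∈ Y →
      ∃ z₀ ∈ Z, z = u * z₀ + ((1 - η : ℝ) : ℂ) * p := by
    intro z hz hzY
    obtain ⟨z₀, hz₀, rfl⟩ := hb.surjOn (Metric.ball_subset_closedBall hz)
    have hz₀1 : ‖z₀‖ < 1 := by
      refine lt_of_le_of_ne (by simpa using hz₀) fun h => ?_
      rw [hf1 z₀ h] at hz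
      exact absurd (by simpa using hz) h.not_lt
    have hz₀Z : z₀ ∈ Z := ⟨by simpa using hz₀1, by
      rw [hP z₀ hz₀] at hzY
      exact hzY⟩
    exact ⟨z₀, hz₀Z, hfr z₀ (hZr z₀ hz₀Z)⟩
  have hball : ∀ z₀ ∈ Z, u * z₀ + ((1 - η : ℝ) : ℂ) * p ∈ Metric.ball p ε := by
    intro z₀ hz₀
    rw [mem_ball_iff_norm, show u * z₀ + ((1 - η : ℝ) : ℂ) * p - p = u * z₀ - (η : ℝ) * p by
      push_cast; ring]
    refine (norm_sub_le _ _).trans_lt ?_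
    rw [norm_mul, norm_mul, hp, Complex.norm_real, Real.norm_eq_abs, abs_of_pos hη0, mul_one]
    have : ‖u‖ * ‖z₀‖ ≤ ‖u‖ :=
      mul_le_of_le_one_right (norm_nonneg _) ((hZr z₀ hz₀).trans hr.le)
    linarith
  refine ⟨P, ⟨fun z hz hzY => ?_, fun z hz hzY s hs hzs => ?_, fun z hz hzY w hw hwY h => ?_⟩⟩
  · obtain ⟨z₀, hz₀, rfl⟩ := hint z hz hzY
    exact (hpε _ (hball z₀ hz₀)).1
  · obtain ⟨z₀, hz₀, rfl⟩ := hint z hz hzY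
    exact (hpε _ (hball z₀ hz₀)).2.2 s hs hzs
  · obtain ⟨z₀, hz₀, rfl⟩ := hint z hz hzY
    by_cases hw1 : w ∈ Metric.ball (0 : ℂ) 1
    · obtain ⟨w₀, hw₀, rfl⟩ := hint w hw1 hwY
      rw [level_add, level_add, add_left_inj] at h
      rw [hinj hz₀ hw₀ h]
    · exfalso
      have hwn : ‖w‖ = 1 := le_antisymm (by simpa using hw) (by simpa using hw1)
      obtain ⟨h1, h2, -⟩ := hpε _ (hball z₀ hz₀)
      have hwb : w ∈ PolygonMap.bandSet g 0 := by
        rw [PolygonMap.bandSet, Set.mem_ofPred_eq, ← h]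
        exact h1
      have hPw : P.toFun w = P₀.toFun w := by
        conv_lhs => rw [← hf1 w hwn]
        exact hP w hw
      refine h2 ⟨P.toFun w, hwY, ?_⟩
      change (P₀.bandInv 0 (P.toFun w)).2 = _
      rw [hPw, P₀.bandInv_toFun hg hs0 hw hwb, h]
      rfl

end

end SurfaceMCG

theorem mainTheorem9 (g n : ℕ) (hg : 0 < g)
    {S : Type*} [TopologicalSpace S] [CompactSpace S] [T2Space S] [ConnectedSpace S]
    [ChartedSpace ℂ S] [HasGroupoid S SurfaceMCG.orientationGroupoid]
    (hS : Nonempty (S ≃ₜ SurfaceMCG.GenusSurface g))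
    (Y : Finset S) (hY : Y.card = n) (y₀ : SurfaceMCG.Punctured Y)
    (ρ : SurfaceMCG.PiOne (SurfaceMCG.Punctured Y) y₀ →* SurfaceMCG.Aff)
    (hρ : ∀ a ∈ ρ.range, ∀ b ∈ ρ.range, a * b = b * a) :
    (MulAction.orbit (SurfaceMCG.MappingClassGroup Y) (SurfaceMCG.repClass ρ)).Finite ↔
      (ρ.range : Set SurfaceMCG.Aff).Finite :=
  have ⟨q⟩ := hS
  have ⟨_, hP⟩ := SurfaceMCG.exists_goodPosition hg q Y
  SurfaceMCG.finite_orbit_iff_of_finTriv (hP.finTriv_univ hg) ρ hρ
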